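/- Let $\alpha>0$ and $\Sigma=\{(x_1,0):x_1\in\mathbb R\}\subset\mathbb R^2$. Let $\Gamma\subset\mathbb R^2$ be a Borel set such that (a1) $\Gamma\setminus M=\Sigma\setminus M$ for some compact $M\subset\mathbb R^2$; (a2) $\Gamma\setminus\Sigma=\bigcup_{i=1}^N\Gamma_i$ with $N<\infty$, where each $\Gamma_i$ is a $C^1$ curve of finite length $L_i$, i.e. (with or without its end points) the image of an arc-length parametrization $s\mapsto\Gamma_i(s)$, $C^1$ on $(0,L_i)$ and continuous on $[0,L_i]$, satisfying $|\Gamma_i(s)-\Gamma_i(s')|\ge C_i|s-s'|$ on $(0,L_i)$ for some $C_i>0$ (no self-intersections, no cusps), and no two of the $\Gamma_i$ have a common interior point. For a Borel set $S$, let $l_S$ be the arc length (one-dimensional Hausdorff measure) restricted to $S$. For $S=\Gamma$ and $S=\Sigma$, let $-\Delta_S$ be the operator in $L^2=L^2(\mathbb R^2)$ associated with the form $$\gamma_S(f,g)=(\nabla f,\nabla g)-\alpha\,(I_Sf,I_Sg)_{L^2(l_S)},\qquad f,g\in W^{1,2}(\mathbb R^2),$$ where $I_S:W^{1,2}(\mathbb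 R^2)\to L^2(l_S)$ is the standard embedding (trace), the continuous extension of the restriction map on Schwartz functions. Let $\operatorname{Im}k>0$ and $k^2\notin[-\alpha^2/4,\infty)$. Let $R^k_\Sigma=(-\Delta_\Sigma-k^2)^{-1}$, and let $$G^k_\Sigma(x,y)=\frac1{2\pi}K_0(-ik|x-y|)+\frac{\alpha}{4\pi^3}\int_{\mathbb R^3}\frac{e^{ipx-ip'y}}{(p^2-k^2)(p'^2-k^2)}\,\frac{\tau_k(p_1)}{2\tau_k(p_1)-\alpha}\,dp\,dp_2'$$ be its kernel, where $p=(p_1,p_2)$, $p'=(p_1,p_2')$, $\tau_k(p_1)=(p_1^2-k^2)^{1/2}$ with $\operatorname{Re}\tau_k>0$, and $K_0(z)=\int_0^\infty e^{-z\cosh t}\,dt$ is the Macdonald function. Let $\Lambda=\Gamma\triangle\Sigma$, $\Lambda_0=\Sigma\setminus\Gamma$, $\Lambda_1=\Gamma\setminus\Sigma$, $\nu=l_\Lambda$ and $\mathrm h=L^2(\nu)=L^2(l_{\Lambda_0})\oplus L^2(l_{\Lambda_1})$. Let $\mathrm R^k_{\Sigma,\nu}:\mathrm h\to L^2$ and $\mathrm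 R^k_{\Sigma,\nu\nu}:\mathrm h\to\mathrm h$ be the integral operators $f\mapsto\int G^k_\Sigma(\cdot,y)f(y)\,\nu(dy)$ on their natural domains. Let $(\mathrm R^k_{\Sigma,\nu})^*:L^2\to\mathrm h$ denote the adjoint with respect to the bilinear pairings (the operator with the transposed, not conjugated, kernel), i.e. the Hilbert space adjoint of $\mathrm R^{-\bar k}_{\Sigma,\nu}$; for $k=i\kappa$ it is the Hilbert space adjoint of $\mathrm R^k_{\Sigma,\nu}$. Put $$\Theta^k=-\bigl(\alpha^{-1}\check{\mathbb I}+\mathrm R^k_{\Sigma,\nu\nu}\bigr),\qquad \check{\mathbb I}=\mathbb I_{L^2(l_{\Lambda_0})}\oplus\bigl(-\mathbb I_{L^2(l_{\Lambda_1})}\bigr).$$ **Theorem.** Suppose that $(\Theta^k)^{-1}\in\mathcal B(\mathrm h)$ and that the operator $$R^k_\Gamma=R^k_\Sigma+\mathrm R^k_{\Sigma,\nu}(\Theta^k)^{-1}(\mathrm R^k_{\Sigma,\nu})^*$$ is defined everywhere on $L^2$. Then $k^2$ belongs to the resolvent set of $-\Delta_\Gamma$, and $(-\Delta_\Gamma-k^2)^{-1}=R^k_\Gamma$.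 -/

import Mathlib

open MeasureTheory Filter Topology
open scoped SchwartzMap LineDeriv InnerProductSpace

noncomputable section

namespace LeakyWire

/-- The plane `ℝ²` with its Euclidean norm. -/
abbrev Plane : Type := EuclideanSpace ℝ (Fin 2)

/-- The Hilbert space `L²(ℝ², μ)` of complex functions. -/
abbrev L2 (μ : Measure Plane) : Type := Lp ℂ 2 μ

/-! ### Operators with a domain -/

section Operators

variable {E F G : Type*} [AddCommGroup E] [Module ℂ E] [AddCommGroup F] [Module ℂ F]
  [AddCommGroup G] [Module ℂ G]

/-- The product `g f` of two partially defined operators on its natural domain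
`{x ∈ D(f) : f x ∈ D(g)}`. -/
def opComp (g : F →ₗ.[ℂ] G) (f : E →ₗ.[ℂ] F) : E →ₗ.[ℂ] G :=
  g.comp (f.domRestrict ((g.domain.comap f.toFun).map f.domain.subtype)) (by
    rintro ⟨x, ⟨y, hy, hyx⟩, hx⟩
    have h1 : (f.domRestrict ((g.domain.comap f.toFun).map f.domain.subtype))
        ⟨x, ⟨y, hy, hyx⟩, hx⟩ = f y := LinearPMap.domRestrict_apply hyx.symm
    rw [h1]
    exact hy)

/-- The operator `A - z`, with the domain of `A`. -/
def opShift (A : E →ₗ.[ℂ] E) (z : ℂ) : E →ₗ.[ℂ] E :=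
  A - (z • (LinearMap.id : E →ₗ[ℂ] E)).toPMap ⊤

/-- `(A - z)⁻¹` with domain the range of `A - z`; meaningful when `A - z` is injective. -/
def opResolvent (A : E →ₗ.[ℂ] E) (z : ℂ) : E →ₗ.[ℂ] E := (opShift A z).inverse

end Operators

section Bounded

variable {E : Type*} [NormedAddCommGroup E] [NormedSpace ℂ E]

/-- `A⁻¹` exists and belongs to `𝓑(E)`: some everywhere defined bounded operator is a two-sided
inverse of `A`. -/
def HasBoundedInverse (A : E →ₗ.[ℂ] E) : Prop :=
  ∃ B : E →L[ℂ] E, (∀ y, ∃ h : B y ∈ A.domain, A ⟨B y, h⟩ = y) ∧ ∀ x : A.domain, B (A x) = x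

/-- The resolvent set of `A`. -/
def opResolventSet (A : E →ₗ.[ℂ] E) : Set ℂ := {z | HasBoundedInverse (opShift A z)}

end Bounded

theorem mul_coe_zero (c : Plane → ℂ) (μ : Measure Plane) :
    (fun y => c y * (0 : L2 μ) y) =ᵐ[μ] fun _ => 0 := by
  filter_upwards [Lp.coeFn_zero ℂ 2 μ] with y hy
  rw [hy, Pi.zero_apply, mul_zero]

theorem mul_coe_add (c : Plane → ℂ) {μ : Measure Plane} (f g : L2 μ) :
    (fun y => c y * (f + g : L2 μ) y) =ᵐ[μ] fun y => c y * f y + c y * g y := by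
  filter_upwards [Lp.coeFn_add f g] with y hy
  rw [hy, Pi.add_apply, mul_add]

theorem mul_coe_smul (c : Plane → ℂ) {μ : Measure Plane} (a : ℂ) (f : L2 μ) :
    (fun y => c y * (a • f : L2 μ) y) =ᵐ[μ] fun y => a * (c y * f y) := by
  filter_upwards [Lp.coeFn_smul a f] with y hy
  rw [hy, Pi.smul_apply, smul_eq_mul, mul_left_comm]

/-- The natural domain of the integral operator `L²(μ) → L²(ν)` with kernel `K`: the functions `f`
such that `∫ K(x, y) f(y) μ(dy)` converges absolutely for `ν`-almost every `x` and is, as a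
function of `x`, in `L²(ν)`. -/
def integralOpDomain (K : Plane → Plane → ℂ) (μ ν : Measure Plane) : Submodule ℂ (L2 μ) where
  carrier := {f | (∀ᵐ x ∂ν, Integrable (fun y => K x y * f y) μ) ∧
    MemLp (fun x => ∫ y, K x y * f y ∂μ) 2 ν}
  zero_mem' := by
    refine ⟨.of_forall fun x => (integrable_zero _ _ _).congr (mul_coe_zero (K x) μ).symm, ?_⟩
    refine (MemLp.zero (ε := ℂ)).ae_eq (.of_forall fun x => ?_)
    exact ((integral_congr_ae (mul_coe_zero (K x) μ)).trans (integral_zero _ _)).symm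
  add_mem' := by
    rintro f g ⟨hf, hf'⟩ ⟨hg, hg'⟩
    refine ⟨?_, (hf'.add hg').ae_eq ?_⟩
    · filter_upwards [hf, hg] with x h1 h2
      exact (h1.add h2).congr (mul_coe_add (K x) f g).symm
    · filter_upwards [hf, hg] with x h1 h2
      exact ((integral_congr_ae (mul_coe_add (K x) f g)).trans (integral_add h1 h2)).symm
  smul_mem' := by
    rintro c f ⟨hf, hf'⟩
    refine ⟨?_, (hf'.const_mul c).ae_eq (.of_forall fun x => ?_)⟩
    · filter_upwards [hf] with x h1
      exact (h1.const_mul c).congr (mul_coe_smul (K x) c f).symm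
    · exact ((integral_congr_ae (mul_coe_smul (K x) c f)).trans (integral_const_mul _ _)).symm

theorem integrable_of_mem {K : Plane → Plane → ℂ} {μ ν : Measure Plane} {f : L2 μ}
    (hf : f ∈ integralOpDomain K μ ν) : ∀ᵐ x ∂ν, Integrable (fun y => K x y * f y) μ := hf.1

theorem memLp_integral_of_mem {K : Plane → Plane → ℂ} {μ ν : Measure Plane} {f : L2 μ}
    (hf : f ∈ integralOpDomain K μ ν) : MemLp (fun x => ∫ y, K x y * f y ∂μ) 2 ν := hf.2

/-- The integral operator `L²(μ) → L²(ν)`, `f ↦ ∫ K(·, y) f(y) μ(dy)`, on its natural domain. -/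
def integralOp (K : Plane → Plane → ℂ) (μ ν : Measure Plane) : L2 μ →ₗ.[ℂ] L2 ν where
  domain := integralOpDomain K μ ν
  toFun :=
    { toFun := fun f => (memLp_integral_of_mem f.2).toLp
      map_add' := fun f g => by
        refine Eq.trans ?_ (MemLp.toLp_add (memLp_integral_of_mem f.2)
          (memLp_integral_of_mem g.2))
        refine MemLp.toLp_congr _ _ ?_
        filter_upwards [integrable_of_mem f.2, integrable_of_mem g.2] with x h1 h2
        exact (integral_congr_ae (mul_coe_add (K x) f.1 g.1)).trans (integral_add h1 h2)
      map_smul' := fun c f => by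
        refine Eq.trans ?_ (MemLp.toLp_const_smul c (memLp_integral_of_mem f.2))
        refine MemLp.toLp_congr _ _ (.of_forall fun x => ?_)
        exact (integral_congr_ae (mul_coe_smul (K x) c f.1)).trans (integral_const_mul _ _) }

/-- The natural domain of the multiplication by `m` in `L²(μ)`. -/
def mulOpDomain (m : Plane → ℂ) (μ : Measure Plane) : Submodule ℂ (L2 μ) where
  carrier := {f | MemLp (fun x => m x * f x) 2 μ}
  zero_mem' := (MemLp.zero (ε := ℂ)).ae_eq (mul_coe_zero m μ).symm
  add_mem' := fun {f g} hf hg => (MemLp.add hf hg).ae_eq (mul_coe_add m f g).symm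
  smul_mem' := fun c f hf => (MemLp.const_mul hf c).ae_eq (mul_coe_smul m c f).symm

theorem memLp_mul_of_mem {m : Plane → ℂ} {μ : Measure Plane} {f : L2 μ}
    (hf : f ∈ mulOpDomain m μ) : MemLp (fun x => m x * f x) 2 μ := hf

/-- Multiplication by the function `m` in `L²(μ)`, on its natural domain. -/
def mulOp (m : Plane → ℂ) (μ : Measure Plane) : L2 μ →ₗ.[ℂ] L2 μ where
  domain := mulOpDomain m μ
  toFun :=
    { toFun := fun f => (memLp_mul_of_mem f.2).toLp
      map_add' := fun f g =>
        (MemLp.toLp_congr _ _ (mul_coe_add m f.1 g.1)).trans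
          (MemLp.toLp_add (memLp_mul_of_mem f.2) (memLp_mul_of_mem g.2))
      map_smul' := fun c f =>
        (MemLp.toLp_congr _ _ (mul_coe_smul m c f.1)).trans
          (MemLp.toLp_const_smul c (memLp_mul_of_mem f.2)) }

/-! ### Geometry -/

/-- The straight line `Σ = {(x₁, 0) : x₁ ∈ ℝ}`. -/
def straightLine : Set Plane := {x | x 1 = 0}

/-- A `C¹` curve of finite length `L`, without self-intersections and cusps, parametrized by arc
length over an interval with end points `0`, `L`, which may or may not contain these. -/
structure C1Arc where
  /-- the length -/
  L : ℝ
  L_pos : 0 < L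
  /-- the arc-length parametrization -/
  curve : ℝ → Plane
  /-- the parameter interval -/
  J : Set ℝ
  Ioo_subset : Set.Ioo 0 L ⊆ J
  subset_Icc : J ⊆ Set.Icc 0 L
  continuousOn : ContinuousOn curve (Set.Icc 0 L)
  contDiffOn : ContDiffOn ℝ 1 curve (Set.Ioo 0 L)
  unit_speed : ∀ s ∈ Set.Ioo 0 L, ‖deriv curve s‖ = 1
  chord_arc : ∃ C : ℝ, 0 < C ∧ ∀ s ∈ Set.Ioo 0 L, ∀ s' ∈ Set.Ioo 0 L,
    C * |s - s'| ≤ ‖curve s - curve s'‖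

/-- The points of the curve. -/
def C1Arc.carrier (A : C1Arc) : Set Plane := A.curve '' A.J

/-- The interior points of the curve (its end points removed). -/
def C1Arc.inner (A : C1Arc) : Set Plane := A.curve '' Set.Ioo 0 A.L

/-- `Γ` is a local deformation of the straight line: it coincides with the line outside a compact
set, and off the line it is a finite union of `C¹` curves of finite length no two of which have a
common interior point. -/
structure IsLocalDeformation (Γ : Set Plane) : Prop where
  measurableSet : MeasurableSet Γ
  eq_off_compact : ∃ M : Set Plane, IsCompact M ∧ Γ \ M = straightLine \ M
  decomposition : ∃ (N : ℕ) (A : Fin N → C1Arc), Γ \ straightLine = ⋃ i, (A i).carrier ∧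
    Pairwise fun i j => Disjoint (A i).inner (A j).inner

/-- The Dirac measure on `S`: arc length, i.e. one-dimensional Hausdorff measure, on `S`. -/
def arcMeasure (S : Set Plane) : Measure Plane := (Measure.hausdorffMeasure 1).restrict S

/-! ### The operator `-Δ_Γ` -/

/-- The `j`-th unit vector. -/
def unitVec (j : Fin 2) : Plane := EuclideanSpace.single j 1

/-- `f` belongs to the Sobolev space of functions with square integrable first derivatives, and
`v` is its weak gradient. -/
def HasWeakGradient (f : L2 volume) (v : Fin 2 → L2 volume) : Prop :=
  ∀ j, ∂_{unitVec j} (f : 𝓢'(Plane, ℂ)) = (v j : 𝓢'(Plane, ℂ))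

/-- `t ∈ L²(η)` is the image of the Sobolev function `f`, with weak gradient `v`, under the
standard embedding into `L²(η)`, the continuous extension of the restriction of functions from
Schwartz functions. -/
def IsTrace (η : Measure Plane) (f : L2 volume) (v : Fin 2 → L2 volume) (t : L2 η) : Prop :=
  ∃ φ : ℕ → 𝓢(Plane, ℂ),
    Tendsto (fun n => eLpNorm (fun x => φ n x - f x) 2 volume) atTop (𝓝 0) ∧
    (∀ j, Tendsto (fun n => eLpNorm (fun x => (∂_{unitVec j} (φ n)) x - v j x) 2 volume)
      atTop (𝓝 0)) ∧
    Tendsto (fun n => eLpNorm (fun x => φ n x - t x) 2 η) atTop (𝓝 0)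

theorem tendsto_eLpNorm_add {μ : Measure Plane} (φ ψ : ℕ → 𝓢(Plane, ℂ)) (f g : L2 μ)
    (hf : Tendsto (fun n => eLpNorm (fun x => φ n x - f x) 2 μ) atTop (𝓝 0))
    (hg : Tendsto (fun n => eLpNorm (fun x => ψ n x - g x) 2 μ) atTop (𝓝 0)) :
    Tendsto (fun n => eLpNorm (fun x => (φ n + ψ n) x - (f + g : L2 μ) x) 2 μ) atTop (𝓝 0) := by
  have hsum := hf.add hg
  rw [add_zero] at hsum
  refine tendsto_of_tendsto_of_tendsto_of_le_of_le tendsto_const_nhds hsum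
    (fun n => bot_le) fun n => ?_
  have h0 : (fun x => (φ n + ψ n) x - (f + g : L2 μ) x) =ᵐ[μ]
      (fun x => φ n x - f x) + fun x => ψ n x - g x := by
    filter_upwards [Lp.coeFn_add f g] with x hx
    simp only [hx, Pi.add_apply, add_apply]
    ring
  simp only [eLpNorm_congr_ae h0]
  exact eLpNorm_add_le ((φ n).continuous.aestronglyMeasurable.sub (Lp.aestronglyMeasurable f))
    ((ψ n).continuous.aestronglyMeasurable.sub (Lp.aestronglyMeasurable g)) (by norm_num)

theorem tendsto_eLpNorm_smul {μ : Measure Plane} (c : ℂ) (φ : ℕ → 𝓢(Plane, ℂ)) (f : L2 μ)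
    (hf : Tendsto (fun n => eLpNorm (fun x => φ n x - f x) 2 μ) atTop (𝓝 0)) :
    Tendsto (fun n => eLpNorm (fun x => (c • φ n) x - (c • f : L2 μ) x) 2 μ) atTop (𝓝 0) := by
  have h1 := ENNReal.Tendsto.const_mul (a := ‖c‖ₑ) hf (Or.inr enorm_ne_top)
  rw [mul_zero] at h1
  refine h1.congr fun n => ?_
  have h0 : (fun x => (c • φ n) x - (c • f : L2 μ) x) =ᵐ[μ] c • fun x => φ n x - f x := by
    filter_upwards [Lp.coeFn_smul c f] with x hx
    simp only [hx, Pi.smul_apply, smul_apply, smul_sub]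
  rw [eLpNorm_congr_ae h0, eLpNorm_const_smul]

theorem tendsto_eLpNorm_zero (μ : Measure Plane) :
    Tendsto (fun _ : ℕ => eLpNorm (fun x => (0 : 𝓢(Plane, ℂ)) x - (0 : L2 μ) x) 2 μ)
      atTop (𝓝 0) := by
  refine tendsto_const_nhds.congr fun n => Eq.symm ?_
  rw [← eLpNorm_zero (α := Plane) (ε := ℂ) (p := 2) (μ := μ)]
  refine eLpNorm_congr_ae ?_
  filter_upwards [Lp.coeFn_zero ℂ 2 μ] with x hx
  rw [hx]
  simp

theorem hasWeakGradient_zero : HasWeakGradient 0 0 := fun j => by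
  change ∂_{unitVec j} (Lp.toTemperedDistributionCLM ℂ volume 2 0) =
    Lp.toTemperedDistributionCLM ℂ volume 2 0
  rw [map_zero, LineDeriv.lineDerivOp_zero]

theorem HasWeakGradient.add {f g : L2 volume} {v w : Fin 2 → L2 volume}
    (hf : HasWeakGradient f v) (hg : HasWeakGradient g w) : HasWeakGradient (f + g) (v + w) :=
  fun j => by
  change ∂_{unitVec j} (Lp.toTemperedDistributionCLM ℂ volume 2 (f + g)) =
    Lp.toTemperedDistributionCLM ℂ volume 2 (v j + w j)
  rw [map_add, map_add, LineDeriv.lineDerivOp_add]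
  exact congrArg₂ (· + ·) (hf j) (hg j)

theorem HasWeakGradient.smul {f : L2 volume} {v : Fin 2 → L2 volume} (c : ℂ)
    (hf : HasWeakGradient f v) : HasWeakGradient (c • f) (c • v) := fun j => by
  change ∂_{unitVec j} (Lp.toTemperedDistributionCLM ℂ volume 2 (c • f)) =
    Lp.toTemperedDistributionCLM ℂ volume 2 (c • v j)
  rw [map_smul, map_smul, LineDeriv.lineDerivOp_smul]
  exact congrArg (c • ·) (hf j)

/-- The set of all triples `(f, ∇f, I f)`, where `f` is a Sobolev function and `I f` its embedding
into `L²(η)`. -/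
def sobolevTriples (η : Measure Plane) :
    Submodule ℂ (L2 volume × (Fin 2 → L2 volume) × L2 η) where
  carrier := {p | HasWeakGradient p.1 p.2.1 ∧ IsTrace η p.1 p.2.1 p.2.2}
  zero_mem' := by
    refine ⟨hasWeakGradient_zero, fun _ => 0, tendsto_eLpNorm_zero _, fun j => ?_,
      tendsto_eLpNorm_zero _⟩
    simp only [LineDeriv.lineDerivOp_zero]
    exact tendsto_eLpNorm_zero _
  add_mem' := by
    rintro ⟨f, v, t⟩ ⟨g, w, s⟩ ⟨hf, φ, h1, h2, h3⟩ ⟨hg, ψ, k1, k2, k3⟩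
    refine ⟨hf.add hg, fun n => φ n + ψ n, tendsto_eLpNorm_add φ ψ f g h1 k1, fun j => ?_,
      tendsto_eLpNorm_add φ ψ t s h3 k3⟩
    simp only [LineDeriv.lineDerivOp_add]
    exact tendsto_eLpNorm_add _ _ (v j) (w j) (h2 j) (k2 j)
  smul_mem' := by
    rintro c ⟨f, v, t⟩ ⟨hf, φ, h1, h2, h3⟩
    refine ⟨hf.smul c, fun n => c • φ n, tendsto_eLpNorm_smul c φ f h1, fun j => ?_,
      tendsto_eLpNorm_smul c φ t h3⟩
    simp only [LineDeriv.lineDerivOp_smul]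
    exact tendsto_eLpNorm_smul c _ (v j) (h2 j)

/-- The form `γ(f, g) = (∇f, ∇g) - α (I f, I g)_{L²(η)}` on the Sobolev space, where `p` and `q`
are the triples of `f` and `g`. (The inner product `⟪x, y⟫` is linear in `y`.) -/
def deltaForm (α : ℝ) (η : Measure Plane)
    (p q : L2 volume × (Fin 2 → L2 volume) × L2 η) : ℂ :=
  ∑ j, ⟪q.2.1 j, p.2.1 j⟫_ℂ - (α : ℂ) * ⟪q.2.2, p.2.2⟫_ℂ

theorem deltaForm_add (α : ℝ) (η : Measure Plane)
    (p p' q : L2 volume × (Fin 2 → L2 volume) × L2 η) :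
    deltaForm α η (p + p') q = deltaForm α η p q + deltaForm α η p' q := by
  simp only [deltaForm, Prod.snd_add, Prod.fst_add, Pi.add_apply, inner_add_right,
    Finset.sum_add_distrib]
  ring

theorem deltaForm_smul (α : ℝ) (η : Measure Plane) (c : ℂ)
    (p q : L2 volume × (Fin 2 → L2 volume) × L2 η) :
    deltaForm α η (c • p) q = c * deltaForm α η p q := by
  simp only [deltaForm, Prod.smul_snd, Prod.smul_fst, Pi.smul_apply, inner_smul_right,
    ← Finset.mul_sum]
  ring

/-- The graph of the operator associated with the form `γ`: the pairs `(f, u)` with `f` in the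
form domain and `γ(f, g) = (u, g)` for all `g` in the form domain. -/
def deltaGraph (α : ℝ) (η : Measure Plane) : Submodule ℂ (L2 volume × L2 volume) where
  carrier := {fu | ∃ p ∈ sobolevTriples η, p.1 = fu.1 ∧
    ∀ q ∈ sobolevTriples η, deltaForm α η p q = ⟪q.1, fu.2⟫_ℂ}
  zero_mem' := by
    refine ⟨0, (sobolevTriples η).zero_mem, rfl, fun q _ => ?_⟩
    have h := deltaForm_smul α η 0 0 q
    rw [zero_smul, zero_mul] at h
    exact h.trans (inner_zero_right _).symm
  add_mem' := by
    rintro fu fu' ⟨p, h1, h2, h3⟩ ⟨p', h1', h2', h3'⟩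
    refine ⟨p + p', (sobolevTriples η).add_mem h1 h1', congrArg₂ (· + ·) h2 h2', fun q hq => ?_⟩
    rw [deltaForm_add, h3 q hq, h3' q hq]
    exact (inner_add_right _ _ _).symm
  smul_mem' := by
    rintro c fu ⟨p, h1, h2, h3⟩
    refine ⟨c • p, (sobolevTriples η).smul_mem c h1, congrArg (c • ·) h2, fun q hq => ?_⟩
    rw [deltaForm_smul, h3 q hq]
    exact (inner_smul_right _ _ _).symm

/-- The operator `-Δ - α δ(x - S)`, i.e. the operator in `L²(ℝ²)` associated with the form
`γ(f, g) = (∇f, ∇g) - α (f, g)_{L²(S)}`. -/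
def deltaOperator (α : ℝ) (S : Set Plane) : L2 volume →ₗ.[ℂ] L2 volume :=
  (deltaGraph α (arcMeasure S)).toLinearPMap

/-! ### Kernels -/

/-- The Macdonald function `K₀(z)`, for `Re z > 0`. -/
def macdonaldK0 (z : ℂ) : ℂ := ∫ t in Set.Ioi (0 : ℝ), Complex.exp (-z * (Real.cosh t : ℂ))

/-- The kernel `G^k(x - y)` of the free resolvent `(-Δ - k²)⁻¹`, for `Im k > 0`. -/
def freeKernel (k : ℂ) (x y : Plane) : ℂ :=
  (1 / (2 * (Real.pi : ℂ))) * macdonaldK0 (-(Complex.I * k) * (‖x - y‖ : ℂ))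

/-- `τ_k(p₁) = (p₁² - k²)^{1/2}`, the branch with positive real part. -/
def tau (k : ℂ) (p₁ : ℝ) : ℂ := ((p₁ : ℂ) ^ 2 - k ^ 2) ^ (1 / 2 : ℂ)

/-- The kernel `G^k_Σ(x, y)` of the resolvent of `-Δ_Σ`:
`G^k(x - y) + α / (4 π³) ∫_{ℝ³} e^{ipx - ip'y} / ((p² - k²) (p'² - k²)) ·
τ_k(p₁) / (2 τ_k(p₁) - α) dp dp'₂`, where `p = (p₁, p₂)` and `p' = (p₁, p'₂)`; the integration
variable `q` is `(p₁, p₂, p'₂)`. -/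
def lineKernel (α : ℝ) (k : ℂ) (x y : Plane) : ℂ :=
  freeKernel k x y + (α : ℂ) / (4 * (Real.pi : ℂ) ^ 3) *
    ∫ q : ℝ × ℝ × ℝ,
      Complex.exp (Complex.I * ((q.1 * x 0 + q.2.1 * x 1 : ℝ) : ℂ)
          - Complex.I * ((q.1 * y 0 + q.2.2 * y 1 : ℝ) : ℂ))
        / ((((q.1 ^ 2 + q.2.1 ^ 2 : ℝ) : ℂ) - k ^ 2) * (((q.1 ^ 2 + q.2.2 ^ 2 : ℝ) : ℂ) - k ^ 2))
        * (tau k q.1 / (2 * tau k q.1 - (α : ℂ)))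

/-! ### The operators in the Krein formula -/

/-- The Dirac measure `ν` on `Λ`, the symmetric difference of `Γ` and the line. -/
def nuMeasure (Γ : Set Plane) : Measure Plane := arcMeasure (symmDiff Γ straightLine)

/-- The resolvent `R^k_Σ = (-Δ_Σ - k²)⁻¹`. -/
def lineResolvent (α : ℝ) (k : ℂ) : L2 volume →ₗ.[ℂ] L2 volume :=
  opResolvent (deltaOperator α straightLine) (k ^ 2)

/-- The operator `R^k_{Σ,ν} : L²(ν) → L²(ℝ²)`, `f ↦ G^k_Σ * f ν`. -/
def lineResolventNu (α : ℝ) (k : ℂ) (Γ : Set Plane) : L2 (nuMeasure Γ) →ₗ.[ℂ] L2 volume :=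
  integralOp (lineKernel α k) (nuMeasure Γ) volume

/-- The operator `(R^k_{Σ,ν})^* : L²(ℝ²) → L²(ν)`: the transpose of `R^k_{Σ,ν}`, which has the
kernel `G^k_Σ(x, y)` and not its complex conjugate. As the conjugate of `G^k_Σ` is
`G^{k'}_Σ` with `k' = -conj k`, it is the Hilbert space adjoint of `R^{k'}_{Σ,ν}`. For `k = iκ`
one has `k' = k`. -/
def lineResolventNuStar (α : ℝ) (k : ℂ) (Γ : Set Plane) :
    L2 volume →ₗ.[ℂ] L2 (nuMeasure Γ) :=
  (lineResolventNu α (-(starRingEnd ℂ k)) Γ).adjoint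

/-- The operator `R^k_{Σ,νν}` in `L²(ν)`. -/
def lineResolventNuNu (α : ℝ) (k : ℂ) (Γ : Set Plane) :
    L2 (nuMeasure Γ) →ₗ.[ℂ] L2 (nuMeasure Γ) :=
  integralOp (lineKernel α k) (nuMeasure Γ) (nuMeasure Γ)

open Classical in
/-- The operator `Ǐ` in `L²(ν)`: the identity on `L²` of `Λ₀` (the part of `Λ` on the line), minus
the identity on `L²` of `Λ₁` (the part of `Λ` off the line). -/
def signOp (Γ : Set Plane) : L2 (nuMeasure Γ) →ₗ.[ℂ] L2 (nuMeasure Γ) :=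
  mulOp (fun x => if x ∈ straightLine then 1 else -1) (nuMeasure Γ)

/-- `Θ^k = -(α⁻¹ Ǐ + R^k_{Σ,νν})`. -/
def theta (α : ℝ) (k : ℂ) (Γ : Set Plane) : L2 (nuMeasure Γ) →ₗ.[ℂ] L2 (nuMeasure Γ) :=
  -((α : ℂ)⁻¹ • signOp Γ + lineResolventNuNu α k Γ)

/-- `R^k_Γ = R^k_Σ + R^k_{Σ,ν} (Θ^k)⁻¹ (R^k_{Σ,ν})^*`, on its natural domain. -/
def kreinResolvent (α : ℝ) (k : ℂ) (Γ : Set Plane) : L2 volume →ₗ.[ℂ] L2 volume :=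
  lineResolvent α k +
    opComp (lineResolventNu α k Γ) (opComp (theta α k Γ).inverse (lineResolventNuStar α k Γ))

end LeakyWire

end

/-!
The resolvent formula is checked directly on the operators: every solution of
`(-Δ_Γ - k²) f = u` is produced by it, and it produces only solutions. Three ingredients carry the
argument.

*Traces.* A measure `η` on the plane is of Kato class (`IsKato`) when its potentials `∫ K₀(c|x - y|)
η(dy)` are bounded. Lebesgue measure, arc length on the line and arc length on a `C¹` arc with a
chord-arc bound are of this kind, hence so is arc length on `Γ ∪ Σ` (`IsLocalDeformation.isKato`).
Schur's test, applied to a monotone approximation of the Sobolev weight by integrable multipliers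
whose convolution kernels are dominated by `K₀`, shows that the Fourier transform of `h η`, `h ∈
L²(η)`, lies in the dual of the Sobolev space (`lintegral_hat_sq_le`); by duality this is the trace
inequality `lintegral_invHat_sq_le`. So traces on `η` exist and are unique, and weak equations need
only be tested with Schwartz functions (`IsKato.mem_deltaGraph_iff`). All traces are taken on `Γ ∪
Σ` and restricted from there, so that the equations for `Γ` and for `Σ` concern one and the same
function on `Γ ∪ Σ`.

*Potentials.* For `h ∈ L²(ν)` let `m` be the Fourier transform of `h ν` and `D(p) = 4π²|p|² - k²`
(`symb`, in the normalization `e^{2πi p·x}`). The potential `w = ∫ G^k_Σ(·, y) h(y) ν(dy)` has the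
Fourier transform `(m(p) + A(p₁)) / D(p)` (`potHat`), where the density `A` on the line is chosen so
that the trace of `w` on the line is `A / α` on the Fourier side (`integral_potHat_slice`);
therefore `-Δ_Σ w - k² w = h ν` weakly. To see that the integral kernel, which is singular on the
diagonal, gives this function, `1 / D` is replaced by the integrable multipliers `1 / D - 1 /
(4π²|p|² + l²)`. Their inverse Fourier transforms are differences of two Macdonald kernels
(`fourier_freeKernel`), which converge pointwise off the diagonal as `l → ∞`, while the Fourier
transforms converge in the Sobolev norm. By the trace inequality the pointwise values of the
integral are then the traces of `w`, on every Kato measure (`exists_potential`). In particular the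
integral operators are defined on all of `L²(ν)`.

*Algebra.* The right hand side of the formula being defined on all of `L²`, the operator `-Δ_Σ - k²`
is onto, and, being symmetric up to the shift, also injective (`line_resolvent_injective`). By
Green's formula the transposed operator `(R_{Σ,ν})^*` is the resolvent of the line followed by the
trace on `ν` (`IsLocalDeformation.eq_restrictLp_of_mem_graph`). The integral over `Γ` differs from
the one over `Σ` by an integral over `ν` with the sign `1` on `Σ \ Γ` and `-1` on `Γ \ Σ`
(`integral_arcMeasure_eq`), so `f = R_Σ u + w` solves `(-Δ_Γ - k²) f = u` exactly when the density
of `w` is `h = -α sgn f` on `ν`. Since the trace of `w` is `R_{Σ,νν} h`, this says that `Θ h` is the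
trace of `R_Σ u`, which is the Krein formula. An eigenfunction of `-Δ_Γ` for `k²` is in the same way
the potential of a density in the kernel of `Θ`, so there is none. Thus `-Δ_Γ - k²` is a bijection,
and its inverse is bounded, by the lower bound `|Im k²|` or, for real `k²`, by the
Hellinger-Toeplitz theorem (`IsSymmGraph.mem_opResolventSet`).
-/

noncomputable section

open scoped FourierTransform ENNReal NNReal

namespace LeakyWire

/-! ### One-dimensional integrals -/

/-- A point off the half-line `[b, ∞)` is separated from it, quantitatively at infinity. -/
theorem exists_mul_one_add_le_norm_sub {z : ℂ} {b : ℝ} (hz : ∀ r : ℝ, b ≤ r → z ≠ (r : ℂ)) :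
    ∃ c : ℝ, 0 < c ∧ ∀ r : ℝ, b ≤ r → c * (1 + |r|) ≤ ‖(r : ℂ) - z‖ := by
  have hcl : IsClosed ((fun r : ℝ => (r : ℂ)) '' Set.Ici b) :=
    Complex.isometry_ofReal.isClosedEmbedding.isClosedMap _ isClosed_Ici
  have hne : ((fun r : ℝ => (r : ℂ)) '' Set.Ici b).Nonempty := ⟨_, b, le_refl b, rfl⟩
  have hmem : z ∉ (fun r : ℝ => (r : ℂ)) '' Set.Ici b := by
    rintro ⟨r, hr, hrz⟩
    exact hz r hr hrz.symm
  have hδ := (hcl.notMem_iff_infDist_pos hne).1 hmem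
  set δ := Metric.infDist z ((fun r : ℝ => (r : ℂ)) '' Set.Ici b)
  have hpos : 0 < (1 + ‖z‖) / δ + 1 := by positivity
  refine ⟨((1 + ‖z‖) / δ + 1)⁻¹, inv_pos.2 hpos, fun r hr => ?_⟩
  have h1 : δ ≤ ‖(r : ℂ) - z‖ := by
    rw [← dist_eq_norm, dist_comm]
    exact Metric.infDist_le_dist_of_mem ⟨r, hr, rfl⟩
  have h2 : |r| ≤ ‖z‖ + ‖(r : ℂ) - z‖ := by
    have := norm_add_le z ((r : ℂ) - z)
    simpa using this
  rw [inv_mul_le_iff₀ hpos]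
  have h3 : 1 + ‖z‖ ≤ (1 + ‖z‖) / δ * ‖(r : ℂ) - z‖ := by
    rw [div_mul_eq_mul_div, le_div_iff₀ hδ]
    exact mul_le_mul_of_nonneg_left h1 (by positivity)
  linarith

theorem integrable_exp_neg_mul_abs {μ : ℂ} (hμ : 0 < μ.re) :
    Integrable fun s : ℝ => Complex.exp (-(μ * (|s| : ℝ))) := by
  rw [← integrableOn_univ, ← Set.Iic_union_Ioi (a := (0 : ℝ))]
  refine IntegrableOn.union ?_ ?_
  · refine (integrableOn_exp_mul_complex_Iic hμ 0).congr_fun (fun s hs => ?_) measurableSet_Iic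
    simp [abs_of_nonpos (show s ≤ 0 from hs)]
  · refine (integrableOn_exp_mul_complex_Ioi (a := -μ) (by simpa using hμ) 0).congr_fun
      (fun s hs => ?_) measurableSet_Ioi
    simp [abs_of_pos (show 0 < s from hs)]

theorem lintegral_exp_neg_mul_abs {b : ℝ} (hb : 0 < b) :
    ∫⁻ s : ℝ, ENNReal.ofReal (Real.exp (-(b * |s|))) = ENNReal.ofReal (2 / b) := by
  have h2 : Integrable (fun s : ℝ => Real.exp (-(b * |s|))) := by
    refine (integrable_exp_neg_mul_abs (μ := b) (by simpa using hb)).norm.congr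
      (.of_forall fun s => ?_)
    simp [Complex.norm_exp]
  rw [← ofReal_integral_eq_lintegral_ofReal h2 (.of_forall fun s => (Real.exp_pos _).le)]
  rw [integral_comp_abs (f := fun s => Real.exp (-(b * s)))]
  have h3 := integral_exp_mul_Ioi (a := -b) (by linarith) 0
  simp only [neg_mul] at h3
  rw [h3]
  congr 1
  simp
  rfl

/-- The one-dimensional free resolvent kernel: the Fourier transform of `e^{-μ|s|} / (2μ)` is
`1 / (4π²p² + μ²)`. -/
theorem integral_wave_mul_exp_neg_mul_abs {μ : ℂ} (hμ : 0 < μ.re) (p : ℝ) :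
    ∫ s : ℝ, Complex.exp (((-2 * Real.pi * (s * p) : ℝ) : ℂ) * Complex.I) *
      (Complex.exp (-(μ * (|s| : ℝ))) / (2 * μ)) = 1 / (4 * Real.pi ^ 2 * p ^ 2 + μ ^ 2) := by
  have hμ0 : μ ≠ 0 := fun h => by simp [h] at hμ
  have hint : Integrable fun s : ℝ =>
      Complex.exp (((-2 * Real.pi * (s * p) : ℝ) : ℂ) * Complex.I) *
      (Complex.exp (-(μ * (|s| : ℝ))) / (2 * μ)) := by
    refine ((integrable_exp_neg_mul_abs hμ).div_const _).bdd_mul (c := 1) (by fun_prop) ?_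
    exact .of_forall fun s => (Complex.norm_exp_ofReal_mul_I _).le
  rw [← integral_add_compl (measurableSet_Iic (a := (0 : ℝ))) hint, Set.compl_Iic]
  set q : ℂ := 2 * Real.pi * p * Complex.I with hq
  have hqre : q.re = 0 := by simp [hq]
  have h1 : ∫ s in Set.Iic (0 : ℝ), Complex.exp (((-2 * Real.pi * (s * p) : ℝ) : ℂ) * Complex.I) *
      (Complex.exp (-(μ * (|s| : ℝ))) / (2 * μ)) = (1 / (μ - q)) / (2 * μ) := by
    have := integral_exp_mul_complex_Iic (a := μ - q) (by simpa [hqre] using hμ) 0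
    simp only [Complex.ofReal_zero, mul_zero, Complex.exp_zero] at this
    rw [← this, ← integral_div]
    refine setIntegral_congr_fun measurableSet_Iic fun s hs => ?_
    simp only [mul_div_assoc', ← Complex.exp_add, abs_of_nonpos (show s ≤ 0 from hs)]
    congr 2
    push_cast
    rw [hq]
    ring
  have h2 : ∫ s in Set.Ioi (0 : ℝ), Complex.exp (((-2 * Real.pi * (s * p) : ℝ) : ℂ) * Complex.I) *
      (Complex.exp (-(μ * (|s| : ℝ))) / (2 * μ)) = (1 / (μ + q)) / (2 * μ) := by
    have := integral_exp_mul_complex_Ioi (a := -(μ + q)) (by simpa [hqre] using hμ) 0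
    simp only [Complex.ofReal_zero, mul_zero, Complex.exp_zero, neg_div_neg_eq] at this
    rw [← this, ← integral_div]
    refine setIntegral_congr_fun measurableSet_Ioi fun s hs => ?_
    simp only [mul_div_assoc', ← Complex.exp_add, abs_of_pos (show 0 < s from hs)]
    congr 2
    push_cast
    rw [hq]
    ring
  have h3 : μ - q ≠ 0 := fun h => by
    have := congrArg Complex.re h
    simp [hqre] at this
    exact hμ.ne' this
  have h4 : μ + q ≠ 0 := fun h => by
    have := congrArg Complex.re h
    simp [hqre] at this
    exact hμ.ne' this
  have h5 : (4 * Real.pi ^ 2 * p ^ 2 + μ ^ 2 : ℂ) = (μ - q) * (μ + q) := by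
    rw [hq]
    linear_combination (4 * Real.pi ^ 2 * p ^ 2 : ℂ) * Complex.I_sq
  rw [h1, h2, h5]
  field_simp
  ring

/-! ### The Macdonald function -/

/-- The Macdonald function `K₀(r) = ∫₀^∞ e^{-r cosh t} dt` of a real argument as an extended
nonnegative number. At `r = 0` it is `∞`, so that integrals of `k0` see the diagonal. -/
def k0 (r : ℝ) : ℝ≥0∞ := ∫⁻ t in Set.Ioi (0 : ℝ), ENNReal.ofReal (Real.exp (-(r * Real.cosh t)))

theorem k0_antitone : Antitone k0 := fun r r' h => by
  refine lintegral_mono fun t => ENNReal.ofReal_le_ofReal (Real.exp_le_exp.2 ?_)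
  have := Real.cosh_pos t
  nlinarith

theorem measurable_k0 : Measurable k0 := k0_antitone.measurable

theorem exp_half_le_cosh (t : ℝ) : Real.exp t / 2 ≤ Real.cosh t := by
  rw [Real.cosh_eq]
  have := Real.exp_pos (-t)
  linarith

theorem lintegral_inv_cosh_le :
    ∫⁻ t in Set.Ioi (0 : ℝ), ENNReal.ofReal (1 / Real.cosh t) ≤ 2 := by
  have h1 : IntegrableOn (fun t : ℝ => 2 * Real.exp (-1 * t)) (Set.Ioi 0) :=
    (integrableOn_exp_mul_Ioi (by norm_num) 0).const_mul 2
  calc ∫⁻ t in Set.Ioi (0 : ℝ), ENNReal.ofReal (1 / Real.cosh t)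
      ≤ ∫⁻ t in Set.Ioi (0 : ℝ), ENNReal.ofReal (2 * Real.exp (-1 * t)) := by
        refine lintegral_mono fun t => ENNReal.ofReal_le_ofReal ?_
        rw [div_le_iff₀ (Real.cosh_pos t)]
        have := exp_half_le_cosh t
        have h2 : Real.exp (-1 * t) * Real.exp t = 1 := by rw [← Real.exp_add]; simp
        nlinarith [Real.exp_pos (-1 * t)]
    _ = ENNReal.ofReal (∫ t in Set.Ioi (0 : ℝ), 2 * Real.exp (-1 * t)) :=
        (ofReal_integral_eq_lintegral_ofReal h1
          (.of_forall fun t => by positivity)).symm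
    _ = 2 := by
        rw [integral_const_mul, integral_exp_mul_Ioi (by norm_num)]
        simp

theorem lintegral_k0_abs_le {c : ℝ} (hc : 0 < c) :
    ∫⁻ s : ℝ, k0 (c * |s|) ≤ ENNReal.ofReal (4 / c) := by
  unfold k0
  rw [lintegral_lintegral_swap (by fun_prop)]
  calc ∫⁻ t in Set.Ioi (0 : ℝ), ∫⁻ s : ℝ, ENNReal.ofReal (Real.exp (-(c * |s| * Real.cosh t)))
      = ∫⁻ t in Set.Ioi (0 : ℝ), ENNReal.ofReal (2 / c) * ENNReal.ofReal (1 / Real.cosh t) := by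
        refine lintegral_congr fun t => ?_
        have h := lintegral_exp_neg_mul_abs (b := c * Real.cosh t)
          (mul_pos hc (Real.cosh_pos t))
        rw [← ENNReal.ofReal_mul (by positivity), div_mul_div_comm, mul_one, ← h]
        refine lintegral_congr fun s => ?_
        congr 3
        ring
    _ ≤ ENNReal.ofReal (2 / c) * 2 := by
        rw [lintegral_const_mul _ (by fun_prop)]
        gcongr
        exact lintegral_inv_cosh_le
    _ = ENNReal.ofReal (4 / c) := by
        rw [show (2 : ℝ≥0∞) = ENNReal.ofReal 2 by simp, ← ENNReal.ofReal_mul (by positivity)]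
        congr 1
        ring

theorem k0_le {r : ℝ} (hr : 0 < r) : k0 r ≤ ENNReal.ofReal (2 / r) := by
  calc k0 r ≤ ∫⁻ t in Set.Ioi (0 : ℝ), ENNReal.ofReal (1 / r) * ENNReal.ofReal (1 / Real.cosh t) := by
        refine lintegral_mono fun t => ?_
        rw [← ENNReal.ofReal_mul (by positivity)]
        refine ENNReal.ofReal_le_ofReal ?_
        have h0 : 0 < r * Real.cosh t := mul_pos hr (Real.cosh_pos t)
        rw [div_mul_div_comm, mul_one, Real.exp_neg, one_div]
        exact inv_anti₀ h0 (by linarith [Real.add_one_le_exp (r * Real.cosh t)])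
    _ ≤ ENNReal.ofReal (1 / r) * 2 := by
        rw [lintegral_const_mul _ (by fun_prop)]
        gcongr
        exact lintegral_inv_cosh_le
    _ = ENNReal.ofReal (2 / r) := by
        rw [show (2 : ℝ≥0∞) = ENNReal.ofReal 2 by simp, ← ENNReal.ofReal_mul (by positivity)]
        congr 1
        ring

theorem k0_lt_top {r : ℝ} (hr : 0 < r) : k0 r < ∞ :=
  (k0_le hr).trans_lt ENNReal.ofReal_lt_top

theorem k0_pos (r : ℝ) : 0 < k0 r := by
  unfold k0
  rw [lintegral_pos_iff_support (by fun_prop)]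
  have : (Function.support fun t : ℝ => ENNReal.ofReal (Real.exp (-(r * Real.cosh t)))) =
      Set.univ := by
    ext t
    simp [Real.exp_pos]
  rw [this]
  simp

/-- The integrand is constant on a half-line. -/
theorem k0_zero : k0 0 = ∞ := by simp [k0]

theorem tendsto_k0_mul {r : ℝ} (hr : 0 < r) :
    Tendsto (fun n : ℕ => k0 (n * r)) atTop (𝓝 0) := by
  have h1 : Tendsto (fun n : ℕ => ENNReal.ofReal (2 / (n * r))) atTop (𝓝 0) := by
    rw [← ENNReal.ofReal_zero]
    refine ENNReal.tendsto_ofReal ?_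
    exact tendsto_const_nhds.div_atTop (tendsto_natCast_atTop_atTop.atTop_mul_const hr)
  refine tendsto_of_tendsto_of_tendsto_of_le_of_le' tendsto_const_nhds h1
    (.of_forall fun n => bot_le) ?_
  filter_upwards [eventually_gt_atTop 0] with n hn
  exact k0_le (by positivity)

theorem enorm_macdonaldK0_le (z : ℂ) : ‖macdonaldK0 z‖ₑ ≤ k0 z.re := by
  refine (enorm_integral_le_lintegral_enorm _).trans (lintegral_mono fun t => ?_)
  rw [← ofReal_norm, Complex.norm_exp]
  simp

theorem integrableOn_exp_neg_mul_cosh {z : ℂ} (hz : 0 < z.re) :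
    IntegrableOn (fun t : ℝ => Complex.exp (-z * (Real.cosh t : ℂ))) (Set.Ioi 0) := by
  refine ⟨by fun_prop, ?_⟩
  refine (lintegral_mono fun t => ?_).trans_lt (k0_lt_top hz)
  rw [← ofReal_norm, Complex.norm_exp]
  simp

theorem continuousAt_macdonaldK0 {z : ℂ} (hz : 0 < z.re) : ContinuousAt macdonaldK0 z := by
  refine continuousAt_of_dominated (bound := fun t => Real.exp (-(z.re / 2 * Real.cosh t)))
    (.of_forall fun w => by fun_prop) ?_ ?_ (.of_forall fun t => by fun_prop)
  · have : ∀ᶠ w : ℂ in 𝓝 z, z.re / 2 < w.re :=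
      Complex.continuous_re.continuousAt.eventually (lt_mem_nhds (by linarith))
    filter_upwards [this] with w hw
    refine .of_forall fun t => ?_
    rw [Complex.norm_exp]
    refine Real.exp_le_exp.2 ?_
    have := Real.cosh_pos t
    simp
    nlinarith
  · have h := (integrableOn_exp_neg_mul_cosh (z := ((z.re / 2 : ℝ) : ℂ)) (by simpa using hz)).norm
    refine h.congr (.of_forall fun t => ?_)
    simp only [Complex.norm_exp]
    congr 1
    simp

theorem measurable_macdonaldK0 : Measurable macdonaldK0 := by
  refine StronglyMeasurable.measurable ?_
  unfold macdonaldK0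
  refine StronglyMeasurable.integral_prod_right (f := fun (z : ℂ) (t : ℝ) =>
    Complex.exp (-z * (Real.cosh t : ℂ))) ?_
  refine Continuous.stronglyMeasurable ?_
  unfold Function.uncurry
  fun_prop

/-! ### Fourier transform of the free kernel -/

/-- The coordinates `(a, b) ↦ (a, b)` as a measurable equivalence of `ℝ × ℝ` with the plane. -/
def planeEquiv : ℝ × ℝ ≃ᵐ Plane :=
  MeasurableEquiv.finTwoArrow.symm.trans (MeasurableEquiv.toLp 2 (Fin 2 → ℝ))

@[simp] theorem planeEquiv_zero (z : ℝ × ℝ) : planeEquiv z 0 = z.1 := rfl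

@[simp] theorem planeEquiv_one (z : ℝ × ℝ) : planeEquiv z 1 = z.2 := rfl

theorem measurePreserving_planeEquiv : MeasurePreserving planeEquiv volume volume :=
  ((EuclideanSpace.volume_preserving_symm_measurableEquiv_toLp (Fin 2)).symm).comp
    (volume_preserving_finTwoArrow ℝ).symm

theorem integral_plane {E : Type*} [NormedAddCommGroup E] [NormedSpace ℝ E] (f : Plane → E) :
    ∫ x, f x = ∫ z : ℝ × ℝ, f (planeEquiv z) :=
  (measurePreserving_planeEquiv.integral_comp' f).symm

theorem lintegral_plane (f : Plane → ℝ≥0∞) :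
    ∫⁻ x, f x = ∫⁻ z : ℝ × ℝ, f (planeEquiv z) :=
  (measurePreserving_planeEquiv.lintegral_comp_emb planeEquiv.measurableEmbedding f).symm

theorem integrable_plane {E : Type*} [NormedAddCommGroup E] {f : Plane → E} :
    Integrable f ↔ Integrable fun z : ℝ × ℝ => f (planeEquiv z) :=
  (measurePreserving_planeEquiv.integrable_comp_emb planeEquiv.measurableEmbedding).symm

theorem norm_sq_plane (x : Plane) : ‖x‖ ^ 2 = x 0 ^ 2 + x 1 ^ 2 := by
  rw [EuclideanSpace.norm_sq_eq, Fin.sum_univ_two]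
  simp

theorem norm_planeEquiv (z : ℝ × ℝ) : ‖planeEquiv z‖ = √(z.1 ^ 2 + z.2 ^ 2) := by
  rw [← Real.sqrt_sq (norm_nonneg _), norm_sq_plane, planeEquiv_zero, planeEquiv_one]

theorem inner_plane (x y : Plane) : ⟪x, y⟫_ℝ = x 0 * y 0 + x 1 * y 1 := by
  rw [PiLp.inner_apply, Fin.sum_univ_two]
  simp [mul_comm]

/-- The potential obtained from the three-dimensional Yukawa kernel along a line is the Macdonald
function; the substitution is `u = R sinh t`. -/
theorem macdonaldK0_eq_integral_sqrt {μ : ℂ} (hμ : 0 < μ.re) {R : ℝ} (hR : 0 < R) :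
    macdonaldK0 (μ * R) = (1 / 2) * ∫ u : ℝ, Complex.exp (-(μ * (√(R ^ 2 + u ^ 2) : ℝ))) /
      (√(R ^ 2 + u ^ 2) : ℝ) := by
  set g : ℝ → ℂ := fun u => Complex.exp (-(μ * (√(R ^ 2 + u ^ 2) : ℝ))) / (√(R ^ 2 + u ^ 2) : ℝ)
    with hg
  have hint : Integrable g := by
    have hb : Integrable fun s : ℝ => Real.exp (-(μ.re * |s|)) := by
      refine (integrable_exp_neg_mul_abs hμ).norm.congr (.of_forall fun s => ?_)
      simp [Complex.norm_exp]
    refine (hb.const_mul R⁻¹).mono' (Measurable.aestronglyMeasurable (by fun_prop))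
      (.of_forall fun u => ?_)
    have h1 : R ≤ √(R ^ 2 + u ^ 2) := Real.le_sqrt_of_sq_le (by nlinarith [sq_nonneg u])
    have h2 : |u| ≤ √(R ^ 2 + u ^ 2) :=
      Real.le_sqrt_of_sq_le (by rw [sq_abs]; nlinarith [sq_nonneg R])
    rw [hg, norm_div, Complex.norm_exp, Complex.norm_real, Real.norm_of_nonneg (Real.sqrt_nonneg _),
      div_eq_mul_inv, mul_comm]
    refine mul_le_mul (inv_anti₀ hR h1) (Real.exp_le_exp.2 ?_) (Real.exp_pos _).le (by positivity)
    simp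
    nlinarith
  have h1 : ∫ u : ℝ, g u = 2 * ∫ u in Set.Ioi (0 : ℝ), g u := by
    have h := integral_comp_neg_Iic 0 g
    rw [neg_zero] at h
    rw [← integral_add_compl (measurableSet_Iic (a := (0 : ℝ))) hint, Set.compl_Iic, ← h, two_mul]
    congr 2
    funext u
    simp [hg]
  have h2 : (fun t => R * Real.sinh t) '' Set.Ioi 0 = Set.Ioi 0 := by
    ext u
    constructor
    · rintro ⟨t, ht, rfl⟩
      exact mul_pos hR (Real.sinh_pos_iff.2 ht)
    · intro hu
      refine ⟨Real.arsinh (u / R), Real.arsinh_pos_iff.2 (div_pos hu hR), ?_⟩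
      simp only [Real.sinh_arsinh]
      field_simp
  have h3 := integral_image_eq_integral_abs_deriv_smul (s := Set.Ioi 0)
    (f := fun t => R * Real.sinh t) (f' := fun t => R * Real.cosh t) measurableSet_Ioi
    (fun t _ => ((Real.hasDerivAt_sinh t).const_mul R).hasDerivWithinAt)
    (fun t _ t' _ h => Real.sinh_injective (mul_left_cancel₀ hR.ne' h)) g
  rw [h2] at h3
  rw [h1, h3, macdonaldK0, ← mul_assoc]
  norm_num
  refine setIntegral_congr_fun measurableSet_Ioi fun t _ => ?_
  have h4 : √(R ^ 2 + (R * Real.sinh t) ^ 2) = R * Real.cosh t := by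
    rw [show R ^ 2 + (R * Real.sinh t) ^ 2 = (R * Real.cosh t) ^ 2 by
      rw [mul_pow, mul_pow, Real.cosh_sq]; ring]
    exact Real.sqrt_sq (mul_nonneg hR.le (Real.cosh_pos t).le)
  have h5 : R * Real.cosh t ≠ 0 := (mul_pos hR (Real.cosh_pos t)).ne'
  simp only [hg, h4]
  rw [abs_of_pos hR, abs_of_pos (Real.cosh_pos t), ← Complex.ofReal_mul]
  rw [mul_div_cancel₀ _ (Complex.ofReal_ne_zero.2 h5)]
  congr 1
  push_cast
  ring

theorem integrable_yukawa {μ : ℂ} (hμ : 0 < μ.re) {a : ℝ} (ha : a ≠ 0) :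
    Integrable fun z : ℝ × ℝ => Complex.exp (-(μ * (√(a ^ 2 + (z.1 ^ 2 + z.2 ^ 2)) : ℝ))) /
      (√(a ^ 2 + (z.1 ^ 2 + z.2 ^ 2)) : ℝ) := by
  have hb : Integrable fun s : ℝ => Real.exp (-(μ.re / 2 * |s|)) := by
    refine (integrable_exp_neg_mul_abs (μ := (μ.re / 2 : ℝ)) (by simpa using hμ)).norm.congr
      (.of_forall fun s => ?_)
    simp [Complex.norm_exp]
  refine ((hb.mul_prod hb).const_mul (1 / |a|)).mono' ?_ (.of_forall fun z => ?_)
  · refine Measurable.aestronglyMeasurable ?_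
    fun_prop
  · have h1 : |a| ≤ √(a ^ 2 + (z.1 ^ 2 + z.2 ^ 2)) :=
      Real.le_sqrt_of_sq_le (by rw [sq_abs]; nlinarith [sq_nonneg z.1, sq_nonneg z.2])
    have h2 : |z.1| / 2 + |z.2| / 2 ≤ √(a ^ 2 + (z.1 ^ 2 + z.2 ^ 2)) := by
      refine Real.le_sqrt_of_sq_le ?_
      nlinarith [sq_nonneg (|z.1| - |z.2|), sq_abs z.1, sq_abs z.2, sq_nonneg a]
    rw [norm_div, Complex.norm_exp, Complex.norm_real, Real.norm_of_nonneg (Real.sqrt_nonneg _),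
      ← Real.exp_add, div_eq_mul_inv, mul_comm, one_div]
    refine mul_le_mul (inv_anti₀ (abs_pos.2 ha) h1) (Real.exp_le_exp.2 ?_) (Real.exp_pos _).le
      (by positivity)
    simp
    nlinarith

/-- The integrand is the derivative of `-e^{-μ √(a² + ρ²)} / μ`. -/
theorem integral_radial_yukawa {μ : ℂ} (hμ : 0 < μ.re) {a : ℝ} (ha : a ≠ 0) :
    ∫ ρ in Set.Ioi (0 : ℝ), (ρ : ℂ) * (Complex.exp (-(μ * (√(a ^ 2 + ρ ^ 2) : ℝ))) /
      (√(a ^ 2 + ρ ^ 2) : ℝ)) = Complex.exp (-(μ * (|a| : ℝ))) / μ := by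
  have hμ0 : μ ≠ 0 := fun h => by simp [h] at hμ
  have hpos : ∀ ρ : ℝ, 0 < a ^ 2 + ρ ^ 2 := fun ρ => by positivity
  have hd : ∀ ρ : ℝ, HasDerivAt (fun ρ : ℝ => -Complex.exp (-(μ * (√(a ^ 2 + ρ ^ 2) : ℝ))) / μ)
      ((ρ : ℂ) * (Complex.exp (-(μ * (√(a ^ 2 + ρ ^ 2) : ℝ))) / (√(a ^ 2 + ρ ^ 2) : ℝ))) ρ := by
    intro ρ
    have h1 : HasDerivAt (fun ρ : ℝ => √(a ^ 2 + ρ ^ 2)) (ρ / √(a ^ 2 + ρ ^ 2)) ρ := by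
      have := (((hasDerivAt_id ρ).pow 2).const_add (a ^ 2)).sqrt (hpos ρ).ne'
      refine this.congr_deriv ?_
      simp
      ring
    have h2 := (((h1.ofReal_comp.const_mul μ).neg.cexp).neg).div_const μ
    refine h2.congr_deriv ?_
    have : ((√(a ^ 2 + ρ ^ 2) : ℝ) : ℂ) ≠ 0 :=
      Complex.ofReal_ne_zero.2 (Real.sqrt_pos.2 (hpos ρ)).ne'
    push_cast
    field_simp
    simp only [Pi.neg_apply]
    ring
  have hlim : Tendsto (fun ρ : ℝ => -Complex.exp (-(μ * (√(a ^ 2 + ρ ^ 2) : ℝ))) / μ) atTop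
      (𝓝 0) := by
    have h1 : Tendsto (fun ρ : ℝ => Complex.exp (-(μ * (√(a ^ 2 + ρ ^ 2) : ℝ)))) atTop (𝓝 0) := by
      rw [Complex.tendsto_exp_nhds_zero_iff]
      simp only [Complex.neg_re, Complex.re_mul_ofReal]
      refine tendsto_neg_atTop_atBot.comp (Tendsto.const_mul_atTop hμ ?_)
      refine tendsto_atTop_mono (fun ρ => ?_) tendsto_id
      exact (le_abs_self ρ).trans (Real.le_sqrt_of_sq_le (by rw [sq_abs]; nlinarith [sq_nonneg a]))
    simpa using h1.neg.div_const μ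
  have hint : IntegrableOn (fun ρ : ℝ => (ρ : ℂ) * (Complex.exp (-(μ * (√(a ^ 2 + ρ ^ 2) : ℝ))) /
      (√(a ^ 2 + ρ ^ 2) : ℝ))) (Set.Ioi 0) := by
    have hb : IntegrableOn (fun ρ : ℝ => Real.exp (-μ.re * ρ)) (Set.Ioi 0) :=
      exp_neg_integrableOn_Ioi 0 hμ
    refine hb.mono' (Measurable.aestronglyMeasurable (by fun_prop)) ?_
    filter_upwards [ae_restrict_mem measurableSet_Ioi] with ρ hρ
    have hρ : 0 < ρ := hρ
    have h1 : ρ ≤ √(a ^ 2 + ρ ^ 2) := Real.le_sqrt_of_sq_le (by nlinarith [sq_nonneg a])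
    have h2 : 0 < √(a ^ 2 + ρ ^ 2) := hρ.trans_le h1
    rw [norm_mul, norm_div, Complex.norm_real, Complex.norm_real, Real.norm_of_nonneg hρ.le,
      Real.norm_of_nonneg h2.le, mul_div_left_comm, Complex.norm_exp]
    refine (mul_le_of_le_one_right (Real.exp_pos _).le ((div_le_one h2).2 h1)).trans
      (Real.exp_le_exp.2 ?_)
    simp
    nlinarith
  rw [integral_Ioi_of_hasDerivAt_of_tendsto (hd 0).continuousAt.continuousWithinAt
    (fun ρ _ => hd ρ) hint hlim]
  simp [Real.sqrt_sq_eq_abs]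
  ring

/-- The integral of the planar kernel over one coordinate. In terms of the Yukawa kernel it is an
integral over a plane at distance `|a|` from the origin, taken in polar coordinates. -/
theorem integral_macdonaldK0_sqrt {μ : ℂ} (hμ : 0 < μ.re) {a : ℝ} (ha : a ≠ 0) :
    ∫ y : ℝ, macdonaldK0 (μ * (√(a ^ 2 + y ^ 2) : ℝ)) =
      Real.pi * (Complex.exp (-(μ * (|a| : ℝ))) / μ) := by
  have h1 : ∀ y : ℝ, macdonaldK0 (μ * (√(a ^ 2 + y ^ 2) : ℝ)) = (1 / 2) * ∫ u : ℝ,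
      Complex.exp (-(μ * (√(a ^ 2 + (y ^ 2 + u ^ 2)) : ℝ))) /
        (√(a ^ 2 + (y ^ 2 + u ^ 2)) : ℝ) := fun y => by
    rw [macdonaldK0_eq_integral_sqrt hμ (Real.sqrt_pos.2 (by positivity))]
    simp only [Real.sq_sqrt (show 0 ≤ a ^ 2 + y ^ 2 by positivity), add_assoc]
  simp only [h1]
  rw [integral_const_mul, ← integral_prod _ (integrable_yukawa hμ ha), ← Measure.volume_eq_prod,
    ← integral_comp_polarCoord_symm, polarCoord_target]
  have h2 : ∀ p : ℝ × ℝ, (polarCoord.symm p).1 ^ 2 + (polarCoord.symm p).2 ^ 2 = p.1 ^ 2 :=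
    fun p => by
      simp only [polarCoord_symm_apply]
      nlinarith [Real.sin_sq_add_cos_sq p.2]
  simp only [h2, Complex.real_smul]
  have h3 := setIntegral_prod_mul (μ := (volume : Measure ℝ)) (ν := (volume : Measure ℝ))
    (fun ρ : ℝ => (ρ : ℂ) * (Complex.exp (-(μ * (√(a ^ 2 + ρ ^ 2) : ℝ))) /
      (√(a ^ 2 + ρ ^ 2) : ℝ))) (fun _ => (1 : ℂ)) (Set.Ioi 0) (Set.Ioo (-Real.pi) Real.pi)
  simp only [mul_one] at h3
  rw [Measure.volume_eq_prod, h3, integral_radial_yukawa hμ ha]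
  rw [setIntegral_const, measureReal_def, Real.volume_Ioo, ENNReal.toReal_ofReal
    (by linarith [Real.pi_pos]), Complex.real_smul]
  push_cast
  ring

theorem freeKernel_eq_sub (k : ℂ) (x y : Plane) : freeKernel k x y = freeKernel k (x - y) 0 := by
  simp [freeKernel]

theorem re_neg_I_mul_mul (k : ℂ) (r : ℝ) : (-(Complex.I * k) * (r : ℂ)).re = k.im * r := by
  simp

theorem enorm_freeKernel_le (k : ℂ) (x y : Plane) :
    ‖freeKernel k x y‖ₑ ≤ k0 (k.im * ‖x - y‖) := by
  rw [freeKernel, enorm_mul]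
  have h1 : ‖(1 / (2 * (Real.pi : ℂ)))‖ₑ ≤ 1 := by
    rw [← ofReal_norm, ← ENNReal.ofReal_one]
    refine ENNReal.ofReal_le_ofReal ?_
    rw [norm_div, norm_one, norm_mul, Complex.norm_real, Real.norm_of_nonneg Real.pi_pos.le]
    rw [div_le_one (by norm_num; exact Real.pi_pos)]
    norm_num
    linarith [Real.pi_gt_three]
  refine (mul_le_of_le_one_left bot_le h1).trans ?_
  have h2 := enorm_macdonaldK0_le (-(Complex.I * k) * (‖x - y‖ : ℂ))
  rwa [re_neg_I_mul_mul] at h2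

theorem measurable_freeKernel (k : ℂ) :
    Measurable fun z : Plane × Plane => freeKernel k z.1 z.2 := by
  unfold freeKernel
  exact (measurable_macdonaldK0.comp (by fun_prop)).const_mul _

theorem continuousAt_freeKernel {k : ℂ} (hk : 0 < k.im) {x : Plane} (hx : x ≠ 0) :
    ContinuousAt (fun x => freeKernel k x 0) x := by
  unfold freeKernel
  have h : ContinuousAt macdonaldK0 (-(Complex.I * k) * ((‖x - 0‖ : ℝ) : ℂ)) := by
    refine continuousAt_macdonaldK0 ?_
    rw [re_neg_I_mul_mul, sub_zero]
    exact mul_pos hk (norm_pos_iff.2 hx)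
  exact continuousAt_const.mul
    (h.comp (f := fun x : Plane => -(Complex.I * k) * ((‖x - 0‖ : ℝ) : ℂ)) (by fun_prop))

theorem lintegral_k0_norm_lt_top {c : ℝ} (hc : 0 < c) : ∫⁻ x : Plane, k0 (c * ‖x‖) < ∞ := by
  rw [lintegral_plane]
  have h0 : ∀ z : ℝ × ℝ, k0 (c * ‖planeEquiv z‖) ≤ ∫⁻ t in Set.Ioi (0 : ℝ),
      ENNReal.ofReal (Real.exp (-(c / 2 * Real.cosh t * |z.1|))) *
        ENNReal.ofReal (Real.exp (-(c / 2 * Real.cosh t * |z.2|))) := fun z => by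
    refine lintegral_mono fun t => ?_
    rw [← ENNReal.ofReal_mul (Real.exp_pos _).le, ← Real.exp_add]
    refine ENNReal.ofReal_le_ofReal (Real.exp_le_exp.2 ?_)
    have h2 : |z.1| / 2 + |z.2| / 2 ≤ ‖planeEquiv z‖ := by
      rw [norm_planeEquiv]
      refine Real.le_sqrt_of_sq_le ?_
      nlinarith [sq_nonneg (|z.1| - |z.2|), sq_abs z.1, sq_abs z.2]
    have := mul_le_mul_of_nonneg_left h2 (mul_pos hc (Real.cosh_pos t)).le
    nlinarith
  refine (lintegral_mono h0).trans_lt ?_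
  rw [lintegral_lintegral_swap (by fun_prop)]
  have h1 : ∀ t : ℝ, ∫⁻ z : ℝ × ℝ, ENNReal.ofReal (Real.exp (-(c / 2 * Real.cosh t * |z.1|))) *
      ENNReal.ofReal (Real.exp (-(c / 2 * Real.cosh t * |z.2|))) ≤
      ENNReal.ofReal (16 / c ^ 2) * ENNReal.ofReal (1 / Real.cosh t) := fun t => by
    have hpos : 0 < c / 2 * Real.cosh t := mul_pos (by linarith) (Real.cosh_pos t)
    rw [Measure.volume_eq_prod, lintegral_prod_mul
      (f := fun a : ℝ => ENNReal.ofReal (Real.exp (-(c / 2 * Real.cosh t * |a|))))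
      (g := fun a : ℝ => ENNReal.ofReal (Real.exp (-(c / 2 * Real.cosh t * |a|))))
      (by fun_prop) (by fun_prop), lintegral_exp_neg_mul_abs hpos,
      ← ENNReal.ofReal_mul (by positivity),
      ← ENNReal.ofReal_mul (by positivity)]
    refine ENNReal.ofReal_le_ofReal ?_
    have h3 : 2 / (c / 2 * Real.cosh t) * (2 / (c / 2 * Real.cosh t)) =
        16 / c ^ 2 * (1 / Real.cosh t) * (1 / Real.cosh t) := by
      have := (Real.cosh_pos t).ne'
      field_simp
      norm_num
    rw [h3]
    refine mul_le_of_le_one_right (by have := Real.cosh_pos t; positivity) ?_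
    rw [div_le_one (Real.cosh_pos t)]
    exact Real.one_le_cosh t
  refine (lintegral_mono h1).trans_lt ?_
  rw [lintegral_const_mul _ (by fun_prop)]
  exact ENNReal.mul_lt_top ENNReal.ofReal_lt_top (lintegral_inv_cosh_le.trans_lt (by simp))

theorem integrable_freeKernel {k : ℂ} (hk : 0 < k.im) :
    Integrable fun x => freeKernel k x 0 := by
  refine ⟨((measurable_freeKernel k).comp (measurable_id.prodMk measurable_const)).aestronglyMeasurable,
    (lintegral_mono fun x => ?_).trans_lt (lintegral_k0_norm_lt_top hk)⟩
  simpa using enorm_freeKernel_le k x 0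

/-- The kernel is radial, so a reflection moves `p` to the first axis. The integral over the second
coordinate then leaves the one-dimensional free resolvent kernel. -/
theorem fourier_freeKernel {k : ℂ} (hk : 0 < k.im) (p : Plane) :
    𝓕 (fun x => freeKernel k x 0) p = 1 / (((4 * Real.pi ^ 2 * ‖p‖ ^ 2 : ℝ) : ℂ) - k ^ 2) := by
  set μ : ℂ := -(Complex.I * k) with hμdef
  have hμ : 0 < μ.re := by simpa [hμdef] using hk
  set q : Plane := EuclideanSpace.single 0 ‖p‖ with hq
  have hqp : ‖q‖ = ‖p‖ := by simp [hq]
  set L := (ℝ ∙ (q - p))ᗮ.reflection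
  have hL : L q = p := Submodule.reflection_sub hqp
  have hint := (integrable_freeKernel hk).bdd_mul (c := 1)
    (f := fun x : Plane => Complex.exp ((-2 * Real.pi * ⟪x, q⟫_ℝ : ℝ) * Complex.I)) (by fun_prop)
    (.of_forall fun s => (Complex.norm_exp_ofReal_mul_I _).le)
  rw [Real.fourier_eq', ← L.measurePreserving.integral_comp L.toHomeomorph.measurableEmbedding]
  have h1 : ∀ x, ⟪L x, p⟫_ℝ = ⟪x, q⟫_ℝ := fun x => by
    rw [← hL, LinearIsometryEquiv.inner_map_map]
  have h2 : ∀ x, freeKernel k (L x) 0 = freeKernel k x 0 := fun x => by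
    simp [freeKernel]
  simp only [h1, h2, smul_eq_mul]
  rw [integral_plane, Measure.volume_eq_prod, integral_prod _ (integrable_plane.1 hint)]
  rw [show (((4 * Real.pi ^ 2 * ‖p‖ ^ 2 : ℝ) : ℂ) - k ^ 2) =
    4 * Real.pi ^ 2 * (‖p‖ : ℂ) ^ 2 + μ ^ 2 by
      rw [hμdef]; push_cast; linear_combination - k ^ 2 * Complex.I_sq]
  rw [← integral_wave_mul_exp_neg_mul_abs hμ ‖p‖]
  refine integral_congr_ae ?_
  filter_upwards [Measure.ae_ne volume (0 : ℝ)] with a ha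
  have h3 : ∀ y : ℝ, Complex.exp (((-2 * Real.pi * ⟪planeEquiv (a, y), q⟫_ℝ : ℝ) : ℂ) * Complex.I) *
      freeKernel k (planeEquiv (a, y)) 0 =
      Complex.exp (((-2 * Real.pi * (a * ‖p‖) : ℝ) : ℂ) * Complex.I) * (1 / (2 * (Real.pi : ℂ))) *
        macdonaldK0 (μ * (√(a ^ 2 + y ^ 2) : ℝ)) := fun y => by
    rw [inner_plane, freeKernel, sub_zero, norm_planeEquiv, mul_assoc]
    simp [hq, hμdef, mul_assoc]
  simp only [h3]
  rw [integral_const_mul, integral_macdonaldK0_sqrt hμ ha]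
  have : (Real.pi : ℂ) ≠ 0 := Complex.ofReal_ne_zero.2 Real.pi_pos.ne'
  field_simp

/-- The symbol `4π²|p|² - k²` of `-Δ - k²`. -/
def symb (k : ℂ) (p : Plane) : ℂ := ((4 * Real.pi ^ 2 * ‖p‖ ^ 2 : ℝ) : ℂ) - k ^ 2

theorem continuous_symb (k : ℂ) : Continuous (symb k) := by unfold symb; fun_prop

theorem exists_mul_le_norm_symb {k : ℂ} (hk : ∀ r : ℝ, 0 ≤ r → k ^ 2 ≠ (r : ℂ)) :
    ∃ c : ℝ, 0 < c ∧ ∀ p, c * (1 + ‖p‖ ^ 2) ≤ ‖symb k p‖ := by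
  obtain ⟨c, hc, h⟩ := exists_mul_one_add_le_norm_sub hk
  refine ⟨c, hc, fun p => le_trans ?_ (h (4 * Real.pi ^ 2 * ‖p‖ ^ 2) (by positivity))⟩
  refine mul_le_mul_of_nonneg_left ?_ hc.le
  rw [abs_of_nonneg (by positivity)]
  have h1 : 1 ≤ 4 * Real.pi ^ 2 := by nlinarith [Real.pi_gt_three]
  linarith [mul_le_mul_of_nonneg_right h1 (sq_nonneg ‖p‖)]

theorem symb_ne_zero {k : ℂ} (hk : ∀ r : ℝ, 0 ≤ r → k ^ 2 ≠ (r : ℂ)) (p : Plane) :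
    symb k p ≠ 0 := fun h =>
  hk (4 * Real.pi ^ 2 * ‖p‖ ^ 2) (by positivity) (sub_eq_zero.1 h).symm

/-- For the comparison parameters `k = iκ` the spectral parameter `k² = -κ²` is off `[0, ∞)`. -/
theorem I_mul_sq_ne {κ : ℝ} (hκ : 0 < κ) (r : ℝ) (hr : 0 ≤ r) : (Complex.I * κ) ^ 2 ≠ (r : ℂ) := by
  intro h
  have h1 : ((-κ ^ 2 : ℝ) : ℂ) = r := by
    rw [← h, mul_pow, Complex.I_sq]
    push_cast
    ring
  have := Complex.ofReal_injective h1
  nlinarith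

theorem symb_I_mul (κ : ℝ) (p : Plane) :
    symb (Complex.I * κ) p = ((4 * Real.pi ^ 2 * ‖p‖ ^ 2 + κ ^ 2 : ℝ) : ℂ) := by
  rw [symb, mul_pow, Complex.I_sq]
  push_cast
  ring

theorem one_div_symb_sub {k l : ℂ} (hk : ∀ r : ℝ, 0 ≤ r → k ^ 2 ≠ (r : ℂ))
    (hl : ∀ r : ℝ, 0 ≤ r → l ^ 2 ≠ (r : ℂ)) (p : Plane) :
    1 / symb k p - 1 / symb l p = (k ^ 2 - l ^ 2) / (symb k p * symb l p) := by
  have h1 := symb_ne_zero hk p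
  have h2 := symb_ne_zero hl p
  field_simp
  simp [symb]

theorem integrable_one_div_symb_sub {k l : ℂ} (hk : ∀ r : ℝ, 0 ≤ r → k ^ 2 ≠ (r : ℂ))
    (hl : ∀ r : ℝ, 0 ≤ r → l ^ 2 ≠ (r : ℂ)) :
    Integrable fun p => 1 / symb k p - 1 / symb l p := by
  obtain ⟨c, hc, h⟩ := exists_mul_le_norm_symb hk
  obtain ⟨d, hd, h'⟩ := exists_mul_le_norm_symb hl
  have hb : Integrable fun p : Plane => ((1 : ℝ) + ‖p‖ ^ 2) ^ (-(4 : ℝ) / 2) :=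
    integrable_rpow_neg_one_add_norm_sq (by simp; norm_num)
  refine (hb.const_mul (‖k ^ 2 - l ^ 2‖ / (c * d))).mono' ?_ (.of_forall fun p => ?_)
  · have h1 := continuous_symb k
    have h2 := continuous_symb l
    exact ((continuous_const.div h1 (symb_ne_zero hk)).sub
      (continuous_const.div h2 (symb_ne_zero hl))).aestronglyMeasurable
  · have hp : 0 < 1 + ‖p‖ ^ 2 := by positivity
    rw [one_div_symb_sub hk hl, norm_div, norm_mul, show (-(4 : ℝ) / 2) = -2 by norm_num,
      Real.rpow_neg hp.le, ← div_eq_mul_inv, div_div]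
    refine div_le_div_of_nonneg_left (norm_nonneg _) (by positivity) ?_
    have h3 := mul_le_mul (h p) (h' p) (by positivity) (norm_nonneg _)
    have h4 : (1 + ‖p‖ ^ 2) ^ (2 : ℝ) = (1 + ‖p‖ ^ 2) ^ 2 := by norm_cast
    rw [h4]
    nlinarith

/-- The difference of two free kernels has an absolutely convergent Fourier representation, off the
diagonal. -/
theorem integral_wave_mul_one_div_symb_sub {k l : ℂ} (hki : 0 < k.im) (hli : 0 < l.im)
    (hk : ∀ r : ℝ, 0 ≤ r → k ^ 2 ≠ (r : ℂ)) (hl : ∀ r : ℝ, 0 ≤ r → l ^ 2 ≠ (r : ℂ))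
    {x : Plane} (hx : x ≠ 0) :
    ∫ p, Complex.exp ((2 * Real.pi * ⟪p, x⟫_ℝ : ℝ) * Complex.I) *
      (1 / symb k p - 1 / symb l p) = freeKernel k x 0 - freeKernel l x 0 := by
  have h1 : 𝓕 (fun x => freeKernel k x 0 - freeKernel l x 0) =
      fun p => 1 / symb k p - 1 / symb l p := by
    have h2 : 𝓕 (fun x => freeKernel k x 0 - freeKernel l x 0) =
        𝓕 (fun x => freeKernel k x 0) - 𝓕 (fun x => freeKernel l x 0) := by
      funext p
      simp only [Pi.sub_apply, Real.fourier_eq, smul_sub]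
      rw [integral_sub]
      · exact (Real.fourierIntegral_convergent_iff p).2 (integrable_freeKernel hki)
      · exact (Real.fourierIntegral_convergent_iff p).2 (integrable_freeKernel hli)
    rw [h2]
    funext p
    rw [Pi.sub_apply, fourier_freeKernel hki, fourier_freeKernel hli]
    rfl
  have h3 := ((integrable_freeKernel hki).sub (integrable_freeKernel hli)).fourierInv_fourier_eq
    (f := fun x => freeKernel k x 0 - freeKernel l x 0)
    (by rw [h1]; exact integrable_one_div_symb_sub hk hl)
    ((continuousAt_freeKernel hki hx).sub (continuousAt_freeKernel hli hx))
  rw [h1, Real.fourierInv_eq'] at h3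
  exact h3

/-! ### Measures of Kato class and the trace inequality -/

/-- The measure `η` is of Kato class: the potentials `∫ K₀(c|x - y|) η(dy)` are bounded. -/
def IsKato (η : Measure Plane) : Prop :=
  ∀ c : ℝ, 0 < c → ∃ C : ℝ≥0, ∀ x : Plane, ∫⁻ y, k0 (c * ‖x - y‖) ∂η ≤ C

theorem IsKato.mono {η η' : Measure Plane} (hη : IsKato η) (h : η' ≤ η) : IsKato η' :=
  fun c hc => by
  obtain ⟨C, hC⟩ := hη c hc
  exact ⟨C, fun x => (lintegral_mono' h le_rfl).trans (hC x)⟩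

theorem IsKato.add {η η' : Measure Plane} (hη : IsKato η) (hη' : IsKato η') : IsKato (η + η') :=
  fun c hc => by
  obtain ⟨C, hC⟩ := hη c hc
  obtain ⟨C', hC'⟩ := hη' c hc
  refine ⟨C + C', fun x => ?_⟩
  rw [lintegral_add_measure, ENNReal.coe_add]
  exact add_le_add (hC x) (hC' x)

theorem isKato_zero : IsKato 0 := fun _ _ => ⟨0, fun x => by simp⟩

theorem isKato_volume : IsKato volume := fun c hc => by
  refine ⟨(∫⁻ x : Plane, k0 (c * ‖x‖)).toNNReal, fun x => ?_⟩
  rw [ENNReal.coe_toNNReal (lintegral_k0_norm_lt_top hc).ne]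
  exact (lintegral_sub_left_eq_self (fun y : Plane => k0 (c * ‖y‖)) x).le

theorem IsKato.isLocallyFiniteMeasure {η : Measure Plane} (hη : IsKato η) :
    IsLocallyFiniteMeasure η := by
  refine ⟨fun x => ⟨Metric.ball x 1, Metric.ball_mem_nhds x one_pos, ?_⟩⟩
  obtain ⟨C, hC⟩ := hη 1 one_pos
  have h : k0 1 * η (Metric.ball x 1) ≤ C := by
    refine le_trans ?_ (hC x)
    rw [← setLIntegral_const]
    refine (setLIntegral_mono' measurableSet_ball fun y hy => k0_antitone ?_).trans
      (setLIntegral_le_lintegral _ _)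
    rw [one_mul, ← dist_eq_norm, dist_comm]
    exact (Metric.mem_ball.1 hy).le
  by_contra hcon
  rw [not_lt, top_le_iff] at hcon
  rw [hcon, ENNReal.mul_top (k0_pos 1).ne'] at h
  exact absurd h (by simp)

/-- The plane wave `e^{2πi p·x}`. -/
def wave (p x : Plane) : ℂ := Complex.exp ((2 * Real.pi * ⟪p, x⟫_ℝ : ℝ) * Complex.I)

@[simp] theorem norm_wave (p x : Plane) : ‖wave p x‖ = 1 := Complex.norm_exp_ofReal_mul_I _

@[fun_prop] theorem continuous_wave : Continuous fun z : Plane × Plane => wave z.1 z.2 := by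
  unfold wave
  fun_prop

@[fun_prop] theorem continuous_wave_left (x : Plane) : Continuous fun p => wave p x := by
  unfold wave
  fun_prop

@[fun_prop] theorem continuous_wave_right (p : Plane) : Continuous fun x => wave p x := by
  unfold wave
  fun_prop

theorem conj_wave (p x : Plane) : starRingEnd ℂ (wave p x) = wave p (-x) := by
  rw [wave, wave, ← Complex.exp_conj, map_mul, Complex.conj_I, Complex.conj_ofReal, inner_neg_right]
  congr 1
  push_cast
  ring

theorem wave_mul_wave (p x y : Plane) : wave p x * wave p y = wave p (x + y) := by
  rw [wave, wave, wave, ← Complex.exp_add, inner_add_right]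
  congr 1
  push_cast
  ring

/-- The Fourier transform `∫ e^{-2πi p·y} h(y) η(dy)` of the complex measure `h η`. -/
def hat (η : Measure Plane) (h : Plane → ℂ) (p : Plane) : ℂ := ∫ y, wave p (-y) * h y ∂η

/-- The inverse Fourier transform `∫ e^{2πi p·x} F(p) dp` of an integrable function. -/
def invHat (F : Plane → ℂ) (x : Plane) : ℂ := ∫ p, wave p x * F p

theorem norm_hat_le (η : Measure Plane) (h : Plane → ℂ) (p : Plane) :
    ‖hat η h p‖ ≤ ∫ y, ‖h y‖ ∂η := by
  refine (norm_integral_le_integral_norm _).trans_eq ?_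
  simp

theorem norm_invHat_le (F : Plane → ℂ) (x : Plane) : ‖invHat F x‖ ≤ ∫ p, ‖F p‖ := by
  refine (norm_integral_le_integral_norm _).trans_eq ?_
  simp

theorem integrable_wave_mul {F : Plane → ℂ} {μ : Measure Plane} (hF : Integrable F μ) (x : Plane) :
    Integrable (fun p => wave p x * F p) μ :=
  hF.bdd_mul (c := 1) (by fun_prop) (.of_forall fun p => (norm_wave p x).le)

theorem continuous_invHat {F : Plane → ℂ} (hF : Integrable F) : Continuous (invHat F) := by
  refine continuous_of_dominated (bound := fun p => ‖F p‖)
    (fun x => (integrable_wave_mul hF x).aestronglyMeasurable) (fun x => .of_forall fun p => ?_)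
    hF.norm (.of_forall fun p => by fun_prop)
  simp

theorem continuous_hat {η : Measure Plane} {h : Plane → ℂ} (hh : Integrable h η) :
    Continuous (hat η h) := by
  refine continuous_of_dominated (bound := fun p => ‖h p‖)
    (fun x => (hh.bdd_mul (c := 1) (f := fun y => wave x (-y)) ?_ ?_).aestronglyMeasurable)
    (fun x => .of_forall fun p => ?_) hh.norm (.of_forall fun p => by fun_prop)
  · exact Continuous.aestronglyMeasurable (by fun_prop)
  · simp
  · simp

theorem integral_mul_hat {η : Measure Plane} [SFinite η] {h F : Plane → ℂ} (hh : Integrable h η)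
    (hF : Integrable F) :
    ∫ p, F p * hat η h p = ∫ y, h y * invHat F (-y) ∂η := by
  have hint : Integrable (fun z : Plane × Plane => wave z.1 (-z.2) * (F z.1 * h z.2))
      (volume.prod η) :=
    (hF.mul_prod hh).bdd_mul (c := 1) (Continuous.aestronglyMeasurable (by fun_prop))
      (.of_forall fun z => (norm_wave _ _).le)
  have h1 : ∀ p, F p * hat η h p = ∫ y, wave p (-y) * (F p * h y) ∂η := fun p => by
    rw [hat, ← integral_const_mul]
    congr 1
    funext y
    ring
  have h2 : ∀ y, h y * invHat F (-y) = ∫ p, wave p (-y) * (F p * h y) := fun y => by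
    rw [invHat, ← integral_const_mul]
    congr 1
    funext y
    ring
  simp only [h1, h2]
  exact integral_integral_swap hint

theorem conj_hat (η : Measure Plane) (h : Plane → ℂ) (p : Plane) :
    starRingEnd ℂ (hat η h p) = ∫ y, wave p y * starRingEnd ℂ (h y) ∂η := by
  rw [hat, ← integral_conj]
  simp [conj_wave]

theorem integral_mul_conj_hat {η : Measure Plane} [SFinite η] {h F : Plane → ℂ}
    (hh : Integrable h η) (hF : Integrable F) :
    ∫ p, F p * starRingEnd ℂ (hat η h p) = ∫ y, starRingEnd ℂ (h y) * invHat F y ∂η := by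
  have hh' : Integrable (fun y => starRingEnd ℂ (h y)) η := by
    refine hh.mono (Complex.continuous_conj.comp_aestronglyMeasurable hh.aestronglyMeasurable) ?_
    simp
  have hint : Integrable (fun z : Plane × Plane => wave z.1 z.2 * (F z.1 * starRingEnd ℂ (h z.2)))
      (volume.prod η) :=
    (hF.mul_prod hh').bdd_mul (c := 1) (Continuous.aestronglyMeasurable (by fun_prop))
      (.of_forall fun z => (norm_wave _ _).le)
  have h1 : ∀ p, F p * starRingEnd ℂ (hat η h p) =
      ∫ y, wave p y * (F p * starRingEnd ℂ (h y)) ∂η := fun p => by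
    rw [conj_hat, ← integral_const_mul]
    congr 1
    funext y
    ring
  have h2 : ∀ y, starRingEnd ℂ (h y) * invHat F y =
      ∫ p, wave p y * (F p * starRingEnd ℂ (h y)) := fun y => by
    rw [invHat, ← integral_const_mul]
    congr 1
    funext y
    ring
  simp only [h1, h2]
  exact integral_integral_swap hint

/-- A Fourier multiplier `F` applied to `h η` is the convolution with the inverse transform of `F`.
-/
theorem invHat_mul_hat {η : Measure Plane} [SFinite η] {h F : Plane → ℂ} (hh : Integrable h η)
    (hF : Integrable F) (x : Plane) :
    invHat (fun p => F p * hat η h p) x = ∫ y, h y * invHat F (x - y) ∂η := by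
  have h1 := integral_mul_hat hh (integrable_wave_mul hF x)
  simp only [mul_assoc] at h1
  rw [invHat, h1]
  refine integral_congr_ae (.of_forall fun y => ?_)
  simp only [invHat, ← mul_assoc, wave_mul_wave]
  simp only [sub_eq_add_neg, add_comm]

theorem lintegral_mul_sq_le {α : Type*} [MeasurableSpace α] (μ : Measure α) {f g : α → ℝ≥0∞}
    (hf : AEMeasurable f μ) (hg : AEMeasurable g μ) :
    (∫⁻ a, f a * g a ∂μ) ^ 2 ≤ (∫⁻ a, f a ^ 2 ∂μ) * ∫⁻ a, g a ^ 2 ∂μ := by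
  have h := ENNReal.lintegral_mul_le_Lp_mul_Lq μ Real.HolderConjugate.two_two hf hg
  have h2 := pow_le_pow_left' h 2
  rw [mul_pow] at h2
  have h3 : ∀ a : ℝ≥0∞, (a ^ (1 / (2 : ℝ))) ^ 2 = a := fun a => by
    rw [← ENNReal.rpow_natCast, ← ENNReal.rpow_mul]
    norm_num
  simpa only [h3, Pi.mul_apply, ENNReal.rpow_ofNat] using h2

theorem two_mul_le_sq_add_sq (a b : ℝ≥0∞) : 2 * a * b ≤ a ^ 2 + b ^ 2 := by
  rcases le_total a b with h | h
  · obtain ⟨d, rfl⟩ := exists_add_of_le h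
    calc 2 * a * (a + d) ≤ 2 * a * (a + d) + d ^ 2 := le_self_add
      _ = a ^ 2 + (a + d) ^ 2 := by ring
  · obtain ⟨d, rfl⟩ := exists_add_of_le h
    calc 2 * (b + d) * b ≤ 2 * (b + d) * b + d ^ 2 := le_self_add
      _ = (b + d) ^ 2 + b ^ 2 := by ring

/-- Schur's test for a symmetric kernel. -/
theorem lintegral_schur_le {η : Measure Plane} [SFinite η] {c : ℝ} {C : ℝ≥0∞}
    (hC : ∀ x : Plane, ∫⁻ y, k0 (c * ‖x - y‖) ∂η ≤ C) {a : Plane → ℝ≥0∞} (ha : Measurable a) :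
    ∫⁻ x, ∫⁻ y, a x * a y * (2 * k0 (c * ‖x - y‖)) ∂η ∂η ≤ 2 * C * ∫⁻ x, a x ^ 2 ∂η := by
  have hk : Measurable fun z : Plane × Plane => k0 (c * ‖z.1 - z.2‖) :=
    measurable_k0.comp (by fun_prop)
  have hkx : ∀ x : Plane, Measurable fun y => k0 (c * ‖x - y‖) := fun x =>
    measurable_k0.comp (by fun_prop)
  have hak : Measurable fun z : Plane × Plane => a z.1 ^ 2 * k0 (c * ‖z.1 - z.2‖) :=
    ((ha.comp measurable_fst).pow_const 2).mul hk
  have h1 : ∫⁻ x, ∫⁻ y, a x ^ 2 * k0 (c * ‖x - y‖) ∂η ∂η ≤ C * ∫⁻ x, a x ^ 2 ∂η := by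
    rw [← lintegral_const_mul _ (ha.pow_const 2)]
    refine lintegral_mono fun x => ?_
    rw [lintegral_const_mul _ (hkx x), mul_comm]
    gcongr
    exact hC x
  have h2 : ∫⁻ x, ∫⁻ y, a y ^ 2 * k0 (c * ‖x - y‖) ∂η ∂η ≤ C * ∫⁻ x, a x ^ 2 ∂η := by
    rw [lintegral_lintegral_swap]
    · simpa only [norm_sub_rev] using h1
    · exact (((ha.comp measurable_snd).pow_const 2).mul hk).aemeasurable
  calc ∫⁻ x, ∫⁻ y, a x * a y * (2 * k0 (c * ‖x - y‖)) ∂η ∂η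
      ≤ ∫⁻ x, ((∫⁻ y, a x ^ 2 * k0 (c * ‖x - y‖) ∂η) + ∫⁻ y, a y ^ 2 * k0 (c * ‖x - y‖) ∂η) ∂η := by
        refine lintegral_mono fun x => ?_
        rw [← lintegral_add_left ((hkx x).const_mul _)]
        refine lintegral_mono fun y => ?_
        rw [← add_mul, ← mul_assoc]
        gcongr
        calc a x * a y * 2 = 2 * a x * a y := by ring
          _ ≤ a x ^ 2 + a y ^ 2 := two_mul_le_sq_add_sq _ _
    _ ≤ C * ∫⁻ x, a x ^ 2 ∂η + C * ∫⁻ x, a x ^ 2 ∂η := by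
        rw [lintegral_add_left hak.lintegral_prod_right']
        exact add_le_add h1 h2
    _ = 2 * C * ∫⁻ x, a x ^ 2 ∂η := by ring

/-- The weight `1 + |p|²` of the Sobolev norm on the Fourier side. -/
def sobW (p : Plane) : ℝ≥0∞ := ENNReal.ofReal (1 + ‖p‖ ^ 2)

@[fun_prop] theorem measurable_sobW : Measurable sobW := by unfold sobW; fun_prop

theorem sobW_ne_zero (p : Plane) : sobW p ≠ 0 := by
  rw [sobW, Ne, ENNReal.ofReal_eq_zero, not_le]
  positivity

theorem sobW_ne_top (p : Plane) : sobW p ≠ ∞ := ENNReal.ofReal_ne_top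

/-- The pairing of the Sobolev space with its dual, on the Fourier side. -/
theorem sq_lintegral_mul_le_sobW {f g : Plane → ℝ≥0∞} (hf : AEMeasurable f) (hg : AEMeasurable g) :
    (∫⁻ p, f p * g p) ^ 2 ≤ (∫⁻ p, sobW p * f p ^ 2) * ∫⁻ p, g p ^ 2 * (sobW p)⁻¹ := by
  set u : Plane → ℝ≥0∞ := fun p => sobW p ^ (1 / 2 : ℝ) with hu
  have hum : Measurable u := measurable_sobW.pow_const _
  have hu2 : ∀ p, u p ^ 2 = sobW p := fun p => by
    rw [hu, ← ENNReal.rpow_natCast, ← ENNReal.rpow_mul]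
    norm_num
  have hu0 : ∀ p, u p ≠ 0 := fun p h0 => sobW_ne_zero p (by rw [← hu2, h0]; simp)
  have hut : ∀ p, u p ≠ ∞ := fun p h0 => sobW_ne_top p (by rw [← hu2, h0]; simp)
  have h1 : ∫⁻ p, f p * g p = ∫⁻ p, (u p * f p) * (g p * (u p)⁻¹) := by
    refine lintegral_congr fun p => ?_
    calc f p * g p = (u p * (u p)⁻¹) * (f p * g p) := by
          rw [ENNReal.mul_inv_cancel (hu0 p) (hut p), one_mul]
      _ = _ := by ring
  rw [h1]
  have h2 := lintegral_mul_sq_le volume (hum.aemeasurable.mul hf) (hg.mul hum.inv.aemeasurable)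
  simp only [Pi.mul_apply, Pi.inv_apply, mul_pow, ← ENNReal.inv_pow, hu2] at h2
  exact h2

/-- On the diagonal the bound is trivial, since `k0 0 = ∞`. -/
theorem enorm_invHat_one_div_symb_sub_le {κ κ' : ℝ} (hκ : 0 < κ) (h : κ ≤ κ') (x : Plane) :
    ‖invHat (fun p => 1 / symb (Complex.I * κ) p - 1 / symb (Complex.I * κ') p) x‖ₑ ≤
      2 * k0 (κ * ‖x‖) := by
  have hκ' := hκ.trans_le h
  rcases eq_or_ne x 0 with rfl | hx
  · simp [k0_zero]
  have h1 := integral_wave_mul_one_div_symb_sub (k := Complex.I * κ) (l := Complex.I * κ')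
    (by simpa using hκ) (by simpa using hκ') (I_mul_sq_ne hκ) (I_mul_sq_ne hκ') hx
  have h2 := enorm_freeKernel_le (Complex.I * κ) x 0
  have h3 := enorm_freeKernel_le (Complex.I * κ') x 0
  simp only [Complex.I_mul_im, Complex.ofReal_re, sub_zero] at h2 h3
  unfold invHat wave
  rw [h1, two_mul]
  refine enorm_sub_le.trans (add_le_add h2 (h3.trans (k0_antitone ?_)))
  gcongr

/-- The dual form of the trace inequality: the Fourier transform of `h η` belongs to the weighted
space dual to the Sobolev space. The weight is the increasing limit of the integrable multipliers
`1 / (4π²|p|² + κ²) - 1 / (4π²|p|² + λ²)`, whose convolution kernels are dominated by `K₀`. -/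
theorem lintegral_hat_sq_le {η : Measure Plane} [SFinite η] {C : ℝ≥0∞}
    (hC : ∀ x : Plane, ∫⁻ y, k0 (2 * Real.pi * ‖x - y‖) ∂η ≤ C) {h : Plane → ℂ}
    (hm : Measurable h) (hh : Integrable h η) :
    ∫⁻ p, ‖hat η h p‖ₑ ^ 2 * (sobW p)⁻¹ ≤
      ENNReal.ofReal (4 * Real.pi ^ 2) * (2 * C * ∫⁻ x, ‖h x‖ₑ ^ 2 ∂η) := by
  have hπ := Real.pi_pos
  set κ : ℝ := 2 * Real.pi with hκdef
  have hκ : 0 < κ := by positivity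
  set l : ℕ → ℝ := fun n => κ + n with hl
  have hlκ : ∀ n, κ ≤ l n := fun n => by simp [hl]
  have hl0 : ∀ n, 0 < l n := fun n => hκ.trans_le (hlκ n)
  set r : ℕ → Plane → ℝ := fun n p =>
    1 / (4 * Real.pi ^ 2 * ‖p‖ ^ 2 + κ ^ 2) - 1 / (4 * Real.pi ^ 2 * ‖p‖ ^ 2 + l n ^ 2) with hr
  have hr0 : ∀ n p, 0 ≤ r n p := fun n p => by
    refine sub_nonneg.2 (one_div_le_one_div_of_le (by positivity) ?_)
    have := pow_le_pow_left₀ hκ.le (hlκ n) 2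
    linarith
  have hrs : ∀ n p, ((r n p : ℝ) : ℂ) =
      1 / symb (Complex.I * κ) p - 1 / symb (Complex.I * (l n : ℝ)) p := fun n p => by
    rw [symb_I_mul, symb_I_mul, hr]
    push_cast
    rfl
  have hri : ∀ n, Integrable fun p => ((r n p : ℝ) : ℂ) := fun n => by
    simp only [hrs]
    exact integrable_one_div_symb_sub (I_mul_sq_ne hκ) (I_mul_sq_ne (hl0 n))
  have hmc := continuous_hat hh
  -- the test of Schur bounds the quadratic form of each integrable multiplier, uniformly in `n`
  have hstep : ∀ n, ∫⁻ p, ‖hat η h p‖ₑ ^ 2 * ENNReal.ofReal (r n p) ≤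
      2 * C * ∫⁻ x, ‖h x‖ₑ ^ 2 ∂η := fun n => by
    have hi1 : Integrable fun p => ((r n p : ℝ) : ℂ) * hat η h p :=
      (hri n).mul_bdd (c := ∫ y, ‖h y‖ ∂η) hmc.aestronglyMeasurable
        (.of_forall fun p => norm_hat_le η h p)
    have hi2 : Integrable fun p => ((r n p : ℝ) : ℂ) * hat η h p * starRingEnd ℂ (hat η h p) :=
      hi1.mul_bdd (c := ∫ y, ‖h y‖ ∂η)
        (Complex.continuous_conj.comp hmc).aestronglyMeasurable
        (.of_forall fun p => by simpa using norm_hat_le η h p)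
    have h1 : ∫⁻ p, ‖hat η h p‖ₑ ^ 2 * ENNReal.ofReal (r n p) =
        ‖∫ p, ((r n p : ℝ) : ℂ) * hat η h p * starRingEnd ℂ (hat η h p)‖ₑ := by
      have h2 : ∀ p, ((r n p : ℝ) : ℂ) * hat η h p * starRingEnd ℂ (hat η h p) =
          ((r n p * ‖hat η h p‖ ^ 2 : ℝ) : ℂ) := fun p => by
        rw [mul_assoc, Complex.mul_conj, Complex.normSq_eq_norm_sq]
        push_cast
        ring
      have h3 : Integrable fun p => r n p * ‖hat η h p‖ ^ 2 := by
        simp only [h2] at hi2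
        exact hi2.re
      have h4 : ∀ p, 0 ≤ r n p * ‖hat η h p‖ ^ 2 := fun p => mul_nonneg (hr0 n p) (sq_nonneg _)
      simp only [h2]
      rw [integral_complex_ofReal, ← ofReal_norm, Complex.norm_real,
        Real.norm_of_nonneg (integral_nonneg h4),
        ofReal_integral_eq_lintegral_ofReal h3 (.of_forall h4)]
      refine lintegral_congr fun p => ?_
      rw [ENNReal.ofReal_mul (hr0 n p), ENNReal.ofReal_pow (norm_nonneg _), ofReal_norm, mul_comm]
    rw [h1, integral_mul_conj_hat hh hi1]
    refine le_trans ?_ (lintegral_schur_le hC (a := fun x => ‖h x‖ₑ) (by fun_prop))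
    refine (enorm_integral_le_lintegral_enorm _).trans (lintegral_mono fun x => ?_)
    rw [invHat_mul_hat hh (hri n), enorm_mul]
    simp only [mul_assoc]
    have hme : Measurable fun y => ‖h y‖ₑ * (2 * k0 (κ * ‖x - y‖)) :=
      hm.enorm.mul ((measurable_k0.comp (by fun_prop)).const_mul _)
    rw [lintegral_const_mul _ hme]
    refine mul_le_mul' (by simp) ?_
    refine (enorm_integral_le_lintegral_enorm _).trans (lintegral_mono fun y => ?_)
    rw [enorm_mul]
    refine mul_le_mul' le_rfl ?_
    simp only [hrs]
    exact enorm_invHat_one_div_symb_sub_le hκ (hlκ n) _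
  -- the multipliers increase to `1 / (4π²(|p|² + 1))`, as `κ = 2π`
  have hlim : ∀ p, Tendsto (fun n => ‖hat η h p‖ₑ ^ 2 * ENNReal.ofReal (r n p)) atTop
      (𝓝 (‖hat η h p‖ₑ ^ 2 * ENNReal.ofReal (1 / (4 * Real.pi ^ 2 * ‖p‖ ^ 2 + κ ^ 2)))) :=
    fun p => by
    refine ENNReal.Tendsto.const_mul (ENNReal.tendsto_ofReal ?_) (Or.inr (by finiteness))
    have h1 : Tendsto (fun n => 4 * Real.pi ^ 2 * ‖p‖ ^ 2 + l n ^ 2) atTop atTop := by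
      refine tendsto_atTop_add_const_left _ _ ((tendsto_pow_atTop two_ne_zero).comp ?_)
      exact tendsto_atTop_add_const_left _ _ tendsto_natCast_atTop_atTop
    have h2 := (tendsto_const_nhds (x := 1 / (4 * Real.pi ^ 2 * ‖p‖ ^ 2 + κ ^ 2))).sub
      ((tendsto_const_nhds (x := (1 : ℝ))).div_atTop h1)
    rwa [sub_zero] at h2
  have hmm := hmc.measurable
  have hrm : ∀ n, Measurable fun p => ‖hat η h p‖ₑ ^ 2 * ENNReal.ofReal (r n p) := fun n => by
    simp only [hr]
    fun_prop
  have hfatou := lintegral_liminf_le (μ := volume) (u := atTop) hrm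
  simp only [(hlim _).liminf_eq] at hfatou
  have hb : ∫⁻ p, ‖hat η h p‖ₑ ^ 2 * ENNReal.ofReal (1 / (4 * Real.pi ^ 2 * ‖p‖ ^ 2 + κ ^ 2)) ≤
      2 * C * ∫⁻ x, ‖h x‖ₑ ^ 2 ∂η :=
    hfatou.trans ((liminf_le_liminf (.of_forall hstep)).trans_eq
      (tendsto_const_nhds (x := 2 * C * ∫⁻ x, ‖h x‖ₑ ^ 2 ∂η)).liminf_eq)
  refine le_trans (le_of_eq ?_) (mul_le_mul' le_rfl hb)
  rw [← lintegral_const_mul _ (by fun_prop)]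
  refine lintegral_congr fun p => ?_
  rw [mul_left_comm, ← ENNReal.ofReal_mul (by positivity), sobW,
    ← ENNReal.ofReal_inv_of_pos (by positivity)]
  congr 2
  rw [hκdef]
  have : 0 < 1 + ‖p‖ ^ 2 := by positivity
  field_simp
  ring

/-- The trace inequality on the Fourier side: for a measure of Kato class, the `L²(η)` norm of the
inverse Fourier transform of `F` is controlled by the Sobolev norm. -/
theorem lintegral_invHat_sq_le {η : Measure Plane} [IsLocallyFiniteMeasure η] {C : ℝ≥0}
    (hC : ∀ x : Plane, ∫⁻ y, k0 (2 * Real.pi * ‖x - y‖) ∂η ≤ C) {F : Plane → ℂ}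
    (hF : Integrable F) :
    ∫⁻ x, ‖invHat F x‖ₑ ^ 2 ∂η ≤
      ENNReal.ofReal (4 * Real.pi ^ 2) * (2 * C) * ∫⁻ p, sobW p * ‖F p‖ₑ ^ 2 := by
  set K : ℝ≥0∞ := ENNReal.ofReal (4 * Real.pi ^ 2) * (2 * C)
  set N : ℝ≥0∞ := ∫⁻ p, sobW p * ‖F p‖ₑ ^ 2
  have hfc := continuous_invHat hF
  -- on a ball the left hand side `X` is finite, and can be divided out of `X² ≤ N K X`
  have hball : ∀ n : ℕ, ∫⁻ x in Metric.ball 0 n, ‖invHat F x‖ₑ ^ 2 ∂η ≤ K * N := fun n => by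
    set S : Set Plane := Metric.ball 0 n
    have hS : MeasurableSet S := measurableSet_ball
    have hSη : η S < ∞ := measure_ball_lt_top
    set X := ∫⁻ x in S, ‖invHat F x‖ₑ ^ 2 ∂η
    have hb : ∀ x, ‖invHat F x‖ₑ ≤ ENNReal.ofReal (∫ p, ‖F p‖) := fun x => by
      rw [← ofReal_norm]
      exact ENNReal.ofReal_le_ofReal (norm_invHat_le F x)
    have hX : X < ∞ := by
      calc X ≤ ∫⁻ x in S, ENNReal.ofReal (∫ p, ‖F p‖) ^ 2 ∂η :=
            lintegral_mono fun x => pow_le_pow_left' (hb x) 2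
        _ < ∞ := by
            rw [setLIntegral_const]
            exact ENNReal.mul_lt_top (by finiteness) hSη
    set h : Plane → ℂ := S.indicator (invHat F) with hh
    have hhm : Measurable h := hfc.measurable.indicator hS
    have hhi : Integrable h η := by
      rw [hh, integrable_indicator_iff hS]
      refine Measure.integrableOn_of_bounded hSη.ne hfc.aestronglyMeasurable (M := ∫ p, ‖F p‖) ?_
      exact .of_forall fun x => norm_invHat_le F x
    have hhX : ∫⁻ x, ‖h x‖ₑ ^ 2 ∂η = X := by
      rw [show X = ∫⁻ x, S.indicator (fun x => ‖invHat F x‖ₑ ^ 2) x ∂η from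
        (lintegral_indicator hS _).symm]
      refine lintegral_congr fun x => ?_
      by_cases hx : x ∈ S <;> simp [hh, hx]
    have hdual := lintegral_hat_sq_le hC hhm hhi
    rw [hhX, ← mul_assoc] at hdual
    -- `X` is the pairing of `F` with the transform of the measure `h η`
    have h1 : X = ‖∫ y, starRingEnd ℂ (h y) * invHat F y ∂η‖ₑ := by
      have h2 : ∀ y, starRingEnd ℂ (h y) * invHat F y = ((‖h y‖ ^ 2 : ℝ) : ℂ) := fun y => by
        by_cases hy : y ∈ S
        · simp only [hh, Set.indicator_of_mem hy]
          rw [mul_comm, Complex.mul_conj, Complex.normSq_eq_norm_sq]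
        · simp [hh, hy]
      have h3 : Integrable (fun y => ‖h y‖ ^ 2) η := by
        refine ⟨by fun_prop, ?_⟩
        refine lt_of_eq_of_lt ?_ (hhX.trans_lt hX)
        exact lintegral_congr fun y => by simp
      simp only [h2]
      rw [integral_complex_ofReal, ← ofReal_norm, Complex.norm_real,
        Real.norm_of_nonneg (integral_nonneg fun y => sq_nonneg _),
        ofReal_integral_eq_lintegral_ofReal h3 (.of_forall fun y => sq_nonneg _), ← hhX]
      exact lintegral_congr fun y => by rw [ENNReal.ofReal_pow (norm_nonneg _), ofReal_norm]
    rw [← integral_mul_conj_hat hhi hF] at h1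
    have hmc := (continuous_hat hhi).measurable
    have h4 : X ^ 2 ≤ N * (K * X) := by
      have h5 : X ≤ ∫⁻ p, ‖F p‖ₑ * ‖hat η h p‖ₑ := by
        rw [h1]
        refine (enorm_integral_le_lintegral_enorm _).trans_eq (lintegral_congr fun p => ?_)
        rw [enorm_mul, RCLike.enorm_conj]
      exact (pow_le_pow_left' h5 2).trans ((sq_lintegral_mul_le_sobW hF.aestronglyMeasurable.enorm
        (by fun_prop)).trans (mul_le_mul' le_rfl hdual))
    rcases eq_or_ne X 0 with h0 | h0
    · rw [h0]; exact bot_le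
    · rw [pow_two, ← mul_assoc] at h4
      have := (ENNReal.mul_le_mul_iff_left h0 hX.ne).1 h4
      rwa [mul_comm K N]
  have hU : ⋃ n : ℕ, Metric.ball (0 : Plane) n = Set.univ := Metric.iUnion_ball_nat 0
  rw [← setLIntegral_univ, ← hU, setLIntegral_iUnion_of_directed]
  · exact iSup_le hball
  · refine Monotone.directed_le fun m n hmn => Metric.ball_subset_ball ?_
    exact_mod_cast hmn

/-! ### Schwartz functions in the Sobolev norm -/

theorem eLpNorm_two_sq {α : Type*} [MeasurableSpace α] (μ : Measure α) (f : α → ℂ) :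
    eLpNorm f 2 μ ^ 2 = ∫⁻ x, ‖f x‖ₑ ^ 2 ∂μ := by
  rw [eLpNorm_eq_lintegral_rpow_enorm_toReal two_ne_zero ENNReal.ofNat_ne_top,
    ← ENNReal.rpow_natCast, ← ENNReal.rpow_mul]
  simp

theorem tendsto_sq_zero_iff {u : ℕ → ℝ≥0∞} :
    Tendsto (fun n => u n ^ 2) atTop (𝓝 0) ↔ Tendsto u atTop (𝓝 0) := by
  constructor
  · intro h
    have h1 := h.ennrpow_const (1 / 2 : ℝ)
    rw [ENNReal.zero_rpow_of_pos (by norm_num)] at h1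
    refine h1.congr fun n => ?_
    rw [← ENNReal.rpow_natCast, ← ENNReal.rpow_mul]
    norm_num
  · intro h
    simpa using ENNReal.Tendsto.pow (n := 2) h

theorem tendsto_eLpNorm_two_iff {μ : Measure Plane} {f : ℕ → Plane → ℂ} :
    Tendsto (fun n => eLpNorm (f n) 2 μ) atTop (𝓝 0) ↔
      Tendsto (fun n => ∫⁻ x, ‖f n x‖ₑ ^ 2 ∂μ) atTop (𝓝 0) := by
  simp only [← eLpNorm_two_sq]
  exact tendsto_sq_zero_iff.symm

theorem memLp_two_iff {μ : Measure Plane} {f : Plane → ℂ} (hf : AEStronglyMeasurable f μ) :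
    MemLp f 2 μ ↔ ∫⁻ x, ‖f x‖ₑ ^ 2 ∂μ < ∞ := by
  rw [← eLpNorm_two_sq, MemLp, and_iff_right hf]
  constructor
  · intro h; exact ENNReal.pow_lt_top h
  · intro h
    by_contra hcon
    rw [not_lt, top_le_iff] at hcon
    simp [hcon] at h

theorem tendsto_toLp_iff {φ : ℕ → 𝓢(Plane, ℂ)} {f : L2 volume} :
    Tendsto (fun n => (φ n).toLp 2 volume) atTop (𝓝 f) ↔
      Tendsto (fun n => eLpNorm (fun x => φ n x - f x) 2 volume) atTop (𝓝 0) := by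
  rw [Lp.tendsto_Lp_iff_tendsto_eLpNorm']
  refine tendsto_congr fun n => eLpNorm_congr_ae ?_
  filter_upwards [(φ n).coeFn_toLp 2 volume] with x hx
  simp [hx]

theorem invHat_fourier (φ : 𝓢(Plane, ℂ)) (x : Plane) : invHat (𝓕 φ : 𝓢(Plane, ℂ)) x = φ x := by
  have h := Real.fourierInv_eq' (𝓕 φ : 𝓢(Plane, ℂ)) x
  rw [← SchwartzMap.fourierInv_coe, FourierTransform.fourierInv_fourier_eq] at h
  exact h.symm

theorem enorm_add_sq_le (a b : ℂ) : ‖a + b‖ₑ ^ 2 ≤ 2 * ‖a‖ₑ ^ 2 + 2 * ‖b‖ₑ ^ 2 := by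
  calc ‖a + b‖ₑ ^ 2 ≤ (‖a‖ₑ + ‖b‖ₑ) ^ 2 := pow_le_pow_left' (enorm_add_le a b) 2
    _ = ‖a‖ₑ ^ 2 + ‖b‖ₑ ^ 2 + 2 * ‖a‖ₑ * ‖b‖ₑ := by ring
    _ ≤ ‖a‖ₑ ^ 2 + ‖b‖ₑ ^ 2 + (‖a‖ₑ ^ 2 + ‖b‖ₑ ^ 2) := by gcongr; exact two_mul_le_sq_add_sq _ _
    _ = 2 * ‖a‖ₑ ^ 2 + 2 * ‖b‖ₑ ^ 2 := by ring

/-- Convergence of the functions `φ n` in the Sobolev norm to the function with Fourier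
transform `H`. -/
def SobTendsto (φ : ℕ → 𝓢(Plane, ℂ)) (H : Plane → ℂ) : Prop :=
  Tendsto (fun n => ∫⁻ p, sobW p * ‖𝓕 (φ n) p - H p‖ₑ ^ 2) atTop (𝓝 0)

theorem sobW_eq_sq (p : Plane) :
    sobW p = ENNReal.ofReal ((1 + ‖p‖ ^ 2) ^ (1 / 2 : ℝ)) ^ 2 := by
  rw [← ENNReal.ofReal_pow (by positivity), ← Real.rpow_natCast, ← Real.rpow_mul (by positivity)]
  norm_num [sobW]

/-- Schwartz functions are dense in the Sobolev space, since they are dense in `L²` and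
multiplication by a power of `1 + |p|²` preserves them. -/
theorem exists_sobTendsto {H : Plane → ℂ} (hm : AEStronglyMeasurable H volume)
    (hH : ∫⁻ p, sobW p * ‖H p‖ₑ ^ 2 < ∞) : ∃ φ, SobTendsto φ H := by
  set g : Plane → ℂ := fun p => (((1 + ‖p‖ ^ 2) ^ (1 / 2 : ℝ) : ℝ) : ℂ) * H p with hg
  have hgn : ∀ p, ‖g p‖ₑ ^ 2 = sobW p * ‖H p‖ₑ ^ 2 := fun p => by
    rw [hg, enorm_mul, mul_pow, sobW_eq_sq, ← ofReal_norm, Complex.norm_real,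
      Real.norm_of_nonneg (by positivity)]
  have hgm : MemLp g 2 volume := by
    rw [memLp_two_iff]
    · simpa only [hgn] using hH
    · refine AEStronglyMeasurable.mul ?_ hm
      exact Measurable.aestronglyMeasurable (by fun_prop)
  have hd := SchwartzMap.denseRange_toLpCLM (E := Plane) (F := ℂ) (p := 2) (μ := volume)
    ENNReal.ofNat_ne_top (hgm.toLp g)
  obtain ⟨u, hu, hlim⟩ := mem_closure_iff_seq_limit.1 hd
  choose ψ hψ using hu
  have h1 : Tendsto (fun n => (ψ n).toLp 2 volume) atTop (𝓝 (hgm.toLp g)) := by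
    refine hlim.congr fun n => ?_
    rw [← hψ n, SchwartzMap.toLpCLM_apply]
  rw [tendsto_toLp_iff, tendsto_eLpNorm_two_iff] at h1
  have htg := Function.hasTemperateGrowth_one_add_norm_sq_rpow Plane (-(1 / 2) : ℝ)
  refine ⟨fun n => 𝓕⁻ (SchwartzMap.smulLeftCLM ℂ
    (fun p : Plane => (1 + ‖p‖ ^ 2) ^ (-(1 / 2) : ℝ)) (ψ n)), ?_⟩
  refine h1.congr fun n => lintegral_congr_ae ?_
  filter_upwards [hgm.coeFn_toLp] with p hp
  rw [hp, FourierTransform.fourier_fourierInv_eq, SchwartzMap.smulLeftCLM_apply_apply htg,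
    sobW_eq_sq, ← mul_pow]
  congr 1
  have hpos : (0 : ℝ) < 1 + ‖p‖ ^ 2 := by positivity
  rw [show ENNReal.ofReal ((1 + ‖p‖ ^ 2) ^ (1 / 2 : ℝ)) =
    ‖(((1 + ‖p‖ ^ 2) ^ (1 / 2 : ℝ) : ℝ) : ℂ)‖ₑ by
      rw [← ofReal_norm, Complex.norm_real, Real.norm_of_nonneg (by positivity)], ← enorm_mul]
  congr 1
  rw [hg, mul_sub, Complex.real_smul, ← mul_assoc, ← Complex.ofReal_mul, ← Real.rpow_add hpos]
  norm_num

/-- A constant in the trace inequality for `η`. -/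
theorem IsKato.exists_lintegral_invHat_sq_le {η : Measure Plane} (hη : IsKato η) :
    ∃ K : ℝ≥0∞, K ≠ ∞ ∧ ∀ F : Plane → ℂ, Integrable F →
      ∫⁻ x, ‖invHat F x‖ₑ ^ 2 ∂η ≤ K * ∫⁻ p, sobW p * ‖F p‖ₑ ^ 2 := by
  have := hη.isLocallyFiniteMeasure
  obtain ⟨C, hC⟩ := hη (2 * Real.pi) (by positivity)
  exact ⟨_, by finiteness, fun F hF => lintegral_invHat_sq_le hC hF⟩

/-- A function that is, `η`-almost everywhere, the pointwise limit of inverse Fourier transforms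
converging in the Sobolev norm is the limit in `L²(η)` of the Schwartz approximations: the trace
on `η` is computed pointwise. For the Lebesgue measure `η` this identifies the function itself. -/
theorem SobTendsto.tendsto_eLpNorm_sub {η : Measure Plane} (hη : IsKato η)
    {φ : ℕ → 𝓢(Plane, ℂ)} {H : Plane → ℂ} (hφ : SobTendsto φ H)
    (hH : AEStronglyMeasurable H volume) {F : ℕ → Plane → ℂ}
    (hF : ∀ n, Integrable (F n))
    (hFH : Tendsto (fun n => ∫⁻ p, sobW p * ‖F n p - H p‖ₑ ^ 2) atTop (𝓝 0)) {T : Plane → ℂ}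
    (hT : ∀ᵐ x ∂η, Tendsto (fun n => invHat (F n) x) atTop (𝓝 (T x))) :
    Tendsto (fun n => eLpNorm (fun x => φ n x - T x) 2 η) atTop (𝓝 0) := by
  rw [tendsto_eLpNorm_two_iff]
  obtain ⟨K, hK, hKF⟩ := hη.exists_lintegral_invHat_sq_le
  have hb : ∀ n, ∫⁻ x, ‖φ n x - T x‖ₑ ^ 2 ∂η ≤
      K * (2 * ∫⁻ p, sobW p * ‖𝓕 (φ n) p - H p‖ₑ ^ 2) := fun n => by
    -- the trace inequality for `𝓕 (φ n) - F l`, followed by `l → ∞` with the lemma of Fatou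
    have h1 : ∀ l, ∫⁻ x, ‖φ n x - invHat (F l) x‖ₑ ^ 2 ∂η ≤
        K * ((2 * ∫⁻ p, sobW p * ‖𝓕 (φ n) p - H p‖ₑ ^ 2) +
          2 * ∫⁻ p, sobW p * ‖F l p - H p‖ₑ ^ 2) := fun l => by
      have h2 := hKF (fun p => 𝓕 (φ n) p - F l p) ((𝓕 (φ n)).integrable.sub (hF l))
      have h3 : ∀ x, invHat (fun p => 𝓕 (φ n) p - F l p) x = φ n x - invHat (F l) x := fun x => by
        rw [← invHat_fourier (φ n) x, invHat, invHat, invHat, ← integral_sub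
          (integrable_wave_mul (𝓕 (φ n)).integrable x) (integrable_wave_mul (hF l) x)]
        simp only [mul_sub]
      simp only [h3] at h2
      refine h2.trans (mul_le_mul' le_rfl ?_)
      have hFm := (hF l).aestronglyMeasurable
      rw [← lintegral_const_mul' _ _ ENNReal.ofNat_ne_top,
        ← lintegral_const_mul' _ _ ENNReal.ofNat_ne_top, ← lintegral_add_left']
      · refine lintegral_mono fun p => ?_
        have h4 := enorm_add_sq_le (𝓕 (φ n) p - H p) (H p - F l p)
        rw [sub_add_sub_cancel] at h4
        calc sobW p * ‖𝓕 (φ n) p - F l p‖ₑ ^ 2 ≤ sobW p *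
              (2 * ‖𝓕 (φ n) p - H p‖ₑ ^ 2 + 2 * ‖H p - F l p‖ₑ ^ 2) := by gcongr
          _ = _ := by rw [enorm_sub_rev (H p)]; ring
      · refine AEMeasurable.const_mul (measurable_sobW.aemeasurable.mul ?_) _
        exact (((𝓕 (φ n)).continuous.aestronglyMeasurable.sub hH).enorm).pow_const 2
    have h5 : Tendsto (fun l => K * ((2 * ∫⁻ p, sobW p * ‖𝓕 (φ n) p - H p‖ₑ ^ 2) +
          2 * ∫⁻ p, sobW p * ‖F l p - H p‖ₑ ^ 2)) atTop
        (𝓝 (K * (2 * ∫⁻ p, sobW p * ‖𝓕 (φ n) p - H p‖ₑ ^ 2))) := by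
      have h6 := ENNReal.Tendsto.const_mul (a := 2) hFH (Or.inr ENNReal.ofNat_ne_top)
      rw [mul_zero] at h6
      have h7 := (tendsto_const_nhds (x := 2 * ∫⁻ p, sobW p * ‖𝓕 (φ n) p - H p‖ₑ ^ 2)).add h6
      rw [add_zero] at h7
      exact ENNReal.Tendsto.const_mul h7 (Or.inr hK)
    calc ∫⁻ x, ‖φ n x - T x‖ₑ ^ 2 ∂η
        = ∫⁻ x, liminf (fun l => ‖φ n x - invHat (F l) x‖ₑ ^ 2) atTop ∂η := by
          refine lintegral_congr_ae ?_
          filter_upwards [hT] with x hx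
          exact (ENNReal.Tendsto.pow (n := 2)
            ((tendsto_const_nhds (x := φ n x)).sub hx).enorm).liminf_eq.symm
      _ ≤ liminf (fun l => ∫⁻ x, ‖φ n x - invHat (F l) x‖ₑ ^ 2 ∂η) atTop := by
          refine lintegral_liminf_le fun l => ?_
          have := continuous_invHat (hF l)
          have := (φ n).continuous
          fun_prop
      _ ≤ _ := (liminf_le_liminf (.of_forall h1)).trans_eq h5.liminf_eq
  have h8 := ENNReal.Tendsto.const_mul (a := K)
    (ENNReal.Tendsto.const_mul (a := 2) hφ (Or.inr ENNReal.ofNat_ne_top)) (Or.inr hK)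
  rw [mul_zero, mul_zero] at h8
  exact tendsto_of_tendsto_of_tendsto_of_le_of_le tendsto_const_nhds h8 (fun n => bot_le) hb

theorem fourier_lineDeriv_apply (φ : 𝓢(Plane, ℂ)) (j : Fin 2) (p : Plane) :
    𝓕 (∂_{unitVec j} φ) p = 2 * Real.pi * Complex.I * (p j : ℂ) * 𝓕 φ p := by
  have htg : Function.HasTemperateGrowth fun x : Plane => ⟪x, unitVec j⟫_ℝ := by fun_prop
  rw [SchwartzMap.fourier_lineDerivOp_eq, smul_apply,
    SchwartzMap.smulLeftCLM_apply_apply htg]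
  simp [unitVec, EuclideanSpace.inner_single_right, mul_assoc]

theorem lintegral_fourier_sq (φ : 𝓢(Plane, ℂ)) :
    ∫⁻ p, ‖𝓕 φ p‖ₑ ^ 2 = ∫⁻ x, ‖φ x‖ₑ ^ 2 := by
  have h := congrArg norm (SchwartzMap.toLp_fourier_eq φ)
  rw [Lp.norm_fourier_eq, SchwartzMap.norm_toLp, SchwartzMap.norm_toLp,
    ENNReal.toReal_eq_toReal_iff' ((φ.memLp 2 volume).2.ne) (((𝓕 φ).memLp 2 volume).2.ne)] at h
  rw [← eLpNorm_two_sq, ← eLpNorm_two_sq, h]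

theorem lintegral_sobW_mul_fourier_sq_le (φ : 𝓢(Plane, ℂ)) :
    ∫⁻ p, sobW p * ‖𝓕 φ p‖ₑ ^ 2 ≤
      (∫⁻ x, ‖φ x‖ₑ ^ 2) + ∑ j, ∫⁻ x, ‖(∂_{unitVec j} φ) x‖ₑ ^ 2 := by
  rw [Fin.sum_univ_two, ← lintegral_fourier_sq φ, ← lintegral_fourier_sq (∂_{unitVec 0} φ),
    ← lintegral_fourier_sq (∂_{unitVec 1} φ)]
  simp only [fourier_lineDeriv_apply]
  have hm := (𝓕 φ).continuous
  rw [← lintegral_add_left (by fun_prop), ← lintegral_add_left (by fun_prop)]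
  refine lintegral_mono fun p => ?_
  have h1 : ∀ z : ℂ, ‖z‖ₑ ^ 2 = ENNReal.ofReal (‖z‖ ^ 2) := fun z => by
    rw [ENNReal.ofReal_pow (norm_nonneg _), ofReal_norm]
  have hπ := Real.pi_gt_three
  simp only [h1, sobW]
  rw [← ENNReal.ofReal_mul (by positivity), ← ENNReal.ofReal_add (by positivity) (by positivity),
    ← ENNReal.ofReal_add (by positivity) (by positivity), norm_sq_plane]
  refine ENNReal.ofReal_le_ofReal ?_
  simp only [norm_mul, Complex.norm_real, Complex.norm_I, Real.norm_eq_abs, mul_pow, sq_abs,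
    Complex.norm_ofNat, mul_one]
  have h2 : 0 ≤ ‖𝓕 φ p‖ ^ 2 := sq_nonneg _
  have h3 : 1 ≤ 2 ^ 2 * Real.pi ^ 2 := by nlinarith
  have h4 := mul_le_mul_of_nonneg_right h3 (mul_nonneg (sq_nonneg (p 0)) h2)
  have h5 := mul_le_mul_of_nonneg_right h3 (mul_nonneg (sq_nonneg (p 1)) h2)
  linarith

theorem enorm_coord_mul_sq_le (j : Fin 2) (p : Plane) (z : ℂ) :
    ‖2 * Real.pi * Complex.I * (p j : ℂ) * z‖ₑ ^ 2 ≤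
      ENNReal.ofReal (4 * Real.pi ^ 2) * (sobW p * ‖z‖ₑ ^ 2) := by
  have h1 : ∀ z : ℂ, ‖z‖ₑ ^ 2 = ENNReal.ofReal (‖z‖ ^ 2) := fun z => by
    rw [ENNReal.ofReal_pow (norm_nonneg _), ofReal_norm]
  rw [h1, h1, sobW, ← ENNReal.ofReal_mul (by positivity), ← ENNReal.ofReal_mul (by positivity)]
  refine ENNReal.ofReal_le_ofReal ?_
  have h2 : p j ^ 2 ≤ 1 + ‖p‖ ^ 2 := by
    rw [norm_sq_plane]
    fin_cases j <;> simp <;> nlinarith [sq_nonneg (p 0), sq_nonneg (p 1)]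
  simp only [norm_mul, Complex.norm_real, Complex.norm_I, Real.norm_eq_abs, mul_pow, sq_abs,
    Complex.norm_ofNat, mul_one]
  have := mul_le_mul_of_nonneg_left h2
    (mul_nonneg (sq_nonneg Real.pi) (sq_nonneg ‖z‖))
  nlinarith

/-- Convergence in the Sobolev norm entails convergence of the derivatives. -/
theorem SobTendsto.exists_gradient {φ : ℕ → 𝓢(Plane, ℂ)} {H : Plane → ℂ} (hφ : SobTendsto φ H)
    (hm : AEStronglyMeasurable H volume) (hH : ∫⁻ p, sobW p * ‖H p‖ₑ ^ 2 < ∞) (j : Fin 2) :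
    ∃ v : L2 volume, Tendsto (fun n => eLpNorm (fun x => (∂_{unitVec j} (φ n)) x - v x) 2 volume)
      atTop (𝓝 0) := by
  have hmem : MemLp (fun p : Plane => 2 * Real.pi * Complex.I * (p j : ℂ) * H p) 2 volume := by
    rw [memLp_two_iff]
    · refine (lintegral_mono fun p => enorm_coord_mul_sq_le j p (H p)).trans_lt ?_
      rw [lintegral_const_mul' _ _ ENNReal.ofReal_ne_top]
      exact ENNReal.mul_lt_top ENNReal.ofReal_lt_top hH
    · exact AEStronglyMeasurable.mul (Continuous.aestronglyMeasurable (by fun_prop)) hm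
  have h1 : Tendsto (fun n => (𝓕 (∂_{unitVec j} (φ n))).toLp 2 volume) atTop
      (𝓝 (hmem.toLp _)) := by
    rw [tendsto_toLp_iff, tendsto_eLpNorm_two_iff]
    have h2 := ENNReal.Tendsto.const_mul (a := ENNReal.ofReal (4 * Real.pi ^ 2)) hφ
      (Or.inr ENNReal.ofReal_ne_top)
    rw [mul_zero] at h2
    refine tendsto_of_tendsto_of_tendsto_of_le_of_le tendsto_const_nhds h2 (fun n => bot_le)
      fun n => ?_
    rw [← lintegral_const_mul' _ _ ENNReal.ofReal_ne_top]
    refine lintegral_mono_ae ?_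
    filter_upwards [hmem.coeFn_toLp] with p hp
    rw [hp, fourier_lineDeriv_apply, ← mul_sub]
    exact enorm_coord_mul_sq_le j p _
  refine ⟨𝓕⁻ (hmem.toLp _), tendsto_toLp_iff.1 ?_⟩
  have h3 := ((Lp.fourierTransformₗᵢ Plane ℂ).symm.continuous.tendsto _).comp h1
  refine h3.congr fun n => ?_
  have h4 := SchwartzMap.toLp_fourierInv_eq (𝓕 (∂_{unitVec j} (φ n)))
  rw [FourierTransform.fourierInv_fourier_eq] at h4
  exact h4

theorem hasWeakGradient_of_tendsto {φ : ℕ → 𝓢(Plane, ℂ)} {f : L2 volume} {v : Fin 2 → L2 volume}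
    (hf : Tendsto (fun n => eLpNorm (fun x => φ n x - f x) 2 volume) atTop (𝓝 0))
    (hv : ∀ j, Tendsto (fun n => eLpNorm (fun x => (∂_{unitVec j} (φ n)) x - v j x) 2 volume)
      atTop (𝓝 0)) : HasWeakGradient f v := by
  intro j
  have h1 := ((Lp.toTemperedDistributionCLM ℂ volume 2).continuous.tendsto _).comp
    (tendsto_toLp_iff.2 hf)
  have h2 := ((Lp.toTemperedDistributionCLM ℂ volume 2).continuous.tendsto _).comp
    (tendsto_toLp_iff.2 (hv j))
  have h3 := ((LineDeriv.lineDerivOpCLM ℂ 𝓢'(Plane, ℂ) (unitVec j)).continuous.tendsto _).comp h1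
  refine tendsto_nhds_unique h3 (h2.congr fun n => ?_)
  simp only [Function.comp_apply, Lp.toTemperedDistributionCLM_apply,
    Lp.toTemperedDistribution_toLp_eq, LineDeriv.lineDerivOpCLM_apply]
  exact (TemperedDistribution.lineDerivOp_toTemperedDistributionCLM_eq _ _).symm

/-! ### The free form on the Fourier side -/

/-- The product of an element of the Sobolev space and an element of its dual is integrable. -/
theorem integrable_mul_of_sobW {F g : Plane → ℂ} (hF : AEStronglyMeasurable F volume)
    (hg : AEStronglyMeasurable g volume) (hF' : ∫⁻ p, sobW p * ‖F p‖ₑ ^ 2 < ∞)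
    (hg' : ∫⁻ p, ‖g p‖ₑ ^ 2 * (sobW p)⁻¹ < ∞) : Integrable fun p => g p * F p := by
  refine ⟨hg.mul hF, ?_⟩
  have h := (sq_lintegral_mul_le_sobW hF.enorm hg.enorm).trans_lt (ENNReal.mul_lt_top hF' hg')
  simp only [HasFiniteIntegral, enorm_mul]
  by_contra hcon
  rw [not_lt, top_le_iff] at hcon
  simp only [mul_comm (‖F _‖ₑ), hcon] at h
  simp at h

theorem lintegral_sobW_mul_fourier_sq_lt_top (φ : 𝓢(Plane, ℂ)) :
    ∫⁻ p, sobW p * ‖𝓕 φ p‖ₑ ^ 2 < ∞ := by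
  refine (lintegral_sobW_mul_fourier_sq_le φ).trans_lt ?_
  have h : ∀ ψ : 𝓢(Plane, ℂ), ∫⁻ x, ‖ψ x‖ₑ ^ 2 < ∞ := fun ψ =>
    (memLp_two_iff ψ.continuous.aestronglyMeasurable).1 (ψ.memLp 2 volume)
  simp only [Fin.sum_univ_two]
  exact ENNReal.add_lt_top.2 ⟨h _, ENNReal.add_lt_top.2 ⟨h _, h _⟩⟩

theorem SobTendsto.tendsto_integral_mul {φ : ℕ → 𝓢(Plane, ℂ)} {H g : Plane → ℂ}
    (hφ : SobTendsto φ H) (hm : AEStronglyMeasurable H volume)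
    (hH : ∫⁻ p, sobW p * ‖H p‖ₑ ^ 2 < ∞) (hg : AEStronglyMeasurable g volume)
    (hg' : ∫⁻ p, ‖g p‖ₑ ^ 2 * (sobW p)⁻¹ < ∞) :
    Tendsto (fun n => ∫ p, g p * 𝓕 (φ n) p) atTop (𝓝 (∫ p, g p * H p)) := by
  rw [tendsto_iff_edist_tendsto_0, ← tendsto_sq_zero_iff]
  have h1 := ENNReal.Tendsto.mul_const (b := ∫⁻ p, ‖g p‖ₑ ^ 2 * (sobW p)⁻¹) hφ (Or.inr hg'.ne)
  rw [zero_mul] at h1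
  refine tendsto_of_tendsto_of_tendsto_of_le_of_le tendsto_const_nhds h1 (fun n => bot_le)
    fun n => ?_
  have hFm := (𝓕 (φ n)).continuous.aestronglyMeasurable (μ := volume)
  rw [edist_eq_enorm_sub, ← integral_sub
    (integrable_mul_of_sobW hFm hg (lintegral_sobW_mul_fourier_sq_lt_top (φ n)) hg')
    (integrable_mul_of_sobW hm hg hH hg')]
  refine le_trans (pow_le_pow_left' ?_ 2)
    (sq_lintegral_mul_le_sobW (hFm.sub hm).enorm hg.enorm)
  refine (enorm_integral_le_lintegral_enorm _).trans_eq (lintegral_congr fun p => ?_)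
  rw [← mul_sub, enorm_mul, mul_comm]

theorem inner_toLp_eq_integral {μ : Measure Plane} {f g : Plane → ℂ} (hf : MemLp f 2 μ)
    (hg : MemLp g 2 μ) : ⟪hf.toLp f, hg.toLp g⟫_ℂ = ∫ x, starRingEnd ℂ (f x) * g x ∂μ := by
  rw [L2.inner_def]
  refine integral_congr_ae ?_
  filter_upwards [hf.coeFn_toLp, hg.coeFn_toLp] with x h1 h2
  rw [h1, h2, RCLike.inner_apply, mul_comm]

theorem inner_schwartz_eq (ψ φ : 𝓢(Plane, ℂ)) :
    ⟪ψ.toLp 2 volume, φ.toLp 2 volume⟫_ℂ = ∫ p, starRingEnd ℂ (𝓕 ψ p) * 𝓕 φ p := by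
  rw [← SchwartzMap.inner_fourier_toL2_eq]
  exact inner_toLp_eq_integral _ _

/-- Plancherel's formula for the form of `-Δ - z`. -/
theorem form_schwartz_eq (ψ φ : 𝓢(Plane, ℂ)) (z : ℂ) :
    (∑ j, ⟪(∂_{unitVec j} ψ).toLp 2 volume, (∂_{unitVec j} φ).toLp 2 volume⟫_ℂ) -
      z * ⟪ψ.toLp 2 volume, φ.toLp 2 volume⟫_ℂ =
      ∫ p, starRingEnd ℂ (𝓕 ψ p) * (((4 * Real.pi ^ 2 * ‖p‖ ^ 2 : ℝ) : ℂ) - z) * 𝓕 φ p := by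
  have hint : ∀ ψ φ : 𝓢(Plane, ℂ), Integrable fun p => starRingEnd ℂ (𝓕 ψ p) * 𝓕 φ p :=
    fun ψ φ => by
    refine ((𝓕 φ).integrable).bdd_mul (c := ‖(𝓕 ψ).toBoundedContinuousFunction‖)
      (Complex.continuous_conj.comp (𝓕 ψ).continuous).aestronglyMeasurable (.of_forall fun p => ?_)
    rw [RCLike.norm_conj]
    exact (𝓕 ψ).toBoundedContinuousFunction.norm_coe_le_norm p
  simp only [inner_schwartz_eq, Fin.sum_univ_two]
  rw [← integral_add (hint _ _) (hint _ _), ← integral_const_mul, ← integral_sub]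
  rotate_left
  · exact (hint _ _).add (hint _ _)
  · exact (hint _ _).const_mul _
  refine integral_congr_ae (.of_forall fun p => ?_)
  simp only [fourier_lineDeriv_apply, norm_sq_plane, map_mul, Complex.conj_I, Complex.conj_ofReal]
  push_cast
  simp only [map_ofNat]
  linear_combination (-4 * Real.pi ^ 2 * ((p 0 : ℂ) ^ 2 + (p 1 : ℂ) ^ 2) *
    (starRingEnd ℂ (𝓕 ψ p)) * 𝓕 φ p) * Complex.I_sq

/-- The form of `-Δ - z`, tested against a Schwartz function. -/
theorem SobTendsto.form_eq {φ : ℕ → 𝓢(Plane, ℂ)} {H : Plane → ℂ} (hφ : SobTendsto φ H)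
    (hm : AEStronglyMeasurable H volume) (hH : ∫⁻ p, sobW p * ‖H p‖ₑ ^ 2 < ∞)
    {f : L2 volume} {v : Fin 2 → L2 volume}
    (hf : Tendsto (fun n => eLpNorm (fun x => φ n x - f x) 2 volume) atTop (𝓝 0))
    (hv : ∀ j, Tendsto (fun n => eLpNorm (fun x => (∂_{unitVec j} (φ n)) x - v j x) 2 volume)
      atTop (𝓝 0)) (ψ : 𝓢(Plane, ℂ)) (z : ℂ) :
    (∑ j, ⟪(∂_{unitVec j} ψ).toLp 2 volume, v j⟫_ℂ) - z * ⟪ψ.toLp 2 volume, f⟫_ℂ =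
      ∫ p, starRingEnd ℂ (𝓕 ψ p) * (((4 * Real.pi ^ 2 * ‖p‖ ^ 2 : ℝ) : ℂ) - z) * H p := by
  have h1 : Tendsto (fun n => (∑ j, ⟪(∂_{unitVec j} ψ).toLp 2 volume,
      (∂_{unitVec j} (φ n)).toLp 2 volume⟫_ℂ) - z * ⟪ψ.toLp 2 volume, (φ n).toLp 2 volume⟫_ℂ)
      atTop (𝓝 ((∑ j, ⟪(∂_{unitVec j} ψ).toLp 2 volume, v j⟫_ℂ) -
        z * ⟪ψ.toLp 2 volume, f⟫_ℂ)) := by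
    refine Tendsto.sub (tendsto_finsetSum _ fun j _ => ?_) (Tendsto.const_mul z ?_)
    · exact tendsto_const_nhds.inner (tendsto_toLp_iff.2 (hv j))
    · exact tendsto_const_nhds.inner (tendsto_toLp_iff.2 hf)
  simp only [form_schwartz_eq] at h1
  refine tendsto_nhds_unique h1 (hφ.tendsto_integral_mul hm hH ?_ ?_)
  · refine Continuous.aestronglyMeasurable ?_
    exact (Complex.continuous_conj.comp (𝓕 ψ).continuous).mul (by fun_prop)
  · have hb : ∀ p : Plane, ‖starRingEnd ℂ (𝓕 ψ p) *
        (((4 * Real.pi ^ 2 * ‖p‖ ^ 2 : ℝ) : ℂ) - z)‖ₑ ^ 2 * (sobW p)⁻¹ ≤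
        ENNReal.ofReal ((4 * Real.pi ^ 2 + ‖z‖) ^ 2) * (sobW p * ‖𝓕 ψ p‖ₑ ^ 2) := fun p => by
      rw [← div_eq_mul_inv]
      refine ENNReal.div_le_of_le_mul ?_
      have h1 : ∀ z : ℂ, ‖z‖ₑ ^ 2 = ENNReal.ofReal (‖z‖ ^ 2) := fun z => by
        rw [ENNReal.ofReal_pow (norm_nonneg _), ofReal_norm]
      rw [h1, h1, sobW, ← ENNReal.ofReal_mul (by positivity), ← ENNReal.ofReal_mul (by positivity),
        ← ENNReal.ofReal_mul (by positivity)]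
      refine ENNReal.ofReal_le_ofReal ?_
      rw [norm_mul, RCLike.norm_conj, mul_pow]
      have h2 : ‖((4 * Real.pi ^ 2 * ‖p‖ ^ 2 : ℝ) : ℂ) - z‖ ≤
          (4 * Real.pi ^ 2 + ‖z‖) * (1 + ‖p‖ ^ 2) := by
        refine (norm_sub_le _ _).trans ?_
        rw [Complex.norm_real, Real.norm_of_nonneg (by positivity)]
        nlinarith [mul_nonneg (norm_nonneg z) (sq_nonneg ‖p‖), sq_nonneg Real.pi]
      have h3 := pow_le_pow_left₀ (norm_nonneg _) h2 2
      have h4 := mul_le_mul_of_nonneg_left h3 (sq_nonneg ‖𝓕 ψ p‖)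
      refine h4.trans_eq ?_
      ring
    refine (lintegral_mono hb).trans_lt ?_
    rw [lintegral_const_mul' _ _ ENNReal.ofReal_ne_top]
    exact ENNReal.mul_lt_top ENNReal.ofReal_lt_top (lintegral_sobW_mul_fourier_sq_lt_top ψ)

/-! ### Arc length on the line and on `C¹` arcs -/

/-- The parametrization of the straight line by arc length. -/
def linePt (s : ℝ) : Plane := planeEquiv (s, 0)

theorem isometry_linePt : Isometry linePt := by
  refine Isometry.of_dist_eq fun s t => ?_
  rw [EuclideanSpace.dist_eq, Fin.sum_univ_two]
  simp [linePt, Real.sqrt_sq_eq_abs, Real.dist_eq]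

theorem range_linePt : Set.range linePt = straightLine := by
  ext x
  constructor
  · rintro ⟨s, rfl⟩
    simp [linePt, straightLine]
  · intro hx
    refine ⟨x 0, ?_⟩
    ext i
    fin_cases i
    · simp [linePt]
    · simpa [linePt] using (show x 1 = 0 from hx).symm

theorem measurableSet_straightLine : MeasurableSet straightLine :=
  (isClosed_eq (by fun_prop) continuous_const : IsClosed {x : Plane | x 1 = 0}).measurableSet

theorem map_linePt : Measure.map linePt volume = arcMeasure straightLine := by
  rw [← hausdorffMeasure_real, isometry_linePt.map_hausdorffMeasure (Or.inl zero_le_one),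
    range_linePt, arcMeasure]

theorem integral_straightLine (f : Plane → ℂ) :
    ∫ x, f x ∂arcMeasure straightLine = ∫ s : ℝ, f (linePt s) := by
  rw [← map_linePt]
  exact isometry_linePt.isClosedEmbedding.measurableEmbedding.integral_map f

theorem integrable_straightLine {f : Plane → ℂ} :
    Integrable f (arcMeasure straightLine) ↔ Integrable fun s => f (linePt s) := by
  rw [← map_linePt]
  exact isometry_linePt.isClosedEmbedding.measurableEmbedding.integrable_map_iff

theorem lintegral_straightLine (f : Plane → ℝ≥0∞) :
    ∫⁻ x, f x ∂arcMeasure straightLine = ∫⁻ s : ℝ, f (linePt s) := by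
  rw [← map_linePt]
  exact isometry_linePt.isClosedEmbedding.measurableEmbedding.lintegral_map f

theorem lintegral_k0_abs_sub_le {c : ℝ} (hc : 0 < c) (s₀ : ℝ) :
    ∫⁻ s : ℝ, k0 (c * |s - s₀|) ≤ ENNReal.ofReal (4 / c) :=
  (lintegral_sub_right_eq_self (fun s : ℝ => k0 (c * |s|)) s₀).trans_le (lintegral_k0_abs_le hc)

theorem isKato_straightLine : IsKato (arcMeasure straightLine) := fun c hc => by
  refine ⟨(4 / c).toNNReal, fun x => ?_⟩
  rw [lintegral_straightLine]
  refine (lintegral_mono fun s => k0_antitone ?_).trans (lintegral_k0_abs_sub_le hc (x 0))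
  refine mul_le_mul_of_nonneg_left ?_ hc.le
  have h := EuclideanSpace.norm_eq (x - linePt s)
  rw [h]
  refine Real.le_sqrt_of_sq_le ?_
  rw [Fin.sum_univ_two]
  simp [linePt]
  nlinarith [sq_nonneg (x 1)]

theorem C1Arc.lipschitzOnWith (A : C1Arc) : LipschitzOnWith 1 A.curve (Set.Ioo 0 A.L) := by
  refine (convex_Ioo 0 A.L).lipschitzOnWith_of_nnnorm_deriv_le (𝕜 := ℝ) (fun s hs => ?_)
    fun s hs => ?_
  · exact (A.contDiffOn.differentiableOn one_ne_zero).differentiableAt (isOpen_Ioo.mem_nhds hs)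
  · rw [← NNReal.coe_le_coe, coe_nnnorm, A.unit_speed s hs, NNReal.coe_one]

theorem C1Arc.exists_chord_arc_Icc (A : C1Arc) : ∃ C : ℝ, 0 < C ∧ ∀ s ∈ Set.Icc 0 A.L,
    ∀ s' ∈ Set.Icc 0 A.L, C * |s - s'| ≤ ‖A.curve s - A.curve s'‖ := by
  obtain ⟨C, hC, h⟩ := A.chord_arc
  refine ⟨C, hC, ?_⟩
  have hcl : closure (Set.Ioo 0 A.L ×ˢ Set.Ioo 0 A.L) = Set.Icc 0 A.L ×ˢ Set.Icc 0 A.L := by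
    rw [closure_prod_eq, closure_Ioo A.L_pos.ne]
  have hc : ContinuousOn (fun z : ℝ × ℝ => ‖A.curve z.1 - A.curve z.2‖ - C * |z.1 - z.2|)
      (closure (Set.Ioo 0 A.L ×ˢ Set.Ioo 0 A.L)) := by
    rw [hcl]
    refine ContinuousOn.sub (ContinuousOn.norm (ContinuousOn.sub ?_ ?_)) (by fun_prop)
    · exact A.continuousOn.comp continuousOn_fst fun z hz => hz.1
    · exact A.continuousOn.comp continuousOn_snd fun z hz => hz.2
  have hm : Set.MapsTo (fun z : ℝ × ℝ => ‖A.curve z.1 - A.curve z.2‖ - C * |z.1 - z.2|)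
      (Set.Ioo 0 A.L ×ˢ Set.Ioo 0 A.L) (Set.Ici 0) := by
    intro z hz
    have h1 := h z.1 hz.1 z.2 hz.2
    simpa using h1
  have hm' := hm.closure_of_continuousOn hc
  rw [hcl, closure_Ici] at hm'
  intro s hs s' hs'
  have h1 := hm' (Set.mk_mem_prod hs hs')
  simpa using h1

theorem C1Arc.aemeasurable (A : C1Arc) :
    AEMeasurable A.curve (volume.restrict (Set.Ioo 0 A.L)) :=
  (A.continuousOn.mono Set.Ioo_subset_Icc_self).aemeasurable measurableSet_Ioo

/-- Arc length on the arc is at most the image of Lebesgue measure, the parametrization being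
1-Lipschitz; the end points are null sets. -/
theorem C1Arc.arcMeasure_le (A : C1Arc) :
    arcMeasure A.carrier ≤ Measure.map A.curve (volume.restrict (Set.Ioo 0 A.L)) := by
  refine Measure.le_iff.2 fun E hE => ?_
  rw [arcMeasure, Measure.restrict_apply hE, Measure.map_apply_of_aemeasurable A.aemeasurable hE]
  have hsub : E ∩ A.carrier ⊆ A.curve '' (A.curve ⁻¹' E ∩ Set.Ioo 0 A.L) ∪
      ({A.curve 0} ∪ {A.curve A.L}) := by
    rintro x ⟨hxE, s, hs, rfl⟩
    rcases eq_or_lt_of_le (A.subset_Icc hs).1 with h | h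
    · exact Or.inr (Or.inl (by rw [← h]; rfl))
    rcases eq_or_lt_of_le (A.subset_Icc hs).2 with h' | h'
    · exact Or.inr (Or.inr (by rw [h']; rfl))
    · exact Or.inl ⟨s, ⟨hxE, h, h'⟩, rfl⟩
  have hna := Measure.nullSingletonClass_hausdorff Plane (d := 1) one_pos
  refine (measure_mono hsub).trans ((measure_union_le _ _).trans ?_)
  rw [measure_union_null (measure_singleton _) (measure_singleton _), add_zero]
  have hl := (A.lipschitzOnWith.mono (Set.inter_subset_right
    (s := A.curve ⁻¹' E))).hausdorffMeasure_image_le (d := 1) zero_le_one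
  rw [hausdorffMeasure_real] at hl
  simpa using hl.trans (by simp)

/-- The distance from `x` to a point of the arc is at least half the distance of that point to the
point nearest to `x`, hence at least a multiple of the difference of the parameters; this reduces
the bound to the case of a line. -/
theorem C1Arc.isKato (A : C1Arc) : IsKato (arcMeasure A.carrier) := by
  obtain ⟨C, hC, h⟩ := A.exists_chord_arc_Icc
  refine IsKato.mono (fun c hc => ⟨(4 / (c * C / 2)).toNNReal, fun x => ?_⟩) A.arcMeasure_le
  have hkx : Measurable fun y : Plane => k0 (c * ‖x - y‖) := measurable_k0.comp (by fun_prop)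
  rw [lintegral_map' hkx.aemeasurable A.aemeasurable]
  have hcont : ContinuousOn (fun s => ‖x - A.curve s‖) (Set.Icc 0 A.L) :=
    (continuousOn_const.sub A.continuousOn).norm
  obtain ⟨s₀, hs₀, hmin⟩ := isCompact_Icc.exists_isMinOn (Set.nonempty_Icc.2 A.L_pos.le) hcont
  have hbound : ∀ s ∈ Set.Ioo 0 A.L,
      k0 (c * ‖x - A.curve s‖) ≤ k0 (c * C / 2 * |s - s₀|) := fun s hs => by
    refine k0_antitone ?_
    have hs' := Set.Ioo_subset_Icc_self hs
    have h1 := h s hs' s₀ hs₀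
    have h2 : ‖x - A.curve s₀‖ ≤ ‖x - A.curve s‖ := hmin hs'
    have h3 : ‖A.curve s - A.curve s₀‖ ≤ ‖x - A.curve s₀‖ + ‖x - A.curve s‖ := by
      rw [← sub_sub_sub_cancel_left]
      exact norm_sub_le _ _
    nlinarith
  refine (setLIntegral_mono' measurableSet_Ioo hbound).trans
    ((setLIntegral_le_lintegral _ _).trans ?_)
  exact lintegral_k0_abs_sub_le (by positivity) s₀

theorem isKato_sum {ι : Type*} [Fintype ι] {η : ι → Measure Plane} (h : ∀ i, IsKato (η i)) :
    IsKato (Measure.sum η) := by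
  rw [Measure.sum_fintype]
  classical
  refine Finset.induction_on (motive := fun s => IsKato (∑ i ∈ s, η i)) Finset.univ ?_ ?_
  · simpa using isKato_zero
  · intro i s hi hs
    rw [Finset.sum_insert hi]
    exact (h i).add hs

theorem arcMeasure_mono {S T : Set Plane} (h : S ⊆ T) : arcMeasure S ≤ arcMeasure T :=
  Measure.restrict_mono h le_rfl

theorem IsLocalDeformation.isKato {Γ : Set Plane} (hΓ : IsLocalDeformation Γ) :
    IsKato (arcMeasure (Γ ∪ straightLine)) := by
  obtain ⟨N, A, hA, -⟩ := hΓ.decomposition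
  have h1 : IsKato (arcMeasure (⋃ i, (A i).carrier)) :=
    (isKato_sum fun i => (A i).isKato).mono Measure.restrict_iUnion_le
  -- `Γ ∪ Σ` is the union of the arcs and the line
  refine (h1.add isKato_straightLine).mono ?_
  rw [← hA, ← Set.sdiff_union_self]
  exact Measure.restrict_union_le _ _

theorem symmDiff_subset_union (Γ : Set Plane) :
    symmDiff Γ straightLine ⊆ Γ ∪ straightLine :=
  Set.union_subset_union Set.sdiff_subset Set.sdiff_subset

theorem IsLocalDeformation.isFiniteMeasure_nuMeasure {Γ : Set Plane} (hΓ : IsLocalDeformation Γ) :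
    IsFiniteMeasure (nuMeasure Γ) := by
  obtain ⟨M, hM, hMΓ⟩ := hΓ.eq_off_compact
  have hsub : symmDiff Γ straightLine ⊆ M := by
    rintro x (⟨h1, h2⟩ | ⟨h1, h2⟩) <;> by_contra hx
    · exact h2 ((Set.ext_iff.1 hMΓ x).1 ⟨h1, hx⟩).1
    · exact h2 ((Set.ext_iff.1 hMΓ x).2 ⟨h1, hx⟩).1
  have := hΓ.isKato.isLocallyFiniteMeasure
  refine ⟨?_⟩
  rw [nuMeasure, arcMeasure, Measure.restrict_apply_univ]
  refine lt_of_le_of_lt ?_ (hM.measure_lt_top (μ := arcMeasure (Γ ∪ straightLine)))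
  calc Measure.hausdorffMeasure 1 (symmDiff Γ straightLine)
      ≤ Measure.hausdorffMeasure 1 (M ∩ (Γ ∪ straightLine)) :=
        measure_mono (Set.subset_inter hsub (symmDiff_subset_union Γ))
    _ ≤ arcMeasure (Γ ∪ straightLine) M := Measure.le_restrict_apply _ _

/-! ### The symbol of the line -/

theorem tau_sq (k : ℂ) (s : ℝ) : tau k s ^ 2 = (s : ℂ) ^ 2 - k ^ 2 := by
  rw [tau, one_div]
  exact Complex.cpow_ofNat_inv_pow _ 2

/-- The square root with positive real part is the principal one. -/
theorem tau_re_pos {k : ℂ} (hk : ∀ r : ℝ, 0 ≤ r → k ^ 2 ≠ (r : ℂ)) (s : ℝ) :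
    0 < (tau k s).re := by
  set z : ℂ := (s : ℂ) ^ 2 - k ^ 2 with hz
  have hsl : z ∈ Complex.slitPlane := by
    by_contra h
    rw [Complex.mem_slitPlane_iff_not_le_zero, not_not] at h
    obtain ⟨h1, h2⟩ := Complex.le_def.1 h
    simp only [Complex.zero_re, Complex.zero_im] at h1 h2
    refine hk (s ^ 2 - z.re) (by nlinarith [sq_nonneg s]) ?_
    have h3 : z = (z.re : ℂ) := Complex.ext (by simp) (by simp [h2])
    push_cast
    rw [← h3, hz]
    ring
  have hz0 := Complex.slitPlane_ne_zero hsl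
  rw [tau, ← hz, Complex.cpow_def_of_ne_zero hz0, Complex.exp_re]
  refine mul_pos (Real.exp_pos _) (Real.cos_pos_of_mem_Ioo ?_)
  have h1 : (Complex.log z * (1 / 2 : ℂ)).im = z.arg / 2 := by
    rw [show (1 / 2 : ℂ) = ((1 / 2 : ℝ) : ℂ) by push_cast; rfl, Complex.im_mul_ofReal,
      Complex.log_im]
    ring
  rw [h1]
  have h2 := Complex.neg_pi_lt_arg z
  have h3 := (Complex.arg_le_pi z).lt_of_ne (Complex.mem_slitPlane_iff_arg.1 hsl).1
  constructor <;> linarith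

theorem tau_ne_zero {k : ℂ} (hk : ∀ r : ℝ, 0 ≤ r → k ^ 2 ≠ (r : ℂ)) (s : ℝ) : tau k s ≠ 0 :=
  fun h => by
  have := tau_re_pos hk s
  simp [h] at this

theorem measurable_tau (k : ℂ) : Measurable (tau k) := by
  unfold tau
  fun_prop

section Line

variable {α : ℝ} {k : ℂ}

theorem sq_ne_of_nonneg (hk : ∀ r : ℝ, -α ^ 2 / 4 ≤ r → k ^ 2 ≠ (r : ℂ)) (r : ℝ) (hr : 0 ≤ r) :
    k ^ 2 ≠ (r : ℂ) := hk r (by nlinarith [sq_nonneg α])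

/-- The zeros of `2τ - α` correspond to the spectrum `[-α²/4, ∞)` of the line operator. -/
theorem two_mul_tau_sub_ne_zero (hk : ∀ r : ℝ, -α ^ 2 / 4 ≤ r → k ^ 2 ≠ (r : ℂ)) (s : ℝ) :
    2 * tau k s - α ≠ 0 := fun h => by
  have h1 : (4 : ℂ) * tau k s ^ 2 = (α : ℂ) ^ 2 := by linear_combination (2 * tau k s + α) * h
  rw [tau_sq] at h1
  refine hk (s ^ 2 - α ^ 2 / 4) (by nlinarith [sq_nonneg s]) ?_
  push_cast
  linear_combination (-1 / 4 : ℂ) * h1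

/-- The multiplier `τ / (2τ - α)`, in the variable `p₁ / 2π`. -/
def lineMul (α : ℝ) (k : ℂ) (s : ℝ) : ℂ :=
  tau k (2 * Real.pi * s) / (2 * tau k (2 * Real.pi * s) - α)

theorem measurable_lineMul : Measurable (lineMul α k) := by
  have h := (measurable_tau k).comp (measurable_const_mul (2 * Real.pi))
  exact h.div ((h.const_mul 2).sub_const _)

/-- The multiplier is bounded because `k²` has a positive distance from the spectrum
`[-α²/4, ∞)` of the line operator. -/
theorem exists_norm_lineMul_le (hα : 0 < α)
    (hk : ∀ r : ℝ, -α ^ 2 / 4 ≤ r → k ^ 2 ≠ (r : ℂ)) : ∃ C : ℝ, ∀ s, ‖lineMul α k s‖ ≤ C := by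
  obtain ⟨c, hc, h⟩ := exists_mul_one_add_le_norm_sub hk
  suffices hs : ∃ C : ℝ, ∀ s : ℝ, ‖tau k s / (2 * tau k s - α)‖ ≤ C from
    hs.imp fun C hC s => hC (2 * Real.pi * s)
  -- the numerator and the denominator are multiplied by `2τ + α`
  have h1 : ∀ s : ℝ, tau k s / (2 * tau k s - α) =
      (2 * tau k s ^ 2 + α * tau k s) / (4 * (((s ^ 2 - α ^ 2 / 4 : ℝ) : ℂ) - k ^ 2)) := fun s => by
    have h2 : 4 * (((s ^ 2 - α ^ 2 / 4 : ℝ) : ℂ) - k ^ 2) =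
        (2 * tau k s - α) * (2 * tau k s + α) := by
      push_cast
      linear_combination (-4 : ℂ) * tau_sq k s
    have h3 : 2 * tau k s + α ≠ 0 := fun h0 => by
      have h4 := tau_re_pos (sq_ne_of_nonneg hk) s
      have h5 := congrArg Complex.re h0
      simp at h5
      linarith
    rw [h2, div_eq_div_iff (two_mul_tau_sub_ne_zero hk s)
      (mul_ne_zero (two_mul_tau_sub_ne_zero hk s) h3)]
    ring
  set M : ℝ := 1 + α ^ 2 / 4 + ‖k ^ 2‖ with hM
  refine ⟨((2 + α) * M) / (4 * c), fun s => ?_⟩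
  set r : ℝ := s ^ 2 - α ^ 2 / 4 with hr
  have hrα : -α ^ 2 / 4 ≤ r := by rw [hr]; nlinarith [sq_nonneg s]
  have h2 := h r hrα
  have hτ2 : ‖tau k s‖ ^ 2 ≤ M * (1 + |r|) := by
    rw [← norm_pow, tau_sq]
    have h3 : ‖(s : ℂ) ^ 2 - k ^ 2‖ ≤ s ^ 2 + ‖k ^ 2‖ := by
      refine (norm_sub_le _ _).trans_eq ?_
      rw [norm_pow, Complex.norm_real, Real.norm_eq_abs, sq_abs]
    have h4 : s ^ 2 ≤ |r| + α ^ 2 / 4 := by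
      have := le_abs_self r
      rw [hr] at this ⊢
      linarith
    have h5 : M * (1 + |r|) = 1 + α ^ 2 / 4 + ‖k ^ 2‖ + |r| + (α ^ 2 / 4 + ‖k ^ 2‖) * |r| := by
      rw [hM]; ring
    have h6 : 0 ≤ (α ^ 2 / 4 + ‖k ^ 2‖) * |r| := by positivity
    linarith
  have hM1 : 1 ≤ M * (1 + |r|) := by
    have : 1 ≤ M := by rw [hM]; linarith [norm_nonneg (k ^ 2), sq_nonneg α]
    nlinarith [abs_nonneg r]
  have hτ1 : ‖tau k s‖ ≤ M * (1 + |r|) := by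
    nlinarith [norm_nonneg (tau k s), sq_nonneg (‖tau k s‖ - 1)]
  have hpos : 0 < 4 * ‖(r : ℂ) - k ^ 2‖ := by
    have : 0 < c * (1 + |r|) := by positivity
    linarith
  rw [h1, norm_div, norm_mul, Complex.norm_ofNat, div_le_div_iff₀ hpos (by positivity)]
  have h7 : ‖2 * tau k s ^ 2 + α * tau k s‖ ≤ (2 + α) * (M * (1 + |r|)) := by
    refine (norm_add_le _ _).trans ?_
    rw [norm_mul, norm_mul, norm_pow, Complex.norm_real, Real.norm_of_nonneg hα.le,
      Complex.norm_ofNat]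
    nlinarith
  have h8 : 0 ≤ (2 + α) * M := by positivity
  nlinarith [mul_le_mul_of_nonneg_left h2 h8]

theorem symb_planeEquiv (k : ℂ) (s t : ℝ) :
    symb k (planeEquiv (s, t)) = 4 * Real.pi ^ 2 * (t : ℂ) ^ 2 + tau k (2 * Real.pi * s) ^ 2 := by
  rw [symb, norm_sq_plane, tau_sq, planeEquiv_zero, planeEquiv_one]
  push_cast
  ring

theorem norm_sq_planeEquiv (s t : ℝ) : ‖planeEquiv (s, t)‖ ^ 2 = s ^ 2 + t ^ 2 := by
  rw [norm_sq_plane, planeEquiv_zero, planeEquiv_one]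

@[fun_prop] theorem continuous_planeEquiv : Continuous planeEquiv := by
  refine (PiLp.continuous_toLp 2 _).comp (continuous_pi fun i => ?_)
  fin_cases i
  · exact continuous_fst
  · exact continuous_snd

theorem integrable_one_div_symb_slice (hk : ∀ r : ℝ, 0 ≤ r → k ^ 2 ≠ (r : ℂ)) (s : ℝ) :
    Integrable fun t : ℝ => 1 / symb k (planeEquiv (s, t)) := by
  obtain ⟨c, hc, h⟩ := exists_mul_le_norm_symb hk
  refine (integrable_inv_one_add_sq.const_mul c⁻¹).mono' ?_ (.of_forall fun t => ?_)
  · have h1 := continuous_symb k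
    exact (continuous_const.div (by fun_prop) fun t => symb_ne_zero hk _).aestronglyMeasurable
  · have h1 := h (planeEquiv (s, t))
    rw [norm_sq_planeEquiv] at h1
    rw [norm_div, norm_one, one_div, ← mul_inv]
    refine inv_anti₀ (by positivity) (le_trans ?_ h1)
    refine mul_le_mul_of_nonneg_left ?_ hc.le
    linarith [sq_nonneg s]

theorem integral_one_div_symb_slice (hk : ∀ r : ℝ, 0 ≤ r → k ^ 2 ≠ (r : ℂ)) (s : ℝ) :
    ∫ t : ℝ, 1 / symb k (planeEquiv (s, t)) = 1 / (2 * tau k (2 * Real.pi * s)) := by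
  set μ := tau k (2 * Real.pi * s) with hμdef
  have hμ : 0 < μ.re := tau_re_pos hk _
  set f : ℝ → ℂ := fun x => Complex.exp (-(μ * (|x| : ℝ))) / (2 * μ) with hf
  have h1 : 𝓕 f = fun t => 1 / symb k (planeEquiv (s, t)) := by
    funext t
    rw [symb_planeEquiv, ← hμdef, ← integral_wave_mul_exp_neg_mul_abs hμ t,
      Real.fourier_real_eq_integral_exp_smul]
    simp only [smul_eq_mul, mul_assoc, hf]
  have h2 : Continuous f := by rw [hf]; fun_prop
  have h3 := Integrable.fourierInv_fourier_eq (f := f)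
    ((integrable_exp_neg_mul_abs hμ).div_const _)
    (by rw [h1]; exact integrable_one_div_symb_slice hk s) (v := 0) h2.continuousAt
  rw [h1, Real.fourierInv_eq'] at h3
  simpa [hf] using h3

theorem lintegral_plane_slices {f : Plane → ℝ≥0∞} (hf : Measurable f) :
    ∫⁻ p, f p = ∫⁻ s : ℝ, ∫⁻ t : ℝ, f (planeEquiv (s, t)) := by
  rw [lintegral_plane, Measure.volume_eq_prod, lintegral_prod _ (by fun_prop)]

theorem integral_plane_slices {f : Plane → ℂ} (hf : Integrable f) :
    ∫ p, f p = ∫ s : ℝ, ∫ t : ℝ, f (planeEquiv (s, t)) := by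
  rw [integral_plane, Measure.volume_eq_prod, integral_prod _ (integrable_plane.1 hf)]

theorem lintegral_inv_sobW_slice_le (s : ℝ) :
    ∫⁻ t : ℝ, (sobW (planeEquiv (s, t)))⁻¹ ≤ ENNReal.ofReal Real.pi := by
  rw [← integral_univ_inv_one_add_sq, ofReal_integral_eq_lintegral_ofReal
    integrable_inv_one_add_sq (.of_forall fun t => by positivity)]
  refine lintegral_mono fun t => ?_
  rw [sobW, ← ENNReal.ofReal_inv_of_pos (by positivity), norm_sq_planeEquiv]
  refine ENNReal.ofReal_le_ofReal (inv_anti₀ (by positivity) ?_)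
  linarith [sq_nonneg s]

theorem exists_enorm_inv_symb_le (hk : ∀ r : ℝ, 0 ≤ r → k ^ 2 ≠ (r : ℂ)) :
    ∃ K : ℝ≥0∞, K ≠ ∞ ∧ ∀ p, ‖(symb k p)⁻¹‖ₑ ≤ K * (sobW p)⁻¹ := by
  obtain ⟨c, hc, h⟩ := exists_mul_le_norm_symb hk
  refine ⟨ENNReal.ofReal c⁻¹, ENNReal.ofReal_ne_top, fun p => ?_⟩
  rw [sobW, ← ENNReal.ofReal_inv_of_pos (by positivity), ← ENNReal.ofReal_mul (by positivity),
    ← ofReal_norm, norm_inv, ← mul_inv]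
  exact ENNReal.ofReal_le_ofReal (inv_anti₀ (by positivity) (h p))

/-- Division by the symbol maps the dual of the Sobolev space into the Sobolev space. -/
theorem lintegral_sobW_div_symb_sq_lt_top (hk : ∀ r : ℝ, 0 ≤ r → k ^ 2 ≠ (r : ℂ)) {X : Plane → ℂ}
    (hX : ∫⁻ p, ‖X p‖ₑ ^ 2 * (sobW p)⁻¹ < ∞) :
    ∫⁻ p, sobW p * ‖X p / symb k p‖ₑ ^ 2 < ∞ := by
  obtain ⟨K, hK, h⟩ := exists_enorm_inv_symb_le hk
  have h1 : ∀ p, sobW p * ‖X p / symb k p‖ₑ ^ 2 ≤ K ^ 2 * (‖X p‖ₑ ^ 2 * (sobW p)⁻¹) := fun p => by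
    rw [div_eq_mul_inv, enorm_mul, mul_pow]
    calc sobW p * (‖X p‖ₑ ^ 2 * ‖(symb k p)⁻¹‖ₑ ^ 2)
        ≤ sobW p * (‖X p‖ₑ ^ 2 * (K * (sobW p)⁻¹) ^ 2) := by
          gcongr
          exact h p
      _ = (sobW p * (sobW p)⁻¹) * (K ^ 2 * (‖X p‖ₑ ^ 2 * (sobW p)⁻¹)) := by ring
      _ = K ^ 2 * (‖X p‖ₑ ^ 2 * (sobW p)⁻¹) := by
          rw [ENNReal.mul_inv_cancel (sobW_ne_zero p) (sobW_ne_top p), one_mul]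
  refine (lintegral_mono h1).trans_lt ?_
  rw [lintegral_const_mul' _ _ (by finiteness)]
  exact ENNReal.mul_lt_top (by finiteness) hX

/-- A square integrable density on the line belongs to the dual of the Sobolev space. -/
theorem lintegral_coord_sq_mul_inv_sobW_lt_top {a : ℝ → ℂ} (ha : Measurable a)
    (ha2 : ∫⁻ s, ‖a s‖ₑ ^ 2 < ∞) : ∫⁻ p : Plane, ‖a (p 0)‖ₑ ^ 2 * (sobW p)⁻¹ < ∞ := by
  rw [lintegral_plane_slices (by fun_prop)]
  have h1 : ∀ s : ℝ, ∫⁻ t : ℝ, ‖a (planeEquiv (s, t) 0)‖ₑ ^ 2 * (sobW (planeEquiv (s, t)))⁻¹ ≤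
      ‖a s‖ₑ ^ 2 * ENNReal.ofReal Real.pi := fun s => by
    simp only [planeEquiv_zero]
    rw [lintegral_const_mul' _ _ (by finiteness)]
    exact mul_le_mul' le_rfl (lintegral_inv_sobW_slice_le s)
  refine (lintegral_mono h1).trans_lt ?_
  rw [lintegral_mul_const' _ _ (by finiteness)]
  exact ENNReal.mul_lt_top ha2 ENNReal.ofReal_lt_top

/-- The Fourier transform of the restriction to the line of the free potential with the Fourier
transform `m / (4π²|p|² - k²)`. -/
def sliceInt (k : ℂ) (m : Plane → ℂ) (s : ℝ) : ℂ :=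
  ∫ t : ℝ, m (planeEquiv (s, t)) / symb k (planeEquiv (s, t))

theorem measurable_div_symb {m : Plane → ℂ} (hm : Measurable m) :
    Measurable fun p => m p / symb k p := hm.div (continuous_symb k).measurable

theorem measurable_sliceInt {m : Plane → ℂ} (hm : Measurable m) : Measurable (sliceInt k m) := by
  refine StronglyMeasurable.measurable ?_
  refine StronglyMeasurable.integral_prod_right' (f := fun z : ℝ × ℝ =>
    m (planeEquiv z) / symb k (planeEquiv z)) ?_
  exact ((measurable_div_symb hm).comp planeEquiv.measurable).stronglyMeasurable

theorem lintegral_sliceInt_sq_lt_top (hk : ∀ r : ℝ, 0 ≤ r → k ^ 2 ≠ (r : ℂ)) {m : Plane → ℂ}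
    (hm : Measurable m) (hm2 : ∫⁻ p, ‖m p‖ₑ ^ 2 * (sobW p)⁻¹ < ∞) :
    ∫⁻ s, ‖sliceInt k m s‖ₑ ^ 2 < ∞ := by
  obtain ⟨K, hK, h⟩ := exists_enorm_inv_symb_le hk
  have h1 : ∀ s : ℝ, ‖sliceInt k m s‖ₑ ^ 2 ≤ (K ^ 2 * ENNReal.ofReal Real.pi) *
      ∫⁻ t : ℝ, ‖m (planeEquiv (s, t))‖ₑ ^ 2 * (sobW (planeEquiv (s, t)))⁻¹ := fun s => by
    set u : ℝ → ℝ≥0∞ := fun t => (sobW (planeEquiv (s, t)))⁻¹ ^ (1 / 2 : ℝ) with hu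
    have hum : Measurable u := by
      have : Measurable fun t : ℝ => planeEquiv (s, t) := by fun_prop
      exact ((measurable_sobW.comp this).inv).pow_const _
    have hu2 : ∀ t, u t ^ 2 = (sobW (planeEquiv (s, t)))⁻¹ := fun t => by
      rw [hu, ← ENNReal.rpow_natCast, ← ENNReal.rpow_mul]
      norm_num
    have h2 : ‖sliceInt k m s‖ₑ ≤ K * ∫⁻ t : ℝ, (‖m (planeEquiv (s, t))‖ₑ * u t) * u t := by
      rw [← lintegral_const_mul' _ _ hK]
      refine (enorm_integral_le_lintegral_enorm _).trans (lintegral_mono fun t => ?_)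
      rw [div_eq_mul_inv, enorm_mul]
      refine (mul_le_mul' le_rfl (h _)).trans_eq ?_
      rw [← hu2]
      ring
    have hmt : Measurable fun t : ℝ => ‖m (planeEquiv (s, t))‖ₑ := by fun_prop
    calc ‖sliceInt k m s‖ₑ ^ 2
        ≤ (K * ∫⁻ t : ℝ, (‖m (planeEquiv (s, t))‖ₑ * u t) * u t) ^ 2 := pow_le_pow_left' h2 2
      _ ≤ K ^ 2 * ((∫⁻ t : ℝ, (‖m (planeEquiv (s, t))‖ₑ * u t) ^ 2) * ∫⁻ t : ℝ, u t ^ 2) := by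
          rw [mul_pow]
          exact mul_le_mul' le_rfl
            (lintegral_mul_sq_le _ (hmt.mul hum).aemeasurable hum.aemeasurable)
      _ ≤ K ^ 2 * ((∫⁻ t : ℝ, ‖m (planeEquiv (s, t))‖ₑ ^ 2 * (sobW (planeEquiv (s, t)))⁻¹) *
            ENNReal.ofReal Real.pi) := by
          simp only [mul_pow, hu2]
          gcongr
          exact lintegral_inv_sobW_slice_le s
      _ = _ := by ring
  refine (lintegral_mono h1).trans_lt ?_
  rw [lintegral_const_mul' _ _ (by finiteness), ← lintegral_plane_slices
    (f := fun p => ‖m p‖ₑ ^ 2 * (sobW p)⁻¹) (by fun_prop)]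
  exact ENNReal.mul_lt_top (by finiteness) hm2

/-- The Fourier transform of the density on the line that compensates for the potential with the
Fourier transform `m / (4π²|p|² - k²)`. -/
def lineDensity (α : ℝ) (k : ℂ) (m : Plane → ℂ) (s : ℝ) : ℂ :=
  2 * α * lineMul α k s * sliceInt k m s

theorem measurable_lineDensity {m : Plane → ℂ} (hm : Measurable m) :
    Measurable (lineDensity α k m) :=
  (measurable_lineMul.const_mul _).mul (measurable_sliceInt hm)

theorem lintegral_lineDensity_sq_lt_top (hα : 0 < α)
    (hk : ∀ r : ℝ, -α ^ 2 / 4 ≤ r → k ^ 2 ≠ (r : ℂ)) {m : Plane → ℂ} (hm : Measurable m)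
    (hm2 : ∫⁻ p, ‖m p‖ₑ ^ 2 * (sobW p)⁻¹ < ∞) : ∫⁻ s, ‖lineDensity α k m s‖ₑ ^ 2 < ∞ := by
  obtain ⟨C, hC⟩ := exists_norm_lineMul_le hα hk
  have h1 : ∀ s, ‖lineDensity α k m s‖ₑ ^ 2 ≤
      (‖(2 * α : ℂ)‖ₑ * ENNReal.ofReal C) ^ 2 * ‖sliceInt k m s‖ₑ ^ 2 := fun s => by
    rw [lineDensity, enorm_mul, enorm_mul, mul_pow]
    gcongr
    rw [← ofReal_norm]
    exact ENNReal.ofReal_le_ofReal (hC s)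
  refine (lintegral_mono h1).trans_lt ?_
  rw [lintegral_const_mul' _ _ (by finiteness)]
  exact ENNReal.mul_lt_top (by finiteness)
    (lintegral_sliceInt_sq_lt_top (sq_ne_of_nonneg hk) hm hm2)

/-- The Fourier transform of the potential of the line resolvent. -/
def potHat (α : ℝ) (k : ℂ) (m : Plane → ℂ) (p : Plane) : ℂ :=
  (m p + lineDensity α k m (p 0)) / symb k p

theorem measurable_potHat {m : Plane → ℂ} (hm : Measurable m) : Measurable (potHat α k m) :=
  measurable_div_symb (hm.add ((measurable_lineDensity hm).comp (by fun_prop)))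

theorem lintegral_sobW_mul_potHat_sq_lt_top (hα : 0 < α)
    (hk : ∀ r : ℝ, -α ^ 2 / 4 ≤ r → k ^ 2 ≠ (r : ℂ)) {m : Plane → ℂ} (hm : Measurable m)
    (hm2 : ∫⁻ p, ‖m p‖ₑ ^ 2 * (sobW p)⁻¹ < ∞) :
    ∫⁻ p, sobW p * ‖potHat α k m p‖ₑ ^ 2 < ∞ := by
  refine lintegral_sobW_div_symb_sq_lt_top (sq_ne_of_nonneg hk) ?_
  have hA := lintegral_coord_sq_mul_inv_sobW_lt_top (measurable_lineDensity hm)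
    (lintegral_lineDensity_sq_lt_top hα hk hm hm2)
  have hAm : Measurable fun p : Plane => lineDensity α k m (p 0) :=
    (measurable_lineDensity hm).comp (by fun_prop)
  have h1 : ∀ p : Plane, ‖m p + lineDensity α k m (p 0)‖ₑ ^ 2 * (sobW p)⁻¹ ≤
      2 * (‖m p‖ₑ ^ 2 * (sobW p)⁻¹) + 2 * (‖lineDensity α k m (p 0)‖ₑ ^ 2 * (sobW p)⁻¹) :=
    fun p => by
    rw [← mul_assoc, ← mul_assoc, ← add_mul]
    gcongr
    exact enorm_add_sq_le _ _
  refine (lintegral_mono h1).trans_lt ?_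
  rw [lintegral_add_left (by fun_prop), lintegral_const_mul' _ _ ENNReal.ofNat_ne_top,
    lintegral_const_mul' _ _ ENNReal.ofNat_ne_top]
  exact ENNReal.add_lt_top.2 ⟨ENNReal.mul_lt_top (by simp) hm2, ENNReal.mul_lt_top (by simp) hA⟩

/-- The trace on the line of the potential of the line resolvent is the density divided by `α`. -/
theorem integral_potHat_slice (hα : 0 < α) (hk : ∀ r : ℝ, -α ^ 2 / 4 ≤ r → k ^ 2 ≠ (r : ℂ))
    {m : Plane → ℂ} (hm : Measurable m) {C : ℝ} (hmC : ∀ p, ‖m p‖ ≤ C) (s : ℝ) :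
    α * ∫ t : ℝ, potHat α k m (planeEquiv (s, t)) = lineDensity α k m s := by
  have hk0 := sq_ne_of_nonneg hk
  have hi := integrable_one_div_symb_slice hk0 s
  have h1 : ∀ t : ℝ, potHat α k m (planeEquiv (s, t)) =
      m (planeEquiv (s, t)) * (1 / symb k (planeEquiv (s, t))) +
        lineDensity α k m s * (1 / symb k (planeEquiv (s, t))) := fun t => by
    rw [potHat, planeEquiv_zero]
    ring
  have h2 : Integrable fun t : ℝ => m (planeEquiv (s, t)) * (1 / symb k (planeEquiv (s, t))) :=
    hi.bdd_mul (c := C) (Measurable.aestronglyMeasurable (by fun_prop)) (.of_forall fun t => hmC _)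
  have hα0 : (α : ℂ) ≠ 0 := Complex.ofReal_ne_zero.2 hα.ne'
  have hτ := tau_ne_zero hk0 (2 * Real.pi * s)
  have hτα := two_mul_tau_sub_ne_zero hk (2 * Real.pi * s)
  simp only [h1]
  rw [integral_add h2 (hi.const_mul _), integral_const_mul, integral_one_div_symb_slice hk0]
  have h3 : ∫ t : ℝ, m (planeEquiv (s, t)) * (1 / symb k (planeEquiv (s, t))) =
      sliceInt k m s := by simp only [sliceInt, mul_one_div]
  rw [h3, lineDensity, lineMul]
  field_simp
  ring

end Line

/-! ### The kernel of the line resolvent -/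

section Kernel

variable {α : ℝ} {k : ℂ}

/-- The weight `(1 + s²)^{-2/3}`. Its integrability in one variable gives that of the triple
integral in the kernel. -/
def decay (s : ℝ) : ℝ := (1 + s ^ 2) ^ (-(2 / 3) : ℝ)

theorem decay_pos (s : ℝ) : 0 < decay s := Real.rpow_pos_of_pos (by positivity) _

theorem integrable_decay : Integrable decay := by
  have h := integrable_rpow_neg_one_add_norm_sq (E := ℝ) (μ := volume) (r := 4 / 3)
    (by rw [Module.finrank_self]; norm_num)
  refine h.congr (.of_forall fun s => ?_)
  simp only [decay, Real.norm_eq_abs, sq_abs]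
  norm_num

/-- The power `-2/3` leaves an integrable weight in `t`, and two such factors an integrable weight
in `s`. -/
theorem inv_one_add_sq_le (s t : ℝ) :
    (1 + (s ^ 2 + t ^ 2))⁻¹ ≤ decay s ^ (1 / 2 : ℝ) * decay t := by
  have h0 : 0 < 1 + (s ^ 2 + t ^ 2) := by positivity
  have h1 : (1 + (s ^ 2 + t ^ 2))⁻¹ = (1 + (s ^ 2 + t ^ 2)) ^ (-(1 / 3) : ℝ) *
      (1 + (s ^ 2 + t ^ 2)) ^ (-(2 / 3) : ℝ) := by
    rw [← Real.rpow_add h0, ← Real.rpow_neg_one]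
    norm_num
  rw [h1, decay, decay, ← Real.rpow_mul (by positivity)]
  norm_num only [one_div]
  refine mul_le_mul ?_ ?_ (by positivity) (by positivity)
  · exact Real.rpow_le_rpow_of_nonpos (by positivity) (by linarith [sq_nonneg t]) (by norm_num)
  · exact Real.rpow_le_rpow_of_nonpos (by positivity) (by linarith [sq_nonneg s]) (by norm_num)

theorem exists_norm_inv_symb_le_decay (hk : ∀ r : ℝ, 0 ≤ r → k ^ 2 ≠ (r : ℂ)) :
    ∃ K : ℝ, 0 ≤ K ∧ ∀ s t : ℝ,
      ‖(symb k (planeEquiv (s, t)))⁻¹‖ ≤ K * (decay s ^ (1 / 2 : ℝ) * decay t) := by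
  obtain ⟨c, hc, h⟩ := exists_mul_le_norm_symb hk
  refine ⟨c⁻¹, by positivity, fun s t => ?_⟩
  have h1 := h (planeEquiv (s, t))
  rw [norm_sq_planeEquiv] at h1
  rw [norm_inv]
  refine (inv_anti₀ (by positivity) h1).trans ?_
  rw [mul_inv]
  exact mul_le_mul_of_nonneg_left (inv_one_add_sq_le s t) (by positivity)

theorem decay_half_mul (s : ℝ) : decay s ^ (1 / 2 : ℝ) * decay s ^ (1 / 2 : ℝ) = decay s := by
  rw [← Real.rpow_add (decay_pos s)]
  norm_num

/-- The density of the triple integral in the kernel, without the exponentials. -/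
def tripleDensity (α : ℝ) (k : ℂ) (z : ℝ × ℝ × ℝ) : ℂ :=
  lineMul α k z.1 * ((symb k (planeEquiv (z.1, z.2.1)))⁻¹ * (symb k (planeEquiv (z.1, z.2.2)))⁻¹)

theorem measurable_tripleDensity : Measurable (tripleDensity α k) := by
  have h1 := measurable_lineMul (α := α) (k := k)
  have h2 := (continuous_symb k).measurable
  have h3 : Measurable fun z : ℝ × ℝ × ℝ => planeEquiv (z.1, z.2.1) := by fun_prop
  have h4 : Measurable fun z : ℝ × ℝ × ℝ => planeEquiv (z.1, z.2.2) := by fun_prop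
  exact (h1.comp measurable_fst).mul ((h2.comp h3).inv.mul (h2.comp h4).inv)

theorem integrable_tripleDensity (hα : 0 < α)
    (hk : ∀ r : ℝ, -α ^ 2 / 4 ≤ r → k ^ 2 ≠ (r : ℂ)) : Integrable (tripleDensity α k) := by
  obtain ⟨C, hC⟩ := exists_norm_lineMul_le hα hk
  obtain ⟨K, hK, h⟩ := exists_norm_inv_symb_le_decay (sq_ne_of_nonneg hk)
  have hC0 : 0 ≤ C := (norm_nonneg _).trans (hC 0)
  have h1 := (integrable_decay.mul_prod (integrable_decay.mul_prod integrable_decay)).const_mul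
    (C * (K * K))
  refine h1.mono' measurable_tripleDensity.aestronglyMeasurable (.of_forall fun z => ?_)
  rw [tripleDensity, norm_mul, norm_mul]
  calc _ ≤ C * ((K * (decay z.1 ^ (1 / 2 : ℝ) * decay z.2.1)) *
        (K * (decay z.1 ^ (1 / 2 : ℝ) * decay z.2.2))) := by
        gcongr
        · exact hC _
        · exact mul_nonneg hK (by have := decay_pos z.1; have := decay_pos z.2.1; positivity)
        · exact h _ _
        · exact h _ _
    _ = C * (K * K) * ((decay z.1 ^ (1 / 2 : ℝ) * decay z.1 ^ (1 / 2 : ℝ)) *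
        (decay z.2.1 * decay z.2.2)) := by ring
    _ = _ := by rw [decay_half_mul]

/-- The integrand of the triple integral in the kernel: `z = (p₁, p₂, p₂')`, and the point `y`
enters with the opposite sign. -/
def tripleWave (α : ℝ) (k : ℂ) (x y : Plane) (z : ℝ × ℝ × ℝ) : ℂ :=
  wave (planeEquiv (z.1, z.2.1)) x * wave (planeEquiv (z.1, z.2.2)) (-y) * tripleDensity α k z

/-- The integration variables are rescaled by `2π`, to the normalization of `wave`. -/
theorem lineKernel_eq (x y : Plane) :
    lineKernel α k x y = freeKernel k x y + 2 * α * ∫ z, tripleWave α k x y z := by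
  have hπ : (Real.pi : ℂ) ≠ 0 := Complex.ofReal_ne_zero.2 Real.pi_ne_zero
  rw [lineKernel]
  congr 1
  set f : ℝ × ℝ × ℝ → ℂ := fun q =>
      Complex.exp (Complex.I * ((q.1 * x 0 + q.2.1 * x 1 : ℝ) : ℂ)
          - Complex.I * ((q.1 * y 0 + q.2.2 * y 1 : ℝ) : ℂ))
        / ((((q.1 ^ 2 + q.2.1 ^ 2 : ℝ) : ℂ) - k ^ 2) * (((q.1 ^ 2 + q.2.2 ^ 2 : ℝ) : ℂ) - k ^ 2))
        * (tau k q.1 / (2 * tau k q.1 - (α : ℂ))) with hf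
  have h1 : ∀ z, f ((2 * Real.pi) • z) = tripleWave α k x y z := fun z => by
    simp only [hf, tripleWave, tripleDensity, wave, lineMul, symb, norm_sq_planeEquiv, inner_plane,
      planeEquiv_zero, planeEquiv_one, Prod.smul_fst, Prod.smul_snd, smul_eq_mul]
    rw [← Complex.exp_add, div_eq_mul_inv, mul_inv, PiLp.neg_apply, PiLp.neg_apply]
    rw [show (2 * Real.pi * z.1) ^ 2 + (2 * Real.pi * z.2.1) ^ 2 =
        4 * Real.pi ^ 2 * (z.1 ^ 2 + z.2.1 ^ 2) by ring,
      show (2 * Real.pi * z.1) ^ 2 + (2 * Real.pi * z.2.2) ^ 2 =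
        4 * Real.pi ^ 2 * (z.1 ^ 2 + z.2.2 ^ 2) by ring]
    have h2 : Complex.I * ((2 * Real.pi * z.1 * x 0 + 2 * Real.pi * z.2.1 * x 1 : ℝ) : ℂ) -
        Complex.I * ((2 * Real.pi * z.1 * y 0 + 2 * Real.pi * z.2.2 * y 1 : ℝ) : ℂ) =
        ((2 * Real.pi * (z.1 * x 0 + z.2.1 * x 1) : ℝ) : ℂ) * Complex.I +
        ((2 * Real.pi * (z.1 * -y 0 + z.2.2 * -y 1) : ℝ) : ℂ) * Complex.I := by
      push_cast
      ring
    rw [h2]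
    ring
  have : (volume : Measure (ℝ × ℝ)).IsAddHaarMeasure := Measure.prod.instIsAddHaarMeasure _ _
  have : (volume : Measure (ℝ × ℝ × ℝ)).IsAddHaarMeasure :=
    Measure.prod.instIsAddHaarMeasure _ _
  -- the substitution `q = 2πz` in `ℝ³`
  have h3 := Measure.integral_comp_smul (volume : Measure (ℝ × ℝ × ℝ)) f (2 * Real.pi)
  have h4 : Module.finrank ℝ (ℝ × ℝ × ℝ) = 3 := by simp
  simp only [h1] at h3
  rw [h3, h4, abs_of_pos (by positivity), Complex.real_smul]
  push_cast
  field_simp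
  ring

theorem integrable_mul_tripleWave (hα : 0 < α)
    (hk : ∀ r : ℝ, -α ^ 2 / 4 ≤ r → k ^ 2 ≠ (r : ℂ)) {ν : Measure Plane} [SFinite ν]
    {h : Plane → ℂ} (hh : Integrable h ν) (x : Plane) :
    Integrable (fun w : Plane × ℝ × ℝ × ℝ => h w.1 * tripleWave α k x w.1 w.2)
      (ν.prod volume) := by
  have h1 := hh.mul_prod (integrable_tripleDensity hα hk)
  refine (h1.bdd_mul (c := 1) (f := fun w : Plane × ℝ × ℝ × ℝ =>
    wave (planeEquiv (w.2.1, w.2.2.1)) x * wave (planeEquiv (w.2.1, w.2.2.2)) (-w.1))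
    (Continuous.aestronglyMeasurable (by fun_prop)) (.of_forall fun w => ?_)).congr
    (.of_forall fun w => ?_)
  · rw [norm_mul, norm_wave, norm_wave, one_mul]
  · simp only [tripleWave]
    ring

theorem exists_norm_sliceInt_le (hk : ∀ r : ℝ, 0 ≤ r → k ^ 2 ≠ (r : ℂ)) {m : Plane → ℂ} {M : ℝ}
    (hM : ∀ p, ‖m p‖ ≤ M) : ∃ K : ℝ, ∀ s, ‖sliceInt k m s‖ ≤ K * decay s ^ (1 / 2 : ℝ) := by
  obtain ⟨K, hK, h⟩ := exists_norm_inv_symb_le_decay hk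
  have hM0 : 0 ≤ M := (norm_nonneg _).trans (hM 0)
  refine ⟨M * K * ∫ t, decay t, fun s => ?_⟩
  have h1 : ∀ t : ℝ, ‖m (planeEquiv (s, t)) / symb k (planeEquiv (s, t))‖ ≤
      M * (K * (decay s ^ (1 / 2 : ℝ) * decay t)) := fun t => by
    rw [div_eq_mul_inv, norm_mul]
    exact mul_le_mul (hM _) (h s t) (norm_nonneg _) hM0
  refine (norm_integral_le_of_norm_le
    (((integrable_decay.const_mul _).const_mul _).const_mul _) (.of_forall h1)).trans_eq ?_
  rw [integral_const_mul, integral_const_mul, integral_const_mul]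
  ring

theorem integrable_lineDensity_div_symb (hα : 0 < α)
    (hk : ∀ r : ℝ, -α ^ 2 / 4 ≤ r → k ^ 2 ≠ (r : ℂ)) {m : Plane → ℂ} (hm : Measurable m) {M : ℝ}
    (hM : ∀ p, ‖m p‖ ≤ M) : Integrable fun p : Plane => lineDensity α k m (p 0) / symb k p := by
  obtain ⟨C, hC⟩ := exists_norm_lineMul_le hα hk
  obtain ⟨K, hK, h⟩ := exists_norm_inv_symb_le_decay (sq_ne_of_nonneg hk)
  obtain ⟨L, hL⟩ := exists_norm_sliceInt_le (sq_ne_of_nonneg hk) hM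
  have hC0 : 0 ≤ C := (norm_nonneg _).trans (hC 0)
  have hmeas : Measurable fun p : Plane => lineDensity α k m (p 0) / symb k p :=
    measurable_div_symb (m := fun p : Plane => lineDensity α k m (p 0))
      ((measurable_lineDensity hm).comp (by fun_prop))
  refine integrable_plane.2 (((integrable_decay.mul_prod integrable_decay).const_mul
    (2 * |α| * C * (L * K))).mono' (hmeas.comp planeEquiv.measurable).aestronglyMeasurable
    (.of_forall fun z => ?_))
  rw [lineDensity, planeEquiv_zero, div_eq_mul_inv, norm_mul, norm_mul, norm_mul, norm_mul,
    Complex.norm_real, Complex.norm_ofNat, Real.norm_eq_abs]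
  have hz := decay_pos z.1
  calc _ ≤ 2 * |α| * C * (L * decay z.1 ^ (1 / 2 : ℝ)) *
        (K * (decay z.1 ^ (1 / 2 : ℝ) * decay z.2)) := by
        have hL0 := (norm_nonneg _).trans (hL z.1)
        gcongr
        · exact hC _
        · exact hL _
        · exact h _ _
    _ = 2 * |α| * C * (L * K) * ((decay z.1 ^ (1 / 2 : ℝ) * decay z.1 ^ (1 / 2 : ℝ)) *
        decay z.2) := by ring
    _ = _ := by rw [decay_half_mul]

/-- The second term of the kernel, integrated against `h ν`, in Fourier representation. -/
theorem integral_mul_tripleWave (hα : 0 < α)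
    (hk : ∀ r : ℝ, -α ^ 2 / 4 ≤ r → k ^ 2 ≠ (r : ℂ)) {ν : Measure Plane} [SFinite ν]
    {h : Plane → ℂ} (hh : Integrable h ν) (x : Plane) :
    2 * α * ∫ y, h y * (∫ z, tripleWave α k x y z) ∂ν =
      invHat (fun p => lineDensity α k (hat ν h) (p 0) / symb k p) x := by
  have h1 := integrable_mul_tripleWave hα hk hh x
  have hswap : ∫ y, h y * (∫ z, tripleWave α k x y z) ∂ν =
      ∫ z, ∫ y, h y * tripleWave α k x y z ∂ν := by
    rw [← integral_integral_swap h1]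
    simp only [integral_const_mul]
  have h2 : ∀ z : ℝ × ℝ × ℝ, ∫ y, h y * tripleWave α k x y z ∂ν =
      wave (planeEquiv (z.1, z.2.1)) x * tripleDensity α k z *
        hat ν h (planeEquiv (z.1, z.2.2)) := fun z => by
    rw [hat, ← integral_const_mul]
    refine integral_congr_ae (.of_forall fun y => ?_)
    simp only [tripleWave]
    ring
  have h3 : Integrable fun z : ℝ × ℝ × ℝ => wave (planeEquiv (z.1, z.2.1)) x *
      tripleDensity α k z * hat ν h (planeEquiv (z.1, z.2.2)) :=
    h1.integral_prod_right.congr (.of_forall h2)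
  have hm : Measurable (hat ν h) := (continuous_hat hh).measurable
  have h4 := integrable_wave_mul
    (integrable_lineDensity_div_symb hα hk hm (norm_hat_le ν h)) x
  rw [hswap, integral_congr_ae (.of_forall h2), Measure.volume_eq_prod, integral_prod _ h3,
    invHat, integral_plane_slices h4, ← integral_const_mul]
  refine integral_congr_ae (.of_forall fun s => ?_)
  have h5 : ∀ z : ℝ × ℝ, wave (planeEquiv (s, z.1)) x * tripleDensity α k (s, z) *
      hat ν h (planeEquiv (s, z.2)) = lineMul α k s *
      ((wave (planeEquiv (s, z.1)) x * (symb k (planeEquiv (s, z.1)))⁻¹) *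
        (hat ν h (planeEquiv (s, z.2)) / symb k (planeEquiv (s, z.2)))) := fun z => by
    rw [tripleDensity, div_eq_mul_inv]
    ring
  simp only [h5]
  rw [integral_const_mul, Measure.volume_eq_prod,
    integral_prod_mul (fun t : ℝ => wave (planeEquiv (s, t)) x * (symb k (planeEquiv (s, t)))⁻¹)
      (fun u : ℝ => hat ν h (planeEquiv (s, u)) / symb k (planeEquiv (s, u)))]
  have h6 : ∀ t : ℝ, wave (planeEquiv (s, t)) x *
      (lineDensity α k (hat ν h) (planeEquiv (s, t) 0) / symb k (planeEquiv (s, t))) =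
      lineDensity α k (hat ν h) s *
        (wave (planeEquiv (s, t)) x * (symb k (planeEquiv (s, t)))⁻¹) := fun t => by
    rw [planeEquiv_zero, div_eq_mul_inv]
    ring
  simp only [h6]
  rw [integral_const_mul, lineDensity, sliceInt]
  ring

end Kernel

/-! ### The potential of a density -/

section Potential

variable {α : ℝ} {k : ℂ}

/-- The potential of an integrable density converges absolutely almost everywhere on every Kato
measure, by Tonelli. -/
theorem IsKato.lintegral_mul_k0_lt_top {η ν : Measure Plane} (hη : IsKato η) [SFinite η]
    [SFinite ν] {a : Plane → ℝ≥0∞} (ha : Measurable a) (ha1 : ∫⁻ y, a y ∂ν < ∞) {c : ℝ}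
    (hc : 0 < c) : ∀ᵐ x ∂η, ∫⁻ y, a y * k0 (c * ‖x - y‖) ∂ν < ∞ := by
  obtain ⟨C, hC⟩ := hη c hc
  have hk : Measurable fun z : Plane × Plane => k0 (c * ‖z.1 - z.2‖) :=
    measurable_k0.comp (by fun_prop)
  have hm : Measurable fun z : Plane × Plane => a z.2 * k0 (c * ‖z.1 - z.2‖) := by fun_prop
  refine ae_lt_top hm.lintegral_prod_right' (ne_of_lt ?_)
  rw [lintegral_lintegral_swap hm.aemeasurable]
  have h1 : ∀ y, ∫⁻ x, a y * k0 (c * ‖x - y‖) ∂η ≤ C * a y := fun y => by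
    have hmx : Measurable fun x => k0 (c * ‖x - y‖) := measurable_k0.comp (by fun_prop)
    rw [lintegral_const_mul _ hmx, mul_comm]
    refine mul_le_mul' ?_ le_rfl
    simp only [norm_sub_rev _ y]
    exact hC y
  refine (lintegral_mono h1).trans_lt ?_
  rw [lintegral_const_mul _ ha]
  exact ENNReal.mul_lt_top ENNReal.coe_lt_top ha1

theorem integrable_mul_freeKernel {ν : Measure Plane} {h : Plane → ℂ} (hm : Measurable h) {x : Plane}
    {c : ℝ} (hc : c ≤ k.im) (hx : ∫⁻ y, ‖h y‖ₑ * k0 (c * ‖x - y‖) ∂ν < ∞) :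
    Integrable (fun y => h y * freeKernel k x y) ν := by
  have h0 := (measurable_freeKernel k).comp (measurable_prodMk_left (x := x))
  have h1 : Measurable (freeKernel k x) := h0
  refine ⟨(hm.mul h1).aestronglyMeasurable, lt_of_le_of_lt (lintegral_mono fun y => ?_) hx⟩
  rw [enorm_mul]
  refine mul_le_mul' le_rfl ((enorm_freeKernel_le k x y).trans (k0_antitone ?_))
  exact mul_le_mul_of_nonneg_right hc (norm_nonneg _)

theorem integrable_mul_lineKernel (hα : 0 < α)
    (hk : ∀ r : ℝ, -α ^ 2 / 4 ≤ r → k ^ 2 ≠ (r : ℂ)) {ν : Measure Plane} [SFinite ν]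
    {h : Plane → ℂ} (hm : Measurable h) (hh : Integrable h ν) {x : Plane} {c : ℝ} (hc : c ≤ k.im)
    (hx : ∫⁻ y, ‖h y‖ₑ * k0 (c * ‖x - y‖) ∂ν < ∞) :
    Integrable (fun y => lineKernel α k x y * h y) ν := by
  have h2 := (integrable_mul_tripleWave hα hk hh x).integral_prod_left
  simp only [integral_const_mul] at h2
  refine ((integrable_mul_freeKernel hm hc hx).add (h2.const_mul (2 * (α : ℂ)))).congr
    (.of_forall fun y => ?_)
  simp only [lineKernel_eq, Pi.add_apply]
  ring

theorem integral_lineKernel_mul (hα : 0 < α)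
    (hk : ∀ r : ℝ, -α ^ 2 / 4 ≤ r → k ^ 2 ≠ (r : ℂ)) {ν : Measure Plane} [SFinite ν]
    {h : Plane → ℂ} (hm : Measurable h) (hh : Integrable h ν) {x : Plane} {c : ℝ} (hc : c ≤ k.im)
    (hx : ∫⁻ y, ‖h y‖ₑ * k0 (c * ‖x - y‖) ∂ν < ∞) :
    ∫ y, lineKernel α k x y * h y ∂ν = ∫ y, h y * freeKernel k x y ∂ν +
      invHat (fun p => lineDensity α k (hat ν h) (p 0) / symb k p) x := by
  have h2 := (integrable_mul_tripleWave hα hk hh x).integral_prod_left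
  simp only [integral_const_mul] at h2
  rw [← integral_mul_tripleWave hα hk hh x, ← integral_const_mul,
    ← integral_add (integrable_mul_freeKernel hm hc hx) (h2.const_mul (2 * (α : ℂ)))]
  refine integral_congr_ae (.of_forall fun y => ?_)
  simp only [lineKernel_eq]
  ring

/-- Integrable approximations of the Fourier transform of the potential: the symbol `1 / D_k` of
the free resolvent is replaced by `1 / D_k - 1 / D_{il}` with `l = n + 1`. -/
def potApprox (α : ℝ) (k : ℂ) (m : Plane → ℂ) (n : ℕ) (p : Plane) : ℂ :=
  (1 / symb k p - 1 / symb (Complex.I * ((n + 1 : ℝ) : ℂ)) p) * m p +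
    lineDensity α k m (p 0) / symb k p

theorem integrable_potApprox (hα : 0 < α) (hk : ∀ r : ℝ, -α ^ 2 / 4 ≤ r → k ^ 2 ≠ (r : ℂ))
    {m : Plane → ℂ} (hm : Measurable m) {M : ℝ} (hM : ∀ p, ‖m p‖ ≤ M) (n : ℕ) :
    Integrable (potApprox α k m n) :=
  ((integrable_one_div_symb_sub (sq_ne_of_nonneg hk) (I_mul_sq_ne (by positivity))).mul_bdd
    (c := M) hm.aestronglyMeasurable (.of_forall hM)).add
    (integrable_lineDensity_div_symb hα hk hm hM)

/-- The approximations converge in the Sobolev norm, by dominated convergence. -/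
theorem tendsto_potApprox {m : Plane → ℂ} (hm : Measurable m)
    (hm2 : ∫⁻ p, ‖m p‖ₑ ^ 2 * (sobW p)⁻¹ < ∞) :
    Tendsto (fun n => ∫⁻ p, sobW p * ‖potApprox α k m n p - potHat α k m p‖ₑ ^ 2) atTop
      (𝓝 0) := by
  have h1 : ∀ n p, potApprox α k m n p - potHat α k m p =
      -(m p * (symb (Complex.I * ((n + 1 : ℝ) : ℂ)) p)⁻¹) := fun n p => by
    rw [potApprox, potHat]
    ring
  have h2 : ∀ (n : ℕ) p, ‖(symb (Complex.I * ((n + 1 : ℝ) : ℂ)) p)⁻¹‖ₑ =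
      ENNReal.ofReal (4 * Real.pi ^ 2 * ‖p‖ ^ 2 + (n + 1) ^ 2)⁻¹ := fun n p => by
    rw [symb_I_mul, ← ofReal_norm, norm_inv, Complex.norm_real, Real.norm_of_nonneg (by positivity)]
  have hs : ∀ n : ℕ, Measurable fun p : Plane => (symb (Complex.I * ((n + 1 : ℝ) : ℂ)) p)⁻¹ :=
    fun n => (continuous_symb _).measurable.inv
  simp only [h1, enorm_neg, enorm_mul]
  have h3 : ∀ (n : ℕ) p, ‖(symb (Complex.I * ((n + 1 : ℝ) : ℂ)) p)⁻¹‖ₑ ≤ (sobW p)⁻¹ :=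
    fun n p => by
    rw [h2, sobW, ← ENNReal.ofReal_inv_of_pos (by positivity)]
    refine ENNReal.ofReal_le_ofReal (inv_anti₀ (by positivity) ?_)
    have h4 : (1 : ℝ) ≤ 4 * Real.pi ^ 2 := by nlinarith [Real.pi_gt_three]
    have h5 : (1 : ℝ) ≤ ((n : ℝ) + 1) ^ 2 := by
      have : (0 : ℝ) ≤ n := n.cast_nonneg
      nlinarith
    nlinarith [sq_nonneg ‖p‖]
  rw [show (0 : ℝ≥0∞) = ∫⁻ p : Plane, 0 by simp]
  refine tendsto_lintegral_of_dominated_convergence (fun p => ‖m p‖ₑ ^ 2 * (sobW p)⁻¹)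
    (fun n => by have := hs n; fun_prop) (fun n => .of_forall fun p => ?_) hm2.ne
    (.of_forall fun p => ?_)
  · calc _ ≤ sobW p * (‖m p‖ₑ * (sobW p)⁻¹) ^ 2 := by
          refine mul_le_mul' le_rfl (pow_le_pow_left' ?_ 2)
          exact mul_le_mul' le_rfl (h3 n p)
      _ = (sobW p * (sobW p)⁻¹) * (‖m p‖ₑ ^ 2 * (sobW p)⁻¹) := by ring
      _ = _ := by rw [ENNReal.mul_inv_cancel (sobW_ne_zero p) (sobW_ne_top p), one_mul]
  · have h4 : Tendsto (fun n : ℕ => ‖(symb (Complex.I * ((n + 1 : ℝ) : ℂ)) p)⁻¹‖ₑ) atTop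
        (𝓝 0) := by
      simp only [h2]
      rw [← ENNReal.ofReal_zero]
      refine ENNReal.tendsto_ofReal (tendsto_inv_atTop_zero.comp ?_)
      refine tendsto_atTop_add_const_left _ _ ?_
      have h5 : Tendsto (fun n : ℕ => (n : ℝ) + 1) atTop atTop :=
        tendsto_atTop_add_const_right _ _ tendsto_natCast_atTop_atTop
      exact (tendsto_pow_atTop two_ne_zero).comp h5
    have h5 := ENNReal.Tendsto.const_mul h4 (Or.inr (enorm_ne_top (x := m p)))
    rw [mul_zero] at h5
    have h6 := ENNReal.Tendsto.const_mul (tendsto_sq_zero_iff.2 h5) (Or.inr (sobW_ne_top p))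
    rwa [mul_zero] at h6

/-- The approximations converge to the potential at every point where the potential converges
absolutely. -/
theorem tendsto_invHat_potApprox (hα : 0 < α) (hki : 0 < k.im)
    (hk : ∀ r : ℝ, -α ^ 2 / 4 ≤ r → k ^ 2 ≠ (r : ℂ)) {ν : Measure Plane} [SFinite ν]
    {h : Plane → ℂ} (hm : Measurable h) (hh : Integrable h ν) {x : Plane} {c : ℝ}
    (hc : c ≤ k.im) (hc1 : c ≤ 1) (hx : ∫⁻ y, ‖h y‖ₑ * k0 (c * ‖x - y‖) ∂ν < ∞) :
    Tendsto (fun n => invHat (potApprox α k (hat ν h) n) x) atTop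
      (𝓝 (∫ y, lineKernel α k x y * h y ∂ν)) := by
  have hk0 := sq_ne_of_nonneg hk
  have hmm : Measurable (hat ν h) := (continuous_hat hh).measurable
  have hF : ∀ n : ℕ, Integrable fun p =>
      1 / symb k p - 1 / symb (Complex.I * ((n + 1 : ℝ) : ℂ)) p :=
    fun n => integrable_one_div_symb_sub hk0 (I_mul_sq_ne (by positivity))
  have h1 : ∀ n, invHat (potApprox α k (hat ν h) n) x =
      ∫ y, h y * invHat (fun p => 1 / symb k p - 1 / symb (Complex.I * ((n + 1 : ℝ) : ℂ)) p)
        (x - y) ∂ν + invHat (fun p => lineDensity α k (hat ν h) (p 0) / symb k p) x := fun n => by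
    rw [← invHat_mul_hat hh (hF n), invHat, invHat, invHat, ← integral_add]
    · simp only [potApprox, mul_add]
    · exact integrable_wave_mul ((hF n).mul_bdd (c := ∫ y, ‖h y‖ ∂ν) hmm.aestronglyMeasurable
        (.of_forall (norm_hat_le ν h))) x
    · exact integrable_wave_mul (integrable_lineDensity_div_symb hα hk hmm (norm_hat_le ν h)) x
  simp only [h1]
  rw [integral_lineKernel_mul hα hk hm hh hc hx]
  refine Tendsto.add_const _ ?_
  -- away from the zeros of `h`, the diagonal is negligible because `k0` is infinite there
  have hkx : Measurable fun y => k0 (c * ‖x - y‖) := measurable_k0.comp (by fun_prop)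
  have hae : ∀ᵐ y ∂ν, ‖h y‖ₑ * k0 (c * ‖x - y‖) < ∞ := ae_lt_top (by fun_prop) hx.ne
  have hval : ∀ᵐ y ∂ν, h y = 0 ∨ (x - y ≠ 0) := by
    filter_upwards [hae] with y hy
    by_contra! h0
    rw [h0.2, norm_zero, mul_zero, k0_zero, ENNReal.mul_top (by simpa using h0.1)] at hy
    exact lt_irrefl _ hy
  -- off the diagonal the approximation is a difference of two free kernels, and the second one
  -- tends to `0`
  have hdiff : ∀ (n : ℕ) (z : Plane), z ≠ 0 →
      invHat (fun p => 1 / symb k p - 1 / symb (Complex.I * ((n + 1 : ℝ) : ℂ)) p) z =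
        freeKernel k z 0 - freeKernel (Complex.I * ((n + 1 : ℝ) : ℂ)) z 0 := fun n z hz =>
    integral_wave_mul_one_div_symb_sub hki (by simp; positivity) hk0
      (I_mul_sq_ne (by positivity)) hz
  have him : ∀ n : ℕ, (Complex.I * ((n + 1 : ℝ) : ℂ)).im = n + 1 := fun n => by simp
  refine tendsto_integral_of_dominated_convergence
    (fun y => (‖h y‖ₑ * k0 (c * ‖x - y‖)).toReal * 2) (fun n => ?_) ?_ (fun n => ?_) ?_
  · have := continuous_invHat (hF n)
    have h2 : Continuous fun y =>
      invHat (fun p => 1 / symb k p - 1 / symb (Complex.I * ((n + 1 : ℝ) : ℂ)) p) (x - y) := by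
      fun_prop
    exact (hm.mul h2.measurable).aestronglyMeasurable
  · exact (integrable_toReal_of_lintegral_ne_top (by fun_prop) hx.ne).mul_const _
  · filter_upwards [hae, hval] with y hy hv
    rcases hv with hv | hv
    · simp [hv]
    rw [hdiff n _ hv]
    have h2 : ‖h y * (freeKernel k (x - y) 0 -
        freeKernel (Complex.I * ((n + 1 : ℝ) : ℂ)) (x - y) 0)‖ₑ ≤
        ‖h y‖ₑ * k0 (c * ‖x - y‖) * 2 := by
      rw [enorm_mul, mul_assoc]
      refine mul_le_mul' le_rfl ((enorm_sub_le).trans ?_)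
      rw [mul_two]
      refine add_le_add ((enorm_freeKernel_le _ _ _).trans (k0_antitone ?_))
        ((enorm_freeKernel_le _ _ _).trans (k0_antitone ?_))
      · rw [sub_zero]
        gcongr
      · rw [sub_zero, him]
        refine mul_le_mul_of_nonneg_right (hc1.trans ?_) (norm_nonneg _)
        have : (0 : ℝ) ≤ n := n.cast_nonneg
        linarith
    have h3 := ENNReal.toReal_mono (ENNReal.mul_lt_top hy (by simp)).ne h2
    rwa [toReal_enorm, ENNReal.toReal_mul, ENNReal.toReal_ofNat] at h3
  · filter_upwards [hval] with y hv
    rcases hv with hv | hv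
    · simp [hv]
    simp only [hdiff _ _ hv]
    refine Tendsto.const_mul _ ?_
    rw [freeKernel_eq_sub k x y]
    suffices h0 : Tendsto (fun n : ℕ => freeKernel (Complex.I * ((n + 1 : ℝ) : ℂ)) (x - y) 0)
        atTop (𝓝 0) by simpa using tendsto_const_nhds.sub h0
    rw [tendsto_zero_iff_enorm_tendsto_zero]
    have h4 := (tendsto_k0_mul (norm_pos_iff.2 hv)).comp (tendsto_add_atTop_nat 1)
    refine tendsto_of_tendsto_of_tendsto_of_le_of_le tendsto_const_nhds h4 (fun n => bot_le)
      fun n => (enorm_freeKernel_le _ _ _).trans_eq ?_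
    rw [sub_zero, him]
    simp
end Potential

/-! ### The weak equation of the potential -/

section WeakEquation

variable {α : ℝ} {k : ℂ}

theorem IsKato.lintegral_hat_sq_lt_top {η : Measure Plane} (hη : IsKato η) {h : Plane → ℂ}
    (hm : Measurable h) (hh : Integrable h η) (h2 : MemLp h 2 η) :
    ∫⁻ p, ‖hat η h p‖ₑ ^ 2 * (sobW p)⁻¹ < ∞ := by
  have := hη.isLocallyFiniteMeasure
  obtain ⟨C, hC⟩ := hη (2 * Real.pi) (by positivity)
  refine (lintegral_hat_sq_le hC hm hh).trans_lt ?_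
  have h3 := (memLp_two_iff h2.1).1 h2
  finiteness

theorem IsKato.memLp_schwartz {η : Measure Plane} (hη : IsKato η) (φ : 𝓢(Plane, ℂ)) :
    MemLp φ 2 η := by
  obtain ⟨K, hK, h⟩ := hη.exists_lintegral_invHat_sq_le
  rw [memLp_two_iff φ.continuous.aestronglyMeasurable]
  have h1 := h (𝓕 φ : 𝓢(Plane, ℂ)) (𝓕 φ : 𝓢(Plane, ℂ)).integrable
  simp only [invHat_fourier] at h1
  exact h1.trans_lt (ENNReal.mul_lt_top hK.lt_top (lintegral_sobW_mul_fourier_sq_lt_top φ))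

theorem exists_norm_schwartz_le (φ : 𝓢(Plane, ℂ)) :
    ∃ C : ℝ, ∀ s t : ℝ, ‖φ (planeEquiv (s, t))‖ ≤ C * ((1 + s ^ 2)⁻¹ * (1 + t ^ 2)⁻¹) := by
  obtain ⟨C, hC⟩ : ∃ C : ℝ, ∀ x, (1 + ‖x‖) ^ 4 * ‖φ x‖ ≤ C := by
    have h := SchwartzMap.one_add_le_sup_seminorm_apply (𝕜 := ℝ) (m := (4, 0)) (k := 4) (n := 0)
      le_rfl le_rfl φ
    simp only [norm_iteratedFDeriv_zero] at h
    exact ⟨_, h⟩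
  refine ⟨C, fun s t => ?_⟩
  have h := hC (planeEquiv (s, t))
  have h1 := norm_sq_planeEquiv s t
  have h2 : (1 + s ^ 2) * (1 + t ^ 2) ≤ (1 + ‖planeEquiv (s, t)‖) ^ 4 := by
    have h3 : 1 + ‖planeEquiv (s, t)‖ ^ 2 ≤ (1 + ‖planeEquiv (s, t)‖) ^ 2 := by
      nlinarith [norm_nonneg (planeEquiv (s, t))]
    calc (1 + s ^ 2) * (1 + t ^ 2) ≤ (1 + ‖planeEquiv (s, t)‖ ^ 2) ^ 2 := by
          rw [h1]
          nlinarith [sq_nonneg s, sq_nonneg t, mul_nonneg (sq_nonneg s) (sq_nonneg t)]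
      _ ≤ ((1 + ‖planeEquiv (s, t)‖) ^ 2) ^ 2 := pow_le_pow_left₀ (by positivity) h3 2
      _ = _ := by ring
  rw [← mul_inv, ← div_eq_mul_inv, le_div_iff₀ (by positivity), mul_comm]
  exact (mul_le_mul_of_nonneg_right h2 (norm_nonneg _)).trans h

theorem integrable_schwartz_straightLine (φ : 𝓢(Plane, ℂ)) :
    Integrable φ (arcMeasure straightLine) := by
  obtain ⟨C, hC⟩ := exists_norm_schwartz_le φ
  refine integrable_straightLine.2 ((integrable_inv_one_add_sq.const_mul C).mono'
    (φ.continuous.comp isometry_linePt.continuous).aestronglyMeasurable (.of_forall fun s => ?_))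
  refine (hC s 0).trans_eq ?_
  norm_num

/-- The Fourier transform of the restriction of a Schwartz function to the line is the integral of
its Fourier transform over the perpendicular lines. -/
theorem hat_straightLine (ψ : 𝓢(Plane, ℂ)) (p : Plane) :
    hat (arcMeasure straightLine) ψ p = ∫ t : ℝ, 𝓕 ψ (planeEquiv (p 0, t)) := by
  set F : 𝓢(Plane, ℂ) := 𝓕 ψ with hF
  set d : ℝ → ℂ := fun s => ∫ t : ℝ, F (planeEquiv (s, t)) with hd
  obtain ⟨C, hC⟩ := exists_norm_schwartz_le F
  have hC0 : 0 ≤ C := by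
    have := (norm_nonneg _).trans (hC 0 0)
    norm_num at this
    exact this
  have hFc := F.continuous
  have hcont : Continuous d := by
    refine continuous_of_dominated (bound := fun t => C * (1 + t ^ 2)⁻¹)
      (fun s => (by fun_prop : Continuous fun t : ℝ => F (planeEquiv (s, t))).aestronglyMeasurable)
      (fun s => .of_forall fun t => (hC s t).trans ?_) (integrable_inv_one_add_sq.const_mul C)
      (.of_forall fun t => by fun_prop)
    refine mul_le_mul_of_nonneg_left ?_ hC0
    exact mul_le_of_le_one_left (by positivity) (inv_le_one_of_one_le₀ (by nlinarith [sq_nonneg s]))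
  have hint2 : Integrable fun z : ℝ × ℝ => F (planeEquiv z) := integrable_plane.1 F.integrable
  have hint : Integrable d := hint2.integral_prod_left
  have hinv : 𝓕⁻ d = fun s => ψ (linePt s) := by
    funext s
    rw [← invHat_fourier ψ (linePt s), invHat,
      integral_plane_slices (integrable_wave_mul F.integrable _), Real.fourierInv_eq']
    refine integral_congr_ae (.of_forall fun r => ?_)
    simp only [hd, smul_eq_mul]
    rw [← integral_const_mul]
    refine integral_congr_ae (.of_forall fun t => ?_)
    simp only [wave, inner_plane, planeEquiv_zero, planeEquiv_one, linePt, mul_zero, add_zero]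
    simp only [RCLike.inner_apply, conj_trivial, mul_comm s r]
  have hψ : Integrable fun s => ψ (linePt s) :=
    integrable_straightLine.1 (integrable_schwartz_straightLine ψ)
  -- Fourier inversion is applied to `d`, whose inverse transform is the restriction to the line
  have hdF : 𝓕 (𝓕⁻ d) = d := by
    refine hcont.fourier_fourierInv_eq hint ?_
    have h1 : (fun s => 𝓕 d s) = fun s => (𝓕⁻ d) (-s) := by
      funext s
      rw [Real.fourierInv_eq_fourier_neg, neg_neg]
    change Integrable fun s => 𝓕 d s
    rw [h1, hinv]
    exact hψ.comp_neg
  have h2 := congrFun hdF (p 0)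
  rw [hinv, Real.fourier_eq'] at h2
  refine Eq.trans ?_ h2
  rw [hat, integral_straightLine]
  refine integral_congr_ae (.of_forall fun s => ?_)
  simp only [wave, inner_plane, PiLp.neg_apply, planeEquiv_zero, planeEquiv_one, linePt, neg_zero,
    mul_zero, add_zero, RCLike.inner_apply, conj_trivial, smul_eq_mul]
  congr 3
  push_cast
  ring

theorem conj_integral_mul_conj {μ : Measure Plane} (f g : Plane → ℂ) :
    starRingEnd ℂ (∫ x, f x * starRingEnd ℂ (g x) ∂μ) = ∫ x, starRingEnd ℂ (f x) * g x ∂μ := by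
  rw [← integral_conj]
  simp

/-- The pairing of a Schwartz function with the density on the line is `α` times its pairing with
the trace of the potential. -/
theorem integral_conj_fourier_mul_lineDensity (hα : 0 < α)
    (hk : ∀ r : ℝ, -α ^ 2 / 4 ≤ r → k ^ 2 ≠ (r : ℂ)) {m : Plane → ℂ} (hm : Measurable m) {M : ℝ}
    (hM : ∀ p, ‖m p‖ ≤ M) (hm2 : ∫⁻ p, ‖m p‖ₑ ^ 2 * (sobW p)⁻¹ < ∞) (ψ : 𝓢(Plane, ℂ)) :
    ∫ p : Plane, starRingEnd ℂ (𝓕 ψ p) * lineDensity α k m (p 0) =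
      α * ∫ p, starRingEnd ℂ (hat (arcMeasure straightLine) ψ p) * potHat α k m p := by
  have hA := lintegral_coord_sq_mul_inv_sobW_lt_top (measurable_lineDensity hm)
    (lintegral_lineDensity_sq_lt_top hα hk hm hm2)
  have hAm : Measurable fun p : Plane => lineDensity α k m (p 0) :=
    (measurable_lineDensity hm).comp (by fun_prop)
  have hcont : Continuous fun p => 𝓕 ψ p := (𝓕 ψ : 𝓢(Plane, ℂ)).continuous
  have hψ : AEStronglyMeasurable (fun p => starRingEnd ℂ (𝓕 ψ p)) :=
    (Complex.continuous_conj.comp hcont).aestronglyMeasurable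
  have h1 : Integrable fun p : Plane => starRingEnd ℂ (𝓕 ψ p) * lineDensity α k m (p 0) := by
    have := integrable_mul_of_sobW (F := fun p => starRingEnd ℂ (𝓕 ψ p)) hψ
      hAm.aestronglyMeasurable (by simpa using lintegral_sobW_mul_fourier_sq_lt_top ψ) hA
    simpa only [mul_comm] using this
  have hS := integrable_schwartz_straightLine ψ
  have hc := continuous_hat hS
  have h2 : Integrable fun p : Plane =>
      starRingEnd ℂ (hat (arcMeasure straightLine) ψ p) * potHat α k m p := by
    refine integrable_mul_of_sobW (measurable_potHat hm).aestronglyMeasurable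
      (Complex.continuous_conj.comp hc).aestronglyMeasurable
      (lintegral_sobW_mul_potHat_sq_lt_top hα hk hm hm2) ?_
    simpa using isKato_straightLine.lintegral_hat_sq_lt_top ψ.continuous.measurable hS
      (isKato_straightLine.memLp_schwartz ψ)
  rw [integral_plane_slices h1, integral_plane_slices h2, ← integral_const_mul]
  refine integral_congr_ae (.of_forall fun s => ?_)
  simp only [hat_straightLine, planeEquiv_zero]
  rw [integral_mul_const, integral_const_mul, integral_conj,
    ← integral_potHat_slice hα hk hm hM s]
  ring

/-- The potential `∫ G^k_Σ(·, y) h(y) ν(dy)` of a density `h ∈ L²(ν)` is a Sobolev function with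
the pointwise values as traces, and solves `-Δ_Σ w - k² w = h ν` in the weak sense. -/
theorem exists_potential (hα : 0 < α) (hki : 0 < k.im)
    (hk : ∀ r : ℝ, -α ^ 2 / 4 ≤ r → k ^ 2 ≠ (r : ℂ)) {ν : Measure Plane} [IsFiniteMeasure ν]
    (hν : IsKato ν) (h : L2 ν) :
    (∀ η : Measure Plane, IsKato η → h ∈ integralOpDomain (lineKernel α k) ν η) ∧
    ∃ (φ : ℕ → 𝓢(Plane, ℂ)) (v : Fin 2 → L2 volume),
      (∀ η : Measure Plane, IsKato η → Tendsto (fun n => eLpNorm (fun x => φ n x -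
        ∫ y, lineKernel α k x y * h y ∂ν) 2 η) atTop (𝓝 0)) ∧
      (∀ j, Tendsto (fun n => eLpNorm (fun x => (∂_{unitVec j} (φ n)) x - v j x) 2 volume)
        atTop (𝓝 0)) ∧
      ∀ w : L2 volume, w =ᵐ[volume] (fun x => ∫ y, lineKernel α k x y * h y ∂ν) →
        ∀ ψ : 𝓢(Plane, ℂ), (∑ j, ⟪(∂_{unitVec j} ψ).toLp 2 volume, v j⟫_ℂ) -
          k ^ 2 * ⟪ψ.toLp 2 volume, w⟫_ℂ -
          α * ∫ x, starRingEnd ℂ (ψ x) * (∫ y, lineKernel α k x y * h y ∂ν)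
            ∂arcMeasure straightLine = ∫ x, starRingEnd ℂ (ψ x) * h x ∂ν := by
  have hk0 := sq_ne_of_nonneg hk
  have hm : Measurable h := (Lp.stronglyMeasurable h).measurable
  have h2 : MemLp h 2 ν := Lp.memLp h
  have hh : Integrable h ν := h2.integrable one_le_two
  set m := hat ν h with hmdef
  have hmm : Measurable m := (continuous_hat hh).measurable
  have hM : ∀ p, ‖m p‖ ≤ ∫ y, ‖h y‖ ∂ν := norm_hat_le ν h
  have hm2 : ∫⁻ p, ‖m p‖ₑ ^ 2 * (sobW p)⁻¹ < ∞ := hν.lintegral_hat_sq_lt_top hm hh h2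
  have hHm : AEStronglyMeasurable (potHat α k m) volume :=
    (measurable_potHat hmm).aestronglyMeasurable
  have hH := lintegral_sobW_mul_potHat_sq_lt_top hα hk hmm hm2
  obtain ⟨φ, hφ⟩ := exists_sobTendsto hHm hH
  set T : Plane → ℂ := fun x => ∫ y, lineKernel α k x y * h y ∂ν with hT
  -- `c` makes `k0 (c r)` dominate both the free kernel for `k` and those for `i (n + 1)`
  set c := min k.im 1 with hcdef
  have hc0 : 0 < c := lt_min hki one_pos
  have hfin : ∀ η : Measure Plane, IsKato η →
      ∀ᵐ x ∂η, ∫⁻ y, ‖h y‖ₑ * k0 (c * ‖x - y‖) ∂ν < ∞ := fun η hη => by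
    have := hη.isLocallyFiniteMeasure
    exact hη.lintegral_mul_k0_lt_top hm.enorm hh.2 hc0
  have hlim : ∀ η : Measure Plane, IsKato η →
      ∀ᵐ x ∂η, Tendsto (fun n => invHat (potApprox α k m n) x) atTop (𝓝 (T x)) := fun η hη => by
    filter_upwards [hfin η hη] with x hx
    exact tendsto_invHat_potApprox hα hki hk hm hh (min_le_left _ _) (min_le_right _ _) hx
  have hFi := integrable_potApprox hα hk hmm hM
  have htr : ∀ η : Measure Plane, IsKato η →
      Tendsto (fun n => eLpNorm (fun x => φ n x - T x) 2 η) atTop (𝓝 0) := fun η hη =>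
    hφ.tendsto_eLpNorm_sub hη hHm hFi (tendsto_potApprox hmm hm2) (hlim η hη)
  have hTm : ∀ η : Measure Plane, IsKato η → MemLp T 2 η := fun η hη => by
    have h3 : AEStronglyMeasurable T η := aestronglyMeasurable_of_tendsto_ae atTop
      (fun n => (continuous_invHat (hFi n)).aestronglyMeasurable) (hlim η hη)
    obtain ⟨n, hn⟩ := ((htr η hη).eventually (gt_mem_nhds one_pos)).exists
    have h4 : MemLp (fun x => φ n x - T x) 2 η :=
      ⟨(φ n).continuous.aestronglyMeasurable.sub h3, hn.trans ENNReal.one_lt_top⟩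
    refine ((hη.memLp_schwartz (φ n)).sub h4).ae_eq (.of_forall fun x => ?_)
    simp
  refine ⟨fun η hη => ⟨?_, hTm η hη⟩, φ, ?_⟩
  · filter_upwards [hfin η hη] with x hx
    exact integrable_mul_lineKernel hα hk hm hh (min_le_left _ _) hx
  choose v hv using hφ.exists_gradient hHm hH
  refine ⟨v, htr, hv, fun w hw ψ => ?_⟩
  have hφw : Tendsto (fun n => eLpNorm (fun x => φ n x - w x) 2 volume) atTop (𝓝 0) := by
    refine (htr volume isKato_volume).congr fun n => eLpNorm_congr_ae ?_
    filter_upwards [hw] with x hx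
    rw [hx]
  rw [hφ.form_eq hHm hH hφw hv ψ (k ^ 2)]
  have hcont : Continuous fun p => 𝓕 ψ p := (𝓕 ψ : 𝓢(Plane, ℂ)).continuous
  have hψ : AEStronglyMeasurable (fun p => starRingEnd ℂ (𝓕 ψ p)) :=
    (Complex.continuous_conj.comp hcont).aestronglyMeasurable
  have hψ2 : ∫⁻ p, sobW p * ‖starRingEnd ℂ (𝓕 ψ p)‖ₑ ^ 2 < ∞ := by
    simpa using lintegral_sobW_mul_fourier_sq_lt_top ψ
  -- the trace term, by approximation on the line
  have hS := integrable_schwartz_straightLine ψ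
  have hline : ∫ x, starRingEnd ℂ (ψ x) * T x ∂arcMeasure straightLine =
      ∫ p, starRingEnd ℂ (hat (arcMeasure straightLine) ψ p) * potHat α k m p := by
    have := isKato_straightLine.isLocallyFiniteMeasure
    have h3 := hφ.tendsto_integral_mul hHm hH
      (g := fun p => starRingEnd ℂ (hat (arcMeasure straightLine) ψ p))
      (Complex.continuous_conj.comp (continuous_hat hS)).aestronglyMeasurable (by
        simpa using isKato_straightLine.lintegral_hat_sq_lt_top ψ.continuous.measurable hS
          (isKato_straightLine.memLp_schwartz ψ))
    refine tendsto_nhds_unique ?_ h3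
    have h4 : ∀ n, ∫ p, starRingEnd ℂ (hat (arcMeasure straightLine) ψ p) * 𝓕 (φ n) p =
        ∫ x, starRingEnd ℂ (ψ x) * φ n x ∂arcMeasure straightLine := fun n => by
      have h5 := integral_mul_conj_hat hS (𝓕 (φ n) : 𝓢(Plane, ℂ)).integrable
      simp only [invHat_fourier] at h5
      rw [← h5]
      simp only [mul_comm]
    simp only [h4]
    have hs : MemLp ψ 2 (arcMeasure straightLine) := isKato_straightLine.memLp_schwartz ψ
    have hTl := hTm _ isKato_straightLine
    have h6 : Tendsto (fun n => ((isKato_straightLine.memLp_schwartz (φ n)).toLp :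
        L2 (arcMeasure straightLine))) atTop (𝓝 hTl.toLp) := by
      rw [Lp.tendsto_Lp_iff_tendsto_eLpNorm'']
      exact htr _ isKato_straightLine
    have h7 := (tendsto_const_nhds (x := hs.toLp ψ)).inner (𝕜 := ℂ) h6
    simpa only [inner_toLp_eq_integral] using h7
  have hA := lintegral_coord_sq_mul_inv_sobW_lt_top (measurable_lineDensity hmm)
    (lintegral_lineDensity_sq_lt_top hα hk hmm hm2)
  have hAm : Measurable fun p : Plane => lineDensity α k m (p 0) :=
    (measurable_lineDensity hmm).comp (by fun_prop)
  have hi1 := integrable_mul_of_sobW hψ hmm.aestronglyMeasurable hψ2 hm2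
  have hi2 := integrable_mul_of_sobW hψ hAm.aestronglyMeasurable hψ2 hA
  -- multiplication by the symbol leaves the source `m` and the density on the line
  have hsplit : ∫ p, starRingEnd ℂ (𝓕 ψ p) * (((4 * Real.pi ^ 2 * ‖p‖ ^ 2 : ℝ) : ℂ) - k ^ 2) *
      potHat α k m p = (∫ p, starRingEnd ℂ (𝓕 ψ p) * m p) +
        ∫ p : Plane, starRingEnd ℂ (𝓕 ψ p) * lineDensity α k m (p 0) := by
    simp only [mul_comm (starRingEnd ℂ _)]
    rw [← integral_add hi1 hi2]
    refine integral_congr_ae (.of_forall fun p => ?_)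
    have h3 := symb_ne_zero hk0 p
    rw [symb] at h3
    simp only [potHat, symb]
    field_simp
  have hfree : ∫ p, starRingEnd ℂ (𝓕 ψ p) * m p = ∫ x, starRingEnd ℂ (ψ x) * h x ∂ν := by
    have h5 := integral_mul_conj_hat hh (𝓕 ψ : 𝓢(Plane, ℂ)).integrable
    simp only [invHat_fourier] at h5
    rw [← conj_integral_mul_conj (fun p => 𝓕 ψ p) m]
    refine (congrArg (starRingEnd ℂ) h5).trans ?_
    rw [← integral_conj]
    simp [mul_comm]
  rw [hsplit, hline, hfree, integral_conj_fourier_mul_lineDensity hα hk hmm hM hm2]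
  ring

end WeakEquation

/-! ### Graphs of partially defined operators -/

section Graphs

variable {E F G : Type*} [AddCommGroup E] [Module ℂ E] [AddCommGroup F] [Module ℂ F]
  [AddCommGroup G] [Module ℂ G]

theorem exists_apply_eq_of_mem_graph {f : E →ₗ.[ℂ] F} {x : E} {y : F} (h : (x, y) ∈ f.graph) :
    ∃ hx : x ∈ f.domain, f ⟨x, hx⟩ = y := by
  obtain ⟨x', hx', hy⟩ := f.mem_graph_iff.1 h
  simp only at hx' hy
  subst hx'
  exact ⟨x'.2, hy⟩

theorem mem_graph_add {f g : E →ₗ.[ℂ] F} {x : E} {z : F} :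
    (x, z) ∈ (f + g).graph ↔ ∃ a b, (x, a) ∈ f.graph ∧ (x, b) ∈ g.graph ∧ a + b = z := by
  constructor
  · intro h
    obtain ⟨hx, h1⟩ := exists_apply_eq_of_mem_graph h
    rw [LinearPMap.add_apply] at h1
    exact ⟨_, _, f.mem_graph ⟨x, hx.1⟩, g.mem_graph ⟨x, hx.2⟩, h1⟩
  · rintro ⟨a, b, ha, hb, rfl⟩
    obtain ⟨h1, rfl⟩ := exists_apply_eq_of_mem_graph ha
    obtain ⟨h2, rfl⟩ := exists_apply_eq_of_mem_graph hb
    have h3 := (f + g).mem_graph ⟨x, h1, h2⟩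
    rwa [LinearPMap.add_apply] at h3

theorem mem_graph_opComp {g : F →ₗ.[ℂ] G} {f : E →ₗ.[ℂ] F} {x : E} {z : G}
    (h : (x, z) ∈ (opComp g f).graph) : ∃ y, (x, y) ∈ f.graph ∧ (y, z) ∈ g.graph := by
  obtain ⟨hx, h1⟩ := exists_apply_eq_of_mem_graph h
  obtain ⟨⟨y, hy, hyx⟩, hx'⟩ := id hx
  simp only [Submodule.subtype_apply] at hyx
  subst hyx
  refine ⟨f y, f.mem_graph y, ?_⟩
  have h2 : (f.domRestrict ((g.domain.comap f.toFun).map f.domain.subtype)) ⟨y, hx⟩ = f y :=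
    LinearPMap.domRestrict_apply rfl
  have h3 : opComp g f ⟨y, hx⟩ = g ⟨f y, hy⟩ := by
    change g ⟨_, _⟩ = g ⟨f y, hy⟩
    congr 1
  rw [← h1, h3]
  exact g.mem_graph ⟨f y, hy⟩

theorem mem_graph_opShift {A : E →ₗ.[ℂ] E} {z : ℂ} {x y : E} :
    (x, y) ∈ (opShift A z).graph ↔ (x, y + z • x) ∈ A.graph := by
  constructor
  · intro h
    obtain ⟨hx, h1⟩ := exists_apply_eq_of_mem_graph h
    have h2 : A ⟨x, hx.1⟩ - z • x = y := h1
    have h3 := A.mem_graph ⟨x, hx.1⟩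
    rwa [← h2, sub_add_cancel]
  · intro h
    obtain ⟨hx, h1⟩ := exists_apply_eq_of_mem_graph h
    have h2 := (opShift A z).mem_graph ⟨x, hx, trivial⟩
    have h3 : opShift A z ⟨x, hx, trivial⟩ = A ⟨x, hx⟩ - z • x := rfl
    rwa [h3, h1, add_sub_cancel_right] at h2

theorem mem_graph_inverse {f : E →ₗ.[ℂ] F} (hf : ∀ x, (x, 0) ∈ f.graph → x = 0) {x : E} {y : F} :
    (y, x) ∈ f.inverse.graph ↔ (x, y) ∈ f.graph := by
  have hker : f.toFun.ker = ⊥ := by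
    refine LinearMap.ker_eq_bot'.2 fun x hx => Subtype.ext (hf x ?_)
    have h := f.mem_graph x
    rwa [show f x = 0 from hx] at h
  rw [LinearPMap.inverse_graph hker]
  simp

theorem mem_graph_opResolvent {A : E →ₗ.[ℂ] E} {z : ℂ} (hA : ∀ x, (x, z • x) ∈ A.graph → x = 0)
    {x y : E} : (y, x) ∈ (opResolvent A z).graph ↔ (x, y + z • x) ∈ A.graph := by
  rw [opResolvent, mem_graph_inverse, mem_graph_opShift]
  intro x hx
  rw [mem_graph_opShift, zero_add] at hx
  exact hA x hx

/-- The domain of the resolvent is the range of `A - z`, also when `A - z` is not injective. -/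
theorem exists_mem_graph_of_mem_opResolvent_domain {A : E →ₗ.[ℂ] E} {z : ℂ} {y : E}
    (h : y ∈ (opResolvent A z).domain) : ∃ x, (x, y + z • x) ∈ A.graph := by
  rw [opResolvent, LinearPMap.inverse_domain] at h
  obtain ⟨x, hx⟩ := h
  refine ⟨x, mem_graph_opShift.1 ?_⟩
  have h1 := (opShift A z).mem_graph x
  rwa [show opShift A z x = y from hx] at h1

end Graphs

/-! ### Symmetric operators -/

section Symmetric

variable {E : Type*} [NormedAddCommGroup E] [InnerProductSpace ℂ E]

/-- Symmetry of a partially defined operator, in terms of its graph. -/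
def IsSymmGraph (A : E →ₗ.[ℂ] E) : Prop :=
  ∀ f u g w, (f, u) ∈ A.graph → (g, w) ∈ A.graph → ⟪u, g⟫_ℂ = ⟪f, w⟫_ℂ

/-- The quadratic form of a symmetric operator is real. -/
theorem IsSymmGraph.im_mul_norm_sq {A : E →ₗ.[ℂ] E} (hA : IsSymmGraph A) {z : ℂ} {f u : E}
    (h : (f, u + z • f) ∈ A.graph) : z.im * ‖f‖ ^ 2 = -(⟪f, u⟫_ℂ).im := by
  have h1 := hA _ _ _ _ h h
  have h2 : (⟪f, u + z • f⟫_ℂ).im = 0 := by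
    have h3 := inner_conj_symm (𝕜 := ℂ) f (u + z • f)
    rw [h1] at h3
    exact Complex.conj_eq_iff_im.1 h3
  have h4 : ⟪f, f⟫_ℂ = ((‖f‖ ^ 2 : ℝ) : ℂ) := by
    rw [inner_self_eq_norm_sq_to_K]
    push_cast
    rfl
  rw [inner_add_right, inner_smul_right, h4, Complex.add_im, Complex.im_mul_ofReal] at h2
  linarith

/-- A symmetric operator with `A - z` onto has `A - z` injective. -/
theorem IsSymmGraph.eq_zero_of_surjective {A : E →ₗ.[ℂ] E} (hA : IsSymmGraph A) {z : ℂ}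
    (hz : ∀ u, ∃ f, (f, u + z • f) ∈ A.graph) {f : E} (hf : (f, z • f) ∈ A.graph) : f = 0 := by
  rcases eq_or_ne z.im 0 with h0 | h0
  · -- a real `z`: the kernel is orthogonal to the range
    obtain ⟨g, hg⟩ := hz f
    have h1 := hA _ _ _ _ hf hg
    rw [inner_smul_left, inner_add_right, inner_smul_right, Complex.conj_eq_iff_im.2 h0] at h1
    exact inner_self_eq_zero.1 (by linear_combination -h1)
  · have h1 := hA.im_mul_norm_sq (u := 0) (by rwa [zero_add])
    rw [inner_zero_right, Complex.zero_im, neg_zero] at h1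
    simpa [h0] using h1

/-- A symmetric operator with `A - z` onto has `z` in its resolvent set: for `z` not real by the
lower bound `|Im z|` of `A - z`, for real `z` by the Hellinger-Toeplitz theorem. -/
theorem IsSymmGraph.mem_opResolventSet [CompleteSpace E] {A : E →ₗ.[ℂ] E} (hA : IsSymmGraph A)
    {z : ℂ} (hz : ∀ u, ∃ f, (f, u + z • f) ∈ A.graph) : z ∈ opResolventSet A := by
  have hinj : ∀ f, (f, z • f) ∈ A.graph → f = 0 := fun f hf => hA.eq_zero_of_surjective hz hf
  set P := opResolvent A z with hP
  have hPg : ∀ u f, (u, f) ∈ P.graph ↔ (f, u + z • f) ∈ A.graph := fun u f =>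
    mem_graph_opResolvent hinj
  have hdom : ∀ u, u ∈ P.domain := fun u => by
    obtain ⟨f, hf⟩ := hz u
    exact LinearPMap.mem_domain_of_mem_graph ((hPg u f).2 hf)
  set R : E →ₗ[ℂ] E := P.toFun ∘ₗ LinearMap.id.codRestrict P.domain hdom with hR
  have hRg : ∀ u, (R u, u + z • R u) ∈ A.graph := fun u => (hPg u _).1 (P.mem_graph ⟨u, hdom u⟩)
  have hRu : ∀ u f, (f, u + z • f) ∈ A.graph → f = R u := fun u f hf =>
    P.mem_graph_snd_inj' ((hPg u f).2 hf) ((hPg u _).2 (hRg u)) rfl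
  -- `R` is the everywhere defined inverse of `A - z`; for real `z` it is symmetric
  have hcont : Continuous R := by
    rcases eq_or_ne z.im 0 with h0 | h0
    · refine LinearMap.IsSymmetric.continuous (𝕜 := ℂ) fun u y => ?_
      have h1 := hA _ _ _ _ (hRg u) (hRg y)
      rw [inner_add_left, inner_add_right, inner_smul_right, inner_smul_left,
        Complex.conj_eq_iff_im.2 h0] at h1
      exact (add_right_cancel h1).symm
    · refine AddMonoidHomClass.continuous_of_bound R |z.im|⁻¹ fun u => ?_
      have h1 := hA.im_mul_norm_sq (hRg u)
      have h2 : |z.im| * ‖R u‖ ^ 2 ≤ ‖R u‖ * ‖u‖ := by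
        have h3 : |z.im| * ‖R u‖ ^ 2 = |(⟪R u, u⟫_ℂ).im| := by
          rw [← abs_neg (⟪R u, u⟫_ℂ).im, ← h1, abs_mul, abs_of_nonneg (sq_nonneg ‖R u‖)]
        rw [h3]
        exact (Complex.abs_im_le_norm _).trans (norm_inner_le_norm _ _)
      have h4 : 0 < |z.im| := abs_pos.2 h0
      rw [inv_mul_eq_div, le_div_iff₀ h4]
      rcases (norm_nonneg (R u)).eq_or_lt with h5 | h5
      · rw [← h5, zero_mul]
        exact norm_nonneg u
      · nlinarith
  refine ⟨⟨R, hcont⟩, fun y => ?_, fun x => ?_⟩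
  · exact exists_apply_eq_of_mem_graph (mem_graph_opShift.2 (hRg y))
  · exact (hRu _ _ (mem_graph_opShift.1 ((opShift A z).mem_graph x))).symm

end Symmetric

/-! ### Traces on Kato measures -/

/-- The restriction of a Schwartz function to a Kato measure. -/
def IsKato.restr {η : Measure Plane} (hη : IsKato η) (φ : 𝓢(Plane, ℂ)) : L2 η :=
  (hη.memLp_schwartz φ).toLp φ

theorem IsKato.coe_restr {η : Measure Plane} (hη : IsKato η) (φ : 𝓢(Plane, ℂ)) :
    hη.restr φ =ᵐ[η] φ := (hη.memLp_schwartz φ).coeFn_toLp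

theorem IsKato.restr_sub {η : Measure Plane} (hη : IsKato η) (φ ψ : 𝓢(Plane, ℂ)) :
    hη.restr (φ - ψ) = hη.restr φ - hη.restr ψ :=
  MemLp.toLp_sub (hη.memLp_schwartz φ) (hη.memLp_schwartz ψ)

theorem IsKato.tendsto_restr_iff {η : Measure Plane} (hη : IsKato η) {φ : ℕ → 𝓢(Plane, ℂ)}
    {t : L2 η} : Tendsto (fun n => hη.restr (φ n)) atTop (𝓝 t) ↔
      Tendsto (fun n => eLpNorm (fun x => φ n x - t x) 2 η) atTop (𝓝 0) := by
  rw [Lp.tendsto_Lp_iff_tendsto_eLpNorm']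
  refine tendsto_congr fun n => eLpNorm_congr_ae ?_
  filter_upwards [hη.coe_restr (φ n)] with x hx
  simp [hx]

theorem tendsto_eLpNorm_toLp {η : Measure Plane} {φ : ℕ → 𝓢(Plane, ℂ)}
    {T : Plane → ℂ} (hT : MemLp T 2 η)
    (h : Tendsto (fun n => eLpNorm (fun x => φ n x - T x) 2 η) atTop (𝓝 0)) :
    Tendsto (fun n => eLpNorm (fun x => φ n x - hT.toLp T x) 2 η) atTop (𝓝 0) := by
  refine h.congr fun n => eLpNorm_congr_ae ?_
  filter_upwards [hT.coeFn_toLp] with x hx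
  rw [hx]

theorem enorm_toLp_sq {μ : Measure Plane} {f : Plane → ℂ} (hf : MemLp f 2 μ) :
    ‖hf.toLp f‖ₑ ^ 2 = ∫⁻ x, ‖f x‖ₑ ^ 2 ∂μ := by
  rw [Lp.enorm_toLp, eLpNorm_two_sq]

/-- The trace inequality for Schwartz functions. -/
theorem IsKato.exists_norm_restr_le {η : Measure Plane} (hη : IsKato η) :
    ∃ K : ℝ, ∀ φ : 𝓢(Plane, ℂ), ‖hη.restr φ‖ ≤
      K * (‖φ.toLp 2 volume‖ + ∑ j, ‖(∂_{unitVec j} φ).toLp 2 volume‖) := by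
  obtain ⟨K, hK, h⟩ := hη.exists_lintegral_invHat_sq_le
  have h0 : ∀ φ : 𝓢(Plane, ℂ), ‖φ.toLp 2 volume‖ₑ ^ 2 = ∫⁻ x, ‖φ x‖ₑ ^ 2 := fun φ =>
    enorm_toLp_sq (φ.memLp 2 volume)
  refine ⟨√K.toReal, fun φ => ?_⟩
  have h1 := h (𝓕 φ : 𝓢(Plane, ℂ)) (𝓕 φ : 𝓢(Plane, ℂ)).integrable
  simp only [invHat_fourier] at h1
  have h2 : ‖hη.restr φ‖ₑ ^ 2 ≤ K * (‖φ.toLp 2 volume‖ₑ ^ 2 +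
      ∑ j, ‖(∂_{unitVec j} φ).toLp 2 volume‖ₑ ^ 2) := by
    simp only [h0]
    rw [IsKato.restr, enorm_toLp_sq]
    exact h1.trans (mul_le_mul' le_rfl (lintegral_sobW_mul_fourier_sq_le φ))
  rw [Fin.sum_univ_two] at h2
  have h3 := ENNReal.toReal_mono (by finiteness) h2
  rw [ENNReal.toReal_mul, ENNReal.toReal_add (by finiteness) (by finiteness),
    ENNReal.toReal_add (by finiteness) (by finiteness)] at h3
  simp only [ENNReal.toReal_pow, toReal_enorm] at h3
  set S := ‖φ.toLp 2 volume‖ + ∑ j, ‖(∂_{unitVec j} φ).toLp 2 volume‖ with hS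
  have hS0 : 0 ≤ S := by positivity
  have h4 : ‖φ.toLp 2 volume‖ ^ 2 + (‖(∂_{unitVec 0} φ).toLp 2 volume‖ ^ 2 +
      ‖(∂_{unitVec 1} φ).toLp 2 volume‖ ^ 2) ≤ S ^ 2 := by
    rw [hS, Fin.sum_univ_two]
    have a := norm_nonneg (φ.toLp 2 volume)
    have b := norm_nonneg ((∂_{unitVec 0} φ).toLp 2 volume)
    have c := norm_nonneg ((∂_{unitVec 1} φ).toLp 2 volume)
    nlinarith [mul_nonneg a b, mul_nonneg a c, mul_nonneg b c]
  refine abs_le_of_sq_le_sq' ?_ (by positivity) |>.2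
  rw [mul_pow, Real.sq_sqrt ENNReal.toReal_nonneg]
  exact h3.trans (mul_le_mul_of_nonneg_left h4 ENNReal.toReal_nonneg)

theorem schwartz_toLp_sub (φ ψ : 𝓢(Plane, ℂ)) :
    (φ - ψ).toLp 2 volume = φ.toLp 2 volume - ψ.toLp 2 volume :=
  MemLp.toLp_sub (φ.memLp 2 volume) (ψ.memLp 2 volume)

theorem lineDeriv_sub (φ ψ : 𝓢(Plane, ℂ)) (j : Fin 2) :
    ∂_{unitVec j} (φ - ψ) = ∂_{unitVec j} φ - ∂_{unitVec j} ψ := by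
  rw [sub_eq_add_neg, LineDeriv.lineDerivOp_add, LineDeriv.lineDerivOp_neg, ← sub_eq_add_neg]

/-- A sequence of Schwartz functions that converges in the Sobolev norm converges on every Kato
measure. -/
theorem IsKato.exists_tendsto_restr {η : Measure Plane} (hη : IsKato η) {φ : ℕ → 𝓢(Plane, ℂ)}
    {f : L2 volume} {v : Fin 2 → L2 volume}
    (hf : Tendsto (fun n => (φ n).toLp 2 volume) atTop (𝓝 f))
    (hv : ∀ j, Tendsto (fun n => (∂_{unitVec j} (φ n)).toLp 2 volume) atTop (𝓝 (v j))) :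
    ∃ T, Tendsto (fun n => hη.restr (φ n)) atTop (𝓝 T) := by
  obtain ⟨K, hK⟩ := hη.exists_norm_restr_le
  refine cauchySeq_tendsto_of_complete (cauchySeq_iff_tendsto_dist_atTop_0.2 ?_)
  have h1 := cauchySeq_iff_tendsto_dist_atTop_0.1 hf.cauchySeq
  have h2 := fun j => cauchySeq_iff_tendsto_dist_atTop_0.1 (hv j).cauchySeq
  have h3 := (h1.add (tendsto_finsetSum Finset.univ fun j _ => h2 j)).const_mul K
  simp only [Finset.sum_const_zero, add_zero, mul_zero] at h3
  refine squeeze_zero (fun _ => dist_nonneg) (fun n => ?_) h3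
  rw [dist_eq_norm, ← hη.restr_sub]
  refine (hK _).trans_eq ?_
  simp only [schwartz_toLp_sub, lineDeriv_sub, dist_eq_norm]

theorem inner_lineDeriv_eq (ψ φ : 𝓢(Plane, ℂ)) (j : Fin 2) :
    ⟪ψ.toLp 2 volume, (∂_{unitVec j} φ).toLp 2 volume⟫_ℂ =
      -⟪(∂_{unitVec j} ψ).toLp 2 volume, φ.toLp 2 volume⟫_ℂ := by
  rw [inner_schwartz_eq, inner_schwartz_eq, ← integral_neg]
  refine integral_congr_ae (.of_forall fun p => ?_)
  simp only [fourier_lineDeriv_apply, map_mul, Complex.conj_I, Complex.conj_ofReal, map_ofNat]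
  ring

/-- Schwartz functions are dense in `L²`. -/
theorem eq_zero_of_inner_schwartz {u : L2 volume}
    (h : ∀ ψ : 𝓢(Plane, ℂ), ⟪ψ.toLp 2 volume, u⟫_ℂ = 0) : u = 0 := by
  have hd := SchwartzMap.denseRange_toLpCLM (F := ℂ) (μ := (volume : Measure Plane))
    (p := 2) (by norm_num)
  exact hd.eq_zero_of_inner_right ℂ fun ψ => h ψ

/-- The weak gradient and the trace are determined by the function. -/
theorem IsKato.eq_zero_of_tendsto {η : Measure Plane} (hη : IsKato η) {φ : ℕ → 𝓢(Plane, ℂ)}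
    {v : Fin 2 → L2 volume} {T : L2 η}
    (hf : Tendsto (fun n => (φ n).toLp 2 volume) atTop (𝓝 0))
    (hv : ∀ j, Tendsto (fun n => (∂_{unitVec j} (φ n)).toLp 2 volume) atTop (𝓝 (v j)))
    (hT : Tendsto (fun n => hη.restr (φ n)) atTop (𝓝 T)) : v = 0 ∧ T = 0 := by
  have hv0 : v = 0 := by
    funext j
    refine eq_zero_of_inner_schwartz fun ψ => ?_
    have h1 := (tendsto_const_nhds (x := ψ.toLp 2 volume)).inner (𝕜 := ℂ) (hv j)
    have h2 := ((tendsto_const_nhds (x := (∂_{unitVec j} ψ).toLp 2 volume)).inner (𝕜 := ℂ) hf).neg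
    simp only [inner_lineDeriv_eq] at h1
    rw [inner_zero_right, neg_zero] at h2
    exact tendsto_nhds_unique h1 h2
  refine ⟨hv0, ?_⟩
  subst hv0
  obtain ⟨K, hK⟩ := hη.exists_norm_restr_le
  have h3 := (hf.norm.add (tendsto_finsetSum Finset.univ fun j _ => (hv j).norm)).const_mul K
  simp only [Pi.zero_apply, norm_zero, Finset.sum_const_zero, add_zero, mul_zero] at h3
  exact tendsto_nhds_unique hT (squeeze_zero_norm (fun n => hK (φ n)) h3)

/-- The restriction of a square integrable function to a smaller measure. -/
def restrictLp {η θ : Measure Plane} (hle : η ≤ θ) (T : L2 θ) : L2 η :=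
  ((Lp.memLp T).mono_measure hle).toLp T

theorem coe_restrictLp {η θ : Measure Plane} (hle : η ≤ θ) (T : L2 θ) :
    restrictLp hle T =ᵐ[η] T := ((Lp.memLp T).mono_measure hle).coeFn_toLp

theorem restrictLp_add {η θ : Measure Plane} (hle : η ≤ θ) (T U : L2 θ) :
    restrictLp hle (T + U) = restrictLp hle T + restrictLp hle U := by
  refine Lp.ext ?_
  filter_upwards [coe_restrictLp hle (T + U), Lp.coeFn_add (restrictLp hle T) (restrictLp hle U),
    coe_restrictLp hle T, coe_restrictLp hle U,
    (Measure.absolutelyContinuous_of_le hle).ae_le (Lp.coeFn_add T U)] with x h1 h2 h3 h4 h5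
  rw [h1, h2, h5, Pi.add_apply, Pi.add_apply, h3, h4]

theorem restrictLp_sub {η θ : Measure Plane} (hle : η ≤ θ) (T U : L2 θ) :
    restrictLp hle (T - U) = restrictLp hle T - restrictLp hle U := by
  rw [eq_sub_iff_add_eq, ← restrictLp_add, sub_add_cancel]

theorem tendsto_restr_mono {η θ : Measure Plane} (hη : IsKato η) (hθ : IsKato θ) (hle : η ≤ θ)
    {φ : ℕ → 𝓢(Plane, ℂ)} {T : L2 θ} (h : Tendsto (fun n => hθ.restr (φ n)) atTop (𝓝 T)) :
    Tendsto (fun n => hη.restr (φ n)) atTop (𝓝 (restrictLp hle T)) := by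
  refine hη.tendsto_restr_iff.2 (tendsto_eLpNorm_toLp _ ?_)
  exact tendsto_of_tendsto_of_tendsto_of_le_of_le tendsto_const_nhds
    (hθ.tendsto_restr_iff.1 h) (fun n => bot_le) fun n => eLpNorm_mono_measure _ hle

theorem IsKato.isTrace_iff {η : Measure Plane} (hη : IsKato η) {f : L2 volume}
    {v : Fin 2 → L2 volume} {t : L2 η} : IsTrace η f v t ↔ ∃ φ : ℕ → 𝓢(Plane, ℂ),
      Tendsto (fun n => (φ n).toLp 2 volume) atTop (𝓝 f) ∧
      (∀ j, Tendsto (fun n => (∂_{unitVec j} (φ n)).toLp 2 volume) atTop (𝓝 (v j))) ∧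
      Tendsto (fun n => hη.restr (φ n)) atTop (𝓝 t) := by
  simp only [IsTrace, hη.tendsto_restr_iff, tendsto_toLp_iff]

theorem mem_sobolevTriples_iff {η : Measure Plane} {f : L2 volume} {v : Fin 2 → L2 volume}
    {t : L2 η} : (f, v, t) ∈ sobolevTriples η ↔ IsTrace η f v t := by
  refine ⟨fun h => h.2, fun h => ⟨?_, h⟩⟩
  obtain ⟨φ, h1, h2, -⟩ := h
  exact hasWeakGradient_of_tendsto h1 h2

theorem IsTrace.add {η : Measure Plane} {f f' : L2 volume} {v v' : Fin 2 → L2 volume} {t t' : L2 η}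
    (h : IsTrace η f v t) (h' : IsTrace η f' v' t') : IsTrace η (f + f') (v + v') (t + t') := by
  have h1 := (sobolevTriples η).add_mem (mem_sobolevTriples_iff.2 h) (mem_sobolevTriples_iff.2 h')
  rw [Prod.mk_add_mk, Prod.mk_add_mk] at h1
  exact mem_sobolevTriples_iff.1 h1

theorem IsTrace.sub {η : Measure Plane} {f f' : L2 volume} {v v' : Fin 2 → L2 volume} {t t' : L2 η}
    (h : IsTrace η f v t) (h' : IsTrace η f' v' t') : IsTrace η (f - f') (v - v') (t - t') := by
  have h1 := (sobolevTriples η).sub_mem (mem_sobolevTriples_iff.2 h) (mem_sobolevTriples_iff.2 h')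
  rw [Prod.mk_sub_mk, Prod.mk_sub_mk] at h1
  exact mem_sobolevTriples_iff.1 h1

theorem IsKato.isTrace_unique {η : Measure Plane} (hη : IsKato η) {f : L2 volume}
    {v v' : Fin 2 → L2 volume} {t t' : L2 η} (h : IsTrace η f v t) (h' : IsTrace η f v' t') :
    v = v' ∧ t = t' := by
  have h1 := h.sub h'
  rw [sub_self] at h1
  obtain ⟨φ, h2, h3, h4⟩ := hη.isTrace_iff.1 h1
  have h5 := hη.eq_zero_of_tendsto h2 h3 h4
  exact ⟨sub_eq_zero.1 h5.1, sub_eq_zero.1 h5.2⟩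

theorem IsKato.isTrace_mono {η θ : Measure Plane} (hθ : IsKato θ) (hle : η ≤ θ) {f : L2 volume}
    {v : Fin 2 → L2 volume} {T : L2 θ} (h : IsTrace θ f v T) :
    IsTrace η f v (restrictLp hle T) := by
  obtain ⟨φ, h1, h2, h3⟩ := hθ.isTrace_iff.1 h
  exact (hθ.mono hle).isTrace_iff.2 ⟨φ, h1, h2, tendsto_restr_mono _ hθ hle h3⟩

/-- A trace on a smaller measure is the restriction of a trace. -/
theorem IsKato.exists_isTrace {η θ : Measure Plane} (hθ : IsKato θ) (hle : η ≤ θ) {f : L2 volume}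
    {v : Fin 2 → L2 volume} {t : L2 η} (h : IsTrace η f v t) :
    ∃ T, IsTrace θ f v T ∧ restrictLp hle T = t := by
  have hη := hθ.mono hle
  obtain ⟨φ, h1, h2, h3⟩ := hη.isTrace_iff.1 h
  obtain ⟨T, hT⟩ := hθ.exists_tendsto_restr h1 h2
  exact ⟨T, hθ.isTrace_iff.2 ⟨φ, h1, h2, hT⟩,
    tendsto_nhds_unique (tendsto_restr_mono hη hθ hle hT) h3⟩

theorem IsKato.isTrace_schwartz {η : Measure Plane} (hη : IsKato η) (ψ : 𝓢(Plane, ℂ)) :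
    IsTrace η (ψ.toLp 2 volume) (fun j => (∂_{unitVec j} ψ).toLp 2 volume) (hη.restr ψ) :=
  hη.isTrace_iff.2 ⟨fun _ => ψ, tendsto_const_nhds, fun _ => tendsto_const_nhds,
    tendsto_const_nhds⟩

/-- A weak equation, tested with Schwartz functions, holds for all Sobolev functions. -/
theorem IsKato.weak_eq_of_schwartz {η ν θ : Measure Plane} (hθ : IsKato θ) (hη : η ≤ θ) (hν : ν ≤ θ)
    {a : ℂ} {v : Fin 2 → L2 volume} {t : L2 η} {u : L2 volume} {h : L2 ν}
    (H : ∀ ψ : 𝓢(Plane, ℂ), (∑ j, ⟪(∂_{unitVec j} ψ).toLp 2 volume, v j⟫_ℂ) -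
      a * ⟪(hθ.mono hη).restr ψ, t⟫_ℂ =
        ⟪ψ.toLp 2 volume, u⟫_ℂ + ⟪(hθ.mono hν).restr ψ, h⟫_ℂ)
    {g : L2 volume} {w : Fin 2 → L2 volume} {U : L2 θ} (hg : IsTrace θ g w U) :
    (∑ j, ⟪w j, v j⟫_ℂ) - a * ⟪restrictLp hη U, t⟫_ℂ =
      ⟪g, u⟫_ℂ + ⟪restrictLp hν U, h⟫_ℂ := by
  obtain ⟨φ, h1, h2, h3⟩ := hθ.isTrace_iff.1 hg
  have h4 := tendsto_restr_mono (hθ.mono hη) hθ hη h3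
  have h5 := tendsto_restr_mono (hθ.mono hν) hθ hν h3
  have hl := (tendsto_finsetSum Finset.univ fun j _ =>
    (h2 j).inner (𝕜 := ℂ) (tendsto_const_nhds (x := v j))).sub
      ((h4.inner (𝕜 := ℂ) (tendsto_const_nhds (x := t))).const_mul a)
  have hr := (h1.inner (𝕜 := ℂ) (tendsto_const_nhds (x := u))).add
      (h5.inner (𝕜 := ℂ) (tendsto_const_nhds (x := h)))
  simp only [H] at hl
  exact tendsto_nhds_unique hl hr

theorem mem_deltaGraph_iff_exists {η : Measure Plane} {α : ℝ} {f u : L2 volume} :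
    (f, u) ∈ deltaGraph α η ↔ ∃ p ∈ sobolevTriples η, p.1 = f ∧
      ∀ q ∈ sobolevTriples η, deltaForm α η p q = ⟪q.1, u⟫_ℂ := Iff.rfl

theorem mem_deltaGraph_iff_isTrace {η : Measure Plane} {α : ℝ} {f u : L2 volume} :
    (f, u) ∈ deltaGraph α η ↔ ∃ v t, IsTrace η f v t ∧ ∀ g w s, IsTrace η g w s →
      (∑ j, ⟪w j, v j⟫_ℂ) - α * ⟪s, t⟫_ℂ = ⟪g, u⟫_ℂ := by
  rw [mem_deltaGraph_iff_exists]
  constructor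
  · rintro ⟨⟨f', v, t⟩, hp, hf, h⟩
    simp only at hf
    subst hf
    exact ⟨v, t, mem_sobolevTriples_iff.1 hp, fun g w s hq =>
      h (g, w, s) (mem_sobolevTriples_iff.2 hq)⟩
  · rintro ⟨v, t, hp, h⟩
    exact ⟨(f, v, t), mem_sobolevTriples_iff.2 hp, rfl, fun q hq =>
      h q.1 q.2.1 q.2.2 (mem_sobolevTriples_iff.1 hq)⟩

/-- Membership in the graph of `-Δ - α η`, with traces on a larger measure and tested with Schwartz
functions only. -/
theorem IsKato.mem_deltaGraph_iff {η θ : Measure Plane} (hθ : IsKato θ) (hη : η ≤ θ) {α : ℝ}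
    {f u : L2 volume} : (f, u) ∈ deltaGraph α η ↔ ∃ v T, IsTrace θ f v T ∧
      ∀ ψ : 𝓢(Plane, ℂ), (∑ j, ⟪(∂_{unitVec j} ψ).toLp 2 volume, v j⟫_ℂ) -
        α * ⟪(hθ.mono hη).restr ψ, restrictLp hη T⟫_ℂ = ⟪ψ.toLp 2 volume, u⟫_ℂ := by
  rw [mem_deltaGraph_iff_isTrace]
  constructor
  · rintro ⟨v, t, hp, h⟩
    obtain ⟨T, hT, hTt⟩ := hθ.exists_isTrace hη hp
    subst hTt
    exact ⟨v, T, hT, fun ψ => h _ _ _ ((hθ.mono hη).isTrace_schwartz ψ)⟩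
  · rintro ⟨v, T, hT, h⟩
    refine ⟨v, restrictLp hη T, hθ.isTrace_mono hη hT, fun g w s hq => ?_⟩
    obtain ⟨U, hU, hUs⟩ := hθ.exists_isTrace hη hq
    subst hUs
    have h1 := hθ.weak_eq_of_schwartz hη hη (a := α) (v := v) (t := restrictLp hη T) (u := u)
      (h := 0) (fun ψ => by rw [inner_zero_right, add_zero, h]) hU
    rwa [inner_zero_right, add_zero] at h1

/-- The pairs `(f, u)` of the graph of `-Δ - α η` form the graph of an operator. -/
theorem IsKato.mem_graph_toLinearPMap {η : Measure Plane} (hη : IsKato η) {α : ℝ}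
    {f u : L2 volume} : (f, u) ∈ (deltaGraph α η).toLinearPMap.graph ↔ (f, u) ∈ deltaGraph α η := by
  rw [Submodule.toLinearPMap_graph_eq]
  rintro ⟨f, u⟩ h hf
  simp only at hf ⊢
  subst hf
  obtain ⟨v, T, hT, h1⟩ := (hη.mem_deltaGraph_iff le_rfl).1 h
  obtain ⟨φ, h2, h3, h4⟩ := hη.isTrace_iff.1 hT
  obtain ⟨rfl, rfl⟩ := hη.eq_zero_of_tendsto h2 h3 h4
  have h5 := restrictLp_sub (le_refl η) 0 0
  rw [sub_self, sub_self] at h5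
  refine eq_zero_of_inner_schwartz fun ψ => ?_
  rw [← h1 ψ, h5]
  simp

theorem inner_conj_deltaForm {η : Measure Plane} (α : ℝ)
    (p q : L2 volume × (Fin 2 → L2 volume) × L2 η) :
    starRingEnd ℂ (deltaForm α η p q) = deltaForm α η q p := by
  simp only [deltaForm, map_sub, map_sum, map_mul, inner_conj_symm, Complex.conj_ofReal]

/-- The operator `-Δ - α η` is symmetric. -/
theorem IsKato.isSymmGraph {η : Measure Plane} (hη : IsKato η) (α : ℝ) :
    IsSymmGraph (deltaGraph α η).toLinearPMap := by
  intro f u g w hf hg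
  obtain ⟨p, hp, rfl, h1⟩ := hη.mem_graph_toLinearPMap.1 hf
  obtain ⟨q, hq, rfl, h2⟩ := hη.mem_graph_toLinearPMap.1 hg
  rw [← h2 p hp, ← inner_conj_symm, ← h1 q hq, inner_conj_deltaForm]

/-! ### The Krein formula -/

theorem le_arcMeasure_union_right (Γ : Set Plane) :
    arcMeasure straightLine ≤ arcMeasure (Γ ∪ straightLine) :=
  arcMeasure_mono Set.subset_union_right

theorem le_arcMeasure_union_left (Γ : Set Plane) : arcMeasure Γ ≤ arcMeasure (Γ ∪ straightLine) :=
  arcMeasure_mono Set.subset_union_left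

theorem nuMeasure_le_arcMeasure_union (Γ : Set Plane) :
    nuMeasure Γ ≤ arcMeasure (Γ ∪ straightLine) :=
  arcMeasure_mono (symmDiff_subset_union Γ)

open Classical in
/-- The sign of the perturbation on the symmetric difference: `1` where a part of the line is
removed, `-1` where an arc is added. -/
def lineSign (x : Plane) : ℂ := if x ∈ straightLine then 1 else -1

theorem lineSign_mul_self (x : Plane) : lineSign x * lineSign x = 1 := by
  unfold lineSign
  split_ifs <;> norm_num

theorem norm_lineSign (x : Plane) : ‖lineSign x‖ = 1 := by
  unfold lineSign
  split_ifs <;> simp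

theorem measurable_lineSign : Measurable lineSign :=
  Measurable.ite measurableSet_straightLine measurable_const measurable_const

theorem memLp_lineSign_mul {Γ : Set Plane} (h : L2 (nuMeasure Γ)) :
    MemLp (fun x => lineSign x * h x) 2 (nuMeasure Γ) := by
  refine (Lp.memLp h).of_le
    (measurable_lineSign.aestronglyMeasurable.mul (Lp.aestronglyMeasurable h))
    (.of_forall fun x => ?_)
  rw [norm_mul, norm_lineSign, one_mul]

/-- Multiplication by the sign. -/
def signMul {Γ : Set Plane} (h : L2 (nuMeasure Γ)) : L2 (nuMeasure Γ) :=
  (memLp_lineSign_mul h).toLp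

theorem coe_signMul {Γ : Set Plane} (h : L2 (nuMeasure Γ)) :
    signMul h =ᵐ[nuMeasure Γ] fun x => lineSign x * h x := (memLp_lineSign_mul h).coeFn_toLp

theorem signMul_signMul {Γ : Set Plane} (h : L2 (nuMeasure Γ)) : signMul (signMul h) = h := by
  refine Lp.ext ?_
  filter_upwards [coe_signMul (signMul h), coe_signMul h] with x h1 h2
  rw [h1, h2, ← mul_assoc, lineSign_mul_self, one_mul]

theorem signMul_smul {Γ : Set Plane} (c : ℂ) (h : L2 (nuMeasure Γ)) :
    signMul (c • h) = c • signMul h := by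
  refine Lp.ext ?_
  filter_upwards [coe_signMul (c • h), coe_signMul h, Lp.coeFn_smul c h,
    Lp.coeFn_smul c (signMul h)] with x h1 h2 h3 h4
  rw [h1, h3, h4, Pi.smul_apply, Pi.smul_apply, h2, smul_eq_mul, smul_eq_mul]
  ring

theorem inner_restr_eq_integral {η : Measure Plane} (hη : IsKato η) (ψ : 𝓢(Plane, ℂ)) (t : L2 η) :
    ⟪hη.restr ψ, t⟫_ℂ = ∫ x, starRingEnd ℂ (ψ x) * t x ∂η := by
  rw [L2.inner_def]
  refine integral_congr_ae ?_
  filter_upwards [hη.coe_restr ψ] with x hx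
  rw [hx, RCLike.inner_apply, mul_comm]

/-- The integral over `Γ` is the integral over the line, corrected on the symmetric difference. -/
theorem integral_arcMeasure_eq {Γ : Set Plane} (hΓ : MeasurableSet Γ) {F : Plane → ℂ}
    (hF : Integrable F (arcMeasure (Γ ∪ straightLine))) :
    ∫ x, F x ∂arcMeasure Γ =
      ∫ x, F x ∂arcMeasure straightLine - ∫ x, lineSign x * F x ∂nuMeasure Γ := by
  have hS := measurableSet_straightLine
  have hΓi : IntegrableOn F Γ (Measure.hausdorffMeasure 1) :=
    IntegrableOn.mono_set hF Set.subset_union_left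
  have hSi : IntegrableOn F straightLine (Measure.hausdorffMeasure 1) :=
    IntegrableOn.mono_set hF Set.subset_union_right
  have hd1 := hΓi.mono_set (Set.sdiff_subset (t := straightLine))
  have hd2 := hSi.mono_set (Set.sdiff_subset (t := Γ))
  have e1 : Set.EqOn (fun x => lineSign x * F x) (fun x => -F x) (Γ \ straightLine) := fun x hx => by
    simp [lineSign, hx.2]
  have e2 : Set.EqOn (fun x => lineSign x * F x) F (straightLine \ Γ) := fun x hx => by
    simp [lineSign, hx.1]
  have h1 := integral_inter_add_sdiff hS hΓi
  have h2 := integral_inter_add_sdiff hΓ hSi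
  have h3 : ∫ x in symmDiff Γ straightLine, lineSign x * F x ∂Measure.hausdorffMeasure 1 =
      -(∫ x in Γ \ straightLine, F x ∂Measure.hausdorffMeasure 1) +
        ∫ x in straightLine \ Γ, F x ∂Measure.hausdorffMeasure 1 := by
    rw [Set.symmDiff_def, setIntegral_union disjoint_sdiff_sdiff (hS.diff hΓ)
      (hd1.neg.congr_fun e1.symm (hΓ.diff hS)) (hd2.congr_fun e2.symm (hS.diff hΓ)),
      setIntegral_congr_fun (hΓ.diff hS) e1, setIntegral_congr_fun (hS.diff hΓ) e2, integral_neg]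
  rw [Set.inter_comm] at h2
  change ∫ x in Γ, F x ∂Measure.hausdorffMeasure 1 =
    ∫ x in straightLine, F x ∂Measure.hausdorffMeasure 1 -
      ∫ x in symmDiff Γ straightLine, lineSign x * F x ∂Measure.hausdorffMeasure 1
  rw [h3, ← h1, ← h2]
  ring

section Krein

variable {α : ℝ} {k : ℂ} {Γ : Set Plane}

/-- The form on `Γ` in terms of the forms on the line and on the symmetric difference. -/
theorem IsLocalDeformation.inner_restr_eq (hΓ : IsLocalDeformation Γ) (ψ : 𝓢(Plane, ℂ))
    (T : L2 (arcMeasure (Γ ∪ straightLine))) :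
    ⟪(hΓ.isKato.mono (le_arcMeasure_union_left Γ)).restr ψ,
      restrictLp (le_arcMeasure_union_left Γ) T⟫_ℂ =
    ⟪(hΓ.isKato.mono (le_arcMeasure_union_right Γ)).restr ψ,
      restrictLp (le_arcMeasure_union_right Γ) T⟫_ℂ -
    ⟪(hΓ.isKato.mono (nuMeasure_le_arcMeasure_union Γ)).restr ψ,
      signMul (restrictLp (nuMeasure_le_arcMeasure_union Γ) T)⟫_ℂ := by
  have hF : Integrable (fun x => starRingEnd ℂ (ψ x) * T x) (arcMeasure (Γ ∪ straightLine)) := by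
    have h1 := L2.integrable_inner (𝕜 := ℂ) (hΓ.isKato.restr ψ) T
    refine h1.congr ?_
    filter_upwards [hΓ.isKato.coe_restr ψ] with x hx
    rw [hx, RCLike.inner_apply, mul_comm]
  have h1 := integral_arcMeasure_eq hΓ.measurableSet hF
  have h2 : ∀ (η : Measure Plane) (hη : η ≤ arcMeasure (Γ ∪ straightLine)),
      ⟪(hΓ.isKato.mono hη).restr ψ, restrictLp hη T⟫_ℂ =
        ∫ x, starRingEnd ℂ (ψ x) * T x ∂η := fun η hη => by
    rw [inner_restr_eq_integral]
    refine integral_congr_ae ?_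
    filter_upwards [coe_restrictLp hη T] with x hx
    rw [hx]
  rw [h2, h2, h1, inner_restr_eq_integral]
  congr 1
  refine integral_congr_ae ?_
  filter_upwards [coe_signMul (restrictLp (nuMeasure_le_arcMeasure_union Γ) T),
    coe_restrictLp (nuMeasure_le_arcMeasure_union Γ) T] with x hx hx'
  rw [hx, hx']
  ring

/-- The potential of a density on the symmetric difference: it is in the range of `R_{Σ,ν}`, its
trace is given by `R_{Σ,νν}`, and it solves the weak equation. -/
theorem IsLocalDeformation.exists_potential (hΓ : IsLocalDeformation Γ) (hα : 0 < α)
    (hki : 0 < k.im) (hk : ∀ r : ℝ, -α ^ 2 / 4 ≤ r → k ^ 2 ≠ (r : ℂ)) (h : L2 (nuMeasure Γ)) :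
    ∃ (w : L2 volume) (v : Fin 2 → L2 volume) (T : L2 (arcMeasure (Γ ∪ straightLine))),
      (h, w) ∈ (lineResolventNu α k Γ).graph ∧ IsTrace _ w v T ∧
      (h, restrictLp (nuMeasure_le_arcMeasure_union Γ) T) ∈ (lineResolventNuNu α k Γ).graph ∧
      ∀ ψ : 𝓢(Plane, ℂ), (∑ j, ⟪(∂_{unitVec j} ψ).toLp 2 volume, v j⟫_ℂ) -
        α * ⟪(hΓ.isKato.mono (le_arcMeasure_union_right Γ)).restr ψ,
          restrictLp (le_arcMeasure_union_right Γ) T⟫_ℂ =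
        ⟪ψ.toLp 2 volume, k ^ 2 • w⟫_ℂ +
          ⟪(hΓ.isKato.mono (nuMeasure_le_arcMeasure_union Γ)).restr ψ, h⟫_ℂ := by
  have := hΓ.isFiniteMeasure_nuMeasure
  have hν := hΓ.isKato.mono (nuMeasure_le_arcMeasure_union Γ)
  obtain ⟨hmem, φ, v, h1, h2, h3⟩ := LeakyWire.exists_potential hα hki hk hν h
  have hw := (hmem _ isKato_volume).2
  have hT := (hmem _ hΓ.isKato).2
  have hTν := (hmem _ hν).2
  have hTcoe : ∀ (η : Measure Plane) (hη : η ≤ arcMeasure (Γ ∪ straightLine)),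
      restrictLp hη (hT.toLp _) =ᵐ[η] fun x => ∫ y, lineKernel α k x y * h y ∂nuMeasure Γ :=
    fun η hη => (coe_restrictLp hη _).trans
      ((Measure.absolutelyContinuous_of_le hη).ae_le hT.coeFn_toLp)
  refine ⟨hw.toLp, v, hT.toLp, (lineResolventNu α k Γ).mem_graph ⟨h, hmem _ isKato_volume⟩,
    ⟨φ, tendsto_eLpNorm_toLp hw (h1 _ isKato_volume), h2,
      tendsto_eLpNorm_toLp hT (h1 _ hΓ.isKato)⟩, ?_, fun ψ => ?_⟩
  · have h4 : restrictLp (nuMeasure_le_arcMeasure_union Γ) (hT.toLp _) = hTν.toLp _ :=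
      Lp.ext ((hTcoe _ _).trans hTν.coeFn_toLp.symm)
    rw [h4]
    exact (lineResolventNuNu α k Γ).mem_graph ⟨h, hmem _ hν⟩
  · have h4 := h3 hw.toLp hw.coeFn_toLp ψ
    rw [inner_restr_eq_integral, inner_restr_eq_integral, ← h4, inner_smul_right]
    have h5 : ∫ x, starRingEnd ℂ (ψ x) * restrictLp (le_arcMeasure_union_right Γ) (hT.toLp _) x
        ∂arcMeasure straightLine = ∫ x, starRingEnd ℂ (ψ x) *
          (∫ y, lineKernel α k x y * h y ∂nuMeasure Γ) ∂arcMeasure straightLine := by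
      refine integral_congr_ae ?_
      filter_upwards [hTcoe _ (le_arcMeasure_union_right Γ)] with x hx
      rw [hx]
    rw [h5]
    ring

theorem mem_graph_theta {h r : L2 (nuMeasure Γ)} (hr : (h, r) ∈ (lineResolventNuNu α k Γ).graph) :
    (h, -((α : ℂ)⁻¹ • signMul h + r)) ∈ (theta α k Γ).graph := by
  obtain ⟨hd, rfl⟩ := exists_apply_eq_of_mem_graph hr
  exact (theta α k Γ).mem_graph ⟨h, memLp_lineSign_mul h, hd⟩

theorem eq_zero_of_hasBoundedInverse {E : Type*} [NormedAddCommGroup E] [NormedSpace ℂ E]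
    {A : E →ₗ.[ℂ] E} (hA : HasBoundedInverse A) (x : E) (hx : (x, 0) ∈ A.graph) : x = 0 := by
  obtain ⟨B, -, hB⟩ := hA
  obtain ⟨hd, h0⟩ := exists_apply_eq_of_mem_graph hx
  have h1 := hB ⟨x, hd⟩
  rw [h0, map_zero] at h1
  exact h1.symm

/-- The transposed operator `(R_{Σ,ν})^*` is the resolvent of the line followed by the trace. -/
theorem IsLocalDeformation.eq_restrictLp_of_mem_graph (hΓ : IsLocalDeformation Γ) (hα : 0 < α)
    (hki : 0 < k.im) (hk : ∀ r : ℝ, -α ^ 2 / 4 ≤ r → k ^ 2 ≠ (r : ℂ)) {u f : L2 volume}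
    {t : L2 (nuMeasure Γ)} (ht : (u, t) ∈ (lineResolventNuStar α k Γ).graph)
    {v : Fin 2 → L2 volume} {T : L2 (arcMeasure (Γ ∪ straightLine))} (hT : IsTrace _ f v T)
    (hf : ∀ ψ : 𝓢(Plane, ℂ), (∑ j, ⟪(∂_{unitVec j} ψ).toLp 2 volume, v j⟫_ℂ) -
      α * ⟪(hΓ.isKato.mono (le_arcMeasure_union_right Γ)).restr ψ,
        restrictLp (le_arcMeasure_union_right Γ) T⟫_ℂ =
      ⟪ψ.toLp 2 volume, u + k ^ 2 • f⟫_ℂ) :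
    t = restrictLp (nuMeasure_le_arcMeasure_union Γ) T := by
  -- the adjoint is that of the operator with the parameter `k' = -k̄`, and `k'²` is the conjugate
  -- of `k²`
  set k' : ℂ := -(starRingEnd ℂ k) with hk'
  have hki' : 0 < k'.im := by simpa [hk'] using hki
  have hsq : k' ^ 2 = starRingEnd ℂ (k ^ 2) := by rw [hk', neg_sq, map_pow]
  have hk2' : ∀ r : ℝ, -α ^ 2 / 4 ≤ r → k' ^ 2 ≠ (r : ℂ) := fun r hr h0 => by
    refine hk r hr ?_
    rw [hsq] at h0
    rw [← Complex.conj_conj (k ^ 2), h0, Complex.conj_ofReal]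
  -- without density of the domain the adjoint would be the junk value `0`
  have hdense : Dense ((lineResolventNu α k' Γ).domain : Set (L2 (nuMeasure Γ))) := by
    have htop : (lineResolventNu α k' Γ).domain = ⊤ := by
      refine Submodule.eq_top_iff'.2 fun h => ?_
      obtain ⟨w, -, -, hw, -⟩ := hΓ.exists_potential hα hki' hk2' h
      exact LinearPMap.mem_domain_of_mem_graph hw
    rw [htop]
    exact dense_univ
  obtain ⟨hu, rfl⟩ := exists_apply_eq_of_mem_graph ht
  refine ext_inner_left ℂ fun h => ?_
  obtain ⟨w, v', T', hw, hT', -, hw'⟩ := hΓ.exists_potential hα hki' hk2' h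
  obtain ⟨hd, rfl⟩ := exists_apply_eq_of_mem_graph hw
  have h1 := LinearPMap.adjoint_isFormalAdjoint hdense ⟨u, hu⟩ ⟨h, hd⟩
  -- Green's formula for the two functions
  have h2 := hΓ.isKato.weak_eq_of_schwartz (le_arcMeasure_union_right Γ)
    (nuMeasure_le_arcMeasure_union Γ) hw' hT
  have h3 := hΓ.isKato.weak_eq_of_schwartz (le_arcMeasure_union_right Γ)
    (le_arcMeasure_union_right Γ) (a := α) (v := v)
    (t := restrictLp (le_arcMeasure_union_right Γ) T) (u := u + k ^ 2 • f) (h := 0)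
    (fun ψ => by rw [inner_zero_right, add_zero, hf]) hT'
  rw [inner_zero_right, add_zero, inner_add_right, inner_smul_right] at h3
  have h4 := congrArg (starRingEnd ℂ) h2
  simp only [map_sub, map_sum, map_mul, map_add, inner_conj_symm, Complex.conj_ofReal] at h4
  rw [h3, inner_smul_left, hsq, Complex.conj_conj, add_comm] at h4
  have h5 := congrArg (starRingEnd ℂ) h1
  rw [inner_conj_symm, inner_conj_symm] at h5
  exact h5.trans (add_left_cancel h4)

theorem exists_mem_graph_of_mem_domain {E F : Type*} [AddCommGroup E] [Module ℂ E] [AddCommGroup F]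
    [Module ℂ F] {A : E →ₗ.[ℂ] F} {x : E} (hx : x ∈ A.domain) : ∃ y, (x, y) ∈ A.graph :=
  ⟨_, A.mem_graph ⟨x, hx⟩⟩

/-- If the right hand side of the Krein formula is defined everywhere, the resolvent of the line
operator is. -/
theorem exists_line_resolvent (hdom : (kreinResolvent α k Γ).domain = ⊤) (u : L2 volume) :
    ∃ f, (f, u + k ^ 2 • f) ∈ (deltaOperator α straightLine).graph := by
  have hu : u ∈ (kreinResolvent α k Γ).domain := by rw [hdom]; trivial
  exact exists_mem_graph_of_mem_opResolvent_domain hu.1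

theorem line_resolvent_injective (hdom : (kreinResolvent α k Γ).domain = ⊤) (f : L2 volume)
    (hf : (f, k ^ 2 • f) ∈ (deltaOperator α straightLine).graph) : f = 0 :=
  (isKato_straightLine.isSymmGraph α).eq_zero_of_surjective (exists_line_resolvent hdom) hf

/-- The functions given by the Krein formula solve the equation `(-Δ_Γ - k²) f = u`. -/
theorem IsLocalDeformation.mem_graph_of_mem_graph_krein (hΓ : IsLocalDeformation Γ) (hα : 0 < α)
    (hki : 0 < k.im) (hk : ∀ r : ℝ, -α ^ 2 / 4 ≤ r → k ^ 2 ≠ (r : ℂ))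
    (hΘ : HasBoundedInverse (theta α k Γ)) (hdom : (kreinResolvent α k Γ).domain = ⊤)
    {u f : L2 volume} (h : (u, f) ∈ (kreinResolvent α k Γ).graph) :
    (f, u + k ^ 2 • f) ∈ (deltaOperator α Γ).graph := by
  have hσ := hΓ.isKato.mono (le_arcMeasure_union_right Γ)
  have hγ := hΓ.isKato.mono (le_arcMeasure_union_left Γ)
  have hα0 : (α : ℂ) ≠ 0 := Complex.ofReal_ne_zero.2 hα.ne'
  obtain ⟨f₀, w, h1, h2, rfl⟩ := mem_graph_add.1 h
  obtain ⟨g, h3, h4⟩ := mem_graph_opComp h2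
  obtain ⟨t, h5, h6⟩ := mem_graph_opComp h3
  rw [mem_graph_inverse (eq_zero_of_hasBoundedInverse hΘ)] at h6
  rw [lineResolvent, mem_graph_opResolvent (line_resolvent_injective hdom)] at h1
  obtain ⟨v₀, T₀, hT₀, hf₀⟩ := (hΓ.isKato.mem_deltaGraph_iff (le_arcMeasure_union_right Γ)).1
    (hσ.mem_graph_toLinearPMap.1 h1)
  have ht := hΓ.eq_restrictLp_of_mem_graph hα hki hk h5 hT₀ hf₀
  obtain ⟨w', v, T, hw, hT, hr, hweq⟩ := hΓ.exists_potential hα hki hk g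
  obtain rfl : w' = w := LinearPMap.mem_graph_snd_inj' _ hw h4 rfl
  have hΘg : t = -((α : ℂ)⁻¹ • signMul g + restrictLp (nuMeasure_le_arcMeasure_union Γ) T) :=
    LinearPMap.mem_graph_snd_inj' _ h6 (mem_graph_theta hr) rfl
  -- the density is the jump `-α sgn f` of the two equations
  have hg : g = -((α : ℂ) • signMul (restrictLp (nuMeasure_le_arcMeasure_union Γ) (T₀ + T))) := by
    have h7 : restrictLp (nuMeasure_le_arcMeasure_union Γ) (T₀ + T) =
        (-(α : ℂ)⁻¹) • signMul g := by
      rw [restrictLp_add, ← ht, hΘg, neg_smul]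
      abel
    rw [h7, signMul_smul, signMul_signMul, smul_smul, mul_neg, mul_inv_cancel₀ hα0, neg_smul,
      one_smul, neg_neg]
  refine hγ.mem_graph_toLinearPMap.2
    ((hΓ.isKato.mem_deltaGraph_iff (le_arcMeasure_union_left Γ)).2 ⟨_, _, hT₀.add hT, fun ψ => ?_⟩)
  have h8 := hf₀ ψ
  have h9 := hweq ψ
  rw [hg, inner_neg_right] at h9
  rw [hΓ.inner_restr_eq ψ (T₀ + T), restrictLp_add (le_arcMeasure_union_right Γ)]
  simp only [Pi.add_apply, inner_add_right, inner_smul_right, Finset.sum_add_distrib, smul_add]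
    at h8 h9 ⊢
  linear_combination h8 + h9

/-- The operator `-Δ_Γ - k²` is injective: an eigenfunction is the potential of a density in the
kernel of `Θ`. -/
theorem IsLocalDeformation.injective (hΓ : IsLocalDeformation Γ) (hα : 0 < α)
    (hki : 0 < k.im) (hk : ∀ r : ℝ, -α ^ 2 / 4 ≤ r → k ^ 2 ≠ (r : ℂ))
    (hΘ : HasBoundedInverse (theta α k Γ)) (hdom : (kreinResolvent α k Γ).domain = ⊤)
    {f : L2 volume} (h : (f, k ^ 2 • f) ∈ (deltaOperator α Γ).graph) : f = 0 := by
  have hσ := hΓ.isKato.mono (le_arcMeasure_union_right Γ)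
  have hγ := hΓ.isKato.mono (le_arcMeasure_union_left Γ)
  have hα0 : (α : ℂ) ≠ 0 := Complex.ofReal_ne_zero.2 hα.ne'
  obtain ⟨v, T, hT, hf⟩ := (hΓ.isKato.mem_deltaGraph_iff (le_arcMeasure_union_left Γ)).1
    (hγ.mem_graph_toLinearPMap.1 h)
  -- the density that the equation for `f` puts on the symmetric difference, relative to the line
  set g : L2 (nuMeasure Γ) :=
    -((α : ℂ) • signMul (restrictLp (nuMeasure_le_arcMeasure_union Γ) T)) with hg
  obtain ⟨w, v', T', hw, hT', hr, hweq⟩ := hΓ.exists_potential hα hki hk g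
  -- `f - w` is in the kernel of `-Δ_Σ - k²`
  have hfw : f - w = 0 := by
    refine line_resolvent_injective hdom _ (hσ.mem_graph_toLinearPMap.2
      ((hΓ.isKato.mem_deltaGraph_iff (le_arcMeasure_union_right Γ)).2
        ⟨_, _, hT.sub hT', fun ψ => ?_⟩))
    have h8 := hf ψ
    have h9 := hweq ψ
    rw [hg, inner_neg_right] at h9
    rw [hΓ.inner_restr_eq ψ T] at h8
    rw [restrictLp_sub (le_arcMeasure_union_right Γ)]
    simp only [Pi.sub_apply, inner_sub_right, inner_smul_right, Finset.sum_sub_distrib, smul_sub]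
      at h8 h9 ⊢
    linear_combination h8 - h9
  obtain rfl : f = w := sub_eq_zero.1 hfw
  obtain ⟨-, rfl⟩ := hΓ.isKato.isTrace_unique hT hT'
  have hg0 : g = 0 := by
    refine eq_zero_of_hasBoundedInverse hΘ g ?_
    have h10 := mem_graph_theta hr
    -- by the choice of `g` the two terms of `Θ g` cancel
    have hz : (α : ℂ)⁻¹ • signMul g + restrictLp (nuMeasure_le_arcMeasure_union Γ) T = 0 := by
      rw [hg, ← neg_smul, signMul_smul, signMul_signMul, smul_smul, mul_neg, inv_mul_cancel₀ hα0,
        neg_smul, one_smul, neg_add_cancel]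
    rwa [hz, neg_zero] at h10
  rw [hg0] at hw
  exact LinearPMap.graph_fst_eq_zero_snd _ hw rfl

end Krein

end LeakyWire

end

theorem mainTheorem1 (α : ℝ) (hα : 0 < α) (Γ : Set LeakyWire.Plane)
    (hΓ : LeakyWire.IsLocalDeformation Γ) (k : ℂ) (hk : 0 < k.im)
    (hk2 : ∀ r : ℝ, -α ^ 2 / 4 ≤ r → k ^ 2 ≠ (r : ℂ))
    (hΘ : LeakyWire.HasBoundedInverse (LeakyWire.theta α k Γ))
    (hdom : (LeakyWire.kreinResolvent α k Γ).domain = ⊤) :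
    k ^ 2 ∈ LeakyWire.opResolventSet (LeakyWire.deltaOperator α Γ) ∧
      LeakyWire.opResolvent (LeakyWire.deltaOperator α Γ) (k ^ 2) =
        LeakyWire.kreinResolvent α k Γ := by
  have htotal : ∀ u, ∃ f, (u, f) ∈ (LeakyWire.kreinResolvent α k Γ).graph := fun u =>
    LeakyWire.exists_mem_graph_of_mem_domain (by rw [hdom]; trivial)
  have hsol := fun u f => hΓ.mem_graph_of_mem_graph_krein hα hk hk2 hΘ hdom (u := u) (f := f)
  have hγ := hΓ.isKato.mono (LeakyWire.le_arcMeasure_union_left Γ)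
  refine ⟨(hγ.isSymmGraph α).mem_opResolventSet fun u => ?_, ?_⟩
  · obtain ⟨f, hf⟩ := htotal u
    exact ⟨f, hsol u f hf⟩
  · have hres := fun u f => LeakyWire.mem_graph_opResolvent (y := u) (x := f)
      fun f hf => hΓ.injective hα hk hk2 hΘ hdom (f := f) hf
    refine LinearPMap.eq_of_eq_graph (Submodule.ext ?_)
    rintro ⟨u, f⟩
    refine ⟨fun h => ?_, fun h => (hres u f).2 (hsol u f h)⟩
    obtain ⟨f', hf'⟩ := htotal u
    have h1 := (hres u f').2 (hsol u f' hf')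
    obtain rfl : f = f' := LinearPMap.mem_graph_snd_inj' _ h h1 rfl
    exact hf'
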